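/- **Setting.** Let $T>0$, $\Omega=(0,1)$, $Q=\Omega\times(0,T)$. Let $a\in C([0,1])\cap C^1((0,1])$ satisfy $a(0)=0$, $a>0$ on $(0,1]$, $x a'(x)\le K a(x)$ on $(0,1]$ for some $K\in(0,1]$, and $a(xy)=a(x)a(y)$ for $x,y\in[0,1]$. Let $\ell\in C^1([0,T])$ be positive, with $a$ also defined at the points $\ell(t)x$ and $a(\ell(t)x)=a(\ell(t))a(x)$ for $t\in[0,T]$, $x\in[0,1]$ (automatic if $\ell\le 1$). Put $$b(t)=\frac{a(\ell(t))}{\ell(t)^2},\qquad B(x,t)=\frac{\ell'(t)\,x}{\ell(t)\sqrt{a(x)}} .$$ For $k=1,2$ let $F_k\in C^2(\mathbb R^2)$ with $F_k(0,0)=0$ and with bounded first and second derivatives. Let $\mathcal O,\mathcal O_1,\mathcal O_2,\mathcal O_{1,d},\mathcal O_{2,d}\subset\Omega$ be measurable, $\alpha_1,\alpha_2>0$, and let $\rho_*$ be continuous on $(0,T)$ and bounded below by a positive constant ($\rho_*$ may blow up at $0$ and $T$). Let $H^1_a(\Omega)$ be the closure of $C_c^\infty(\Omega)$ in the norm $(\|u\|_{L^2}^2+\|\sqrt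 a\,u_x\|_{L^2}^2)^{1/2}$. Let $y_1^0,y_2^0\in H^1_a(\Omega)$, $y^i_{k,d}\in L^\infty(\mathcal O_{i,d}\times(0,T))$ for $i,k\in\{1,2\}$, and $h\in L^2(\mathcal O\times(0,T))$. For $v^i\in L^2(\mathcal O_i\times(0,T))$ let $(y_1,y_2)\in L^2(0,T;H^1_a(\Omega))^2$ be the weak solution of $$\begin{cases} y_{1,t}-b(a y_{1,x})_x-B\sqrt a\,y_{1,x}+F_1(y_1,y_2)=h1_{\mathcal O}+v^11_{\mathcal O_1}+v^21_{\mathcal O_2} & \text{in }Q,\\ y_{2,t}-b(a y_{2,x})_x-B\sqrt a\,y_{2,x}+F_2(y_1,y_2)=0& \text{in }Q,\\ y_k(0,t)=y_k(1,t)=0,\qquad y_k(\cdot,0)=y_k^0,& k=1,2,\end{cases}$$ and for $\mu_1,\mu_2>0$ put $$J_i(h;v^1,v^2)=\frac{\alpha_i}{2}\iint_{\mathcal O_{i,d}\times(0,T)}\big(|y_1-y^i_{1,d}|^2+|y_2-y^i_{2,d}|^2\big)\,dx\,dt+\frac{\mu_i}{2}\iint_{\mathcal O_i\times(0,T)}\rho_*^2|v^i|^2\,dx\,dt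 .$$ Let $\mathcal V_i=\{v\in L^2(\mathcal O_i\times(0,T)):\rho_*v\in L^2(\mathcal O_i\times(0,T))\}$ be the space of controls of finite cost of follower $i$ (it equals $L^2(\mathcal O_i\times(0,T))$ if $\rho_*$ is bounded). A pair $(v^1,v^2)\in\mathcal V_1\times\mathcal V_2$ is a *Nash equilibrium* if, for $i=1,2$, $v^i$ minimizes $J_i$ over $\mathcal V_i$ with respect to the $i$-th follower control, the other one being fixed; it is a *Nash quasi-equilibrium* if, for $i=1,2$, the Gateaux derivative of $J_i$ with respect to the $i$-th follower control vanishes at $(v^1,v^2)$ in every direction of $\mathcal V_i$. We write $D_i^2J_i$ for the second Gateaux derivative with respect to the $i$-th follower control, i.e. $D_i^2J_i(\tilde v,\bar v)=\frac{d}{d\lambda}\big\langle D_iJ_i(\cdot+\lambda\tilde v),\bar v\big\rangle\big|_{\lambda=0}$. **Theorem.** There is a constant $C>0$, independent of $\mu_1,\mu_2$, such that for every $R>0$ there is $\mu_0>0$ with the following property. If $\mu_1,\mu_2\ge\mu_0$ and $(v^1,v^2)$ is a Nash quasi-equilibrium for $(J_1,J_2)$, then for $i=1,2$: 1. the second derivative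 $D_i^2J_i(h;v^1,v^2)$ exists as a bilinear form on $\mathcal V_i$, and $$D_i^2J_i(h;v^1,v^2)(\tilde v,\tilde v)\ \ge\ C\,\|\tilde v\|^2_{L^2(\mathcal O_i\times(0,T))}\qquad\forall\,\tilde v\in\mathcal V_i;$$ 2. as a function of the $i$-th follower control, the other one being fixed at its equilibrium value, $J_i$ is convex on $\{w\in\mathcal V_i:\|w-v^i\|_{L^2(\mathcal O_i\times(0,T))}\le R\}$; 3. $(v^1,v^2)$ is a Nash equilibrium for $(J_1,J_2)$. -/

import Mathlib

open MeasureTheory Set Filter Topology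
open scoped ContDiff

noncomputable section

namespace StackelbergNash

/-! ### Weighted Sobolev spaces

Points of the space-time cylinder are written `z = (x, t)`, with `x = z.1` and `t = z.2`. -/

/-- The cylinder `Q = (0,1) × (0,T)`. -/
def cylinder (T : ℝ) : Set (ℝ × ℝ) := Ioo 0 1 ×ˢ Ioo 0 T

/-- Lebesgue measure on `S × (0,T)`. -/
def cylMeasure (S : Set ℝ) (T : ℝ) : Measure (ℝ × ℝ) := volume.restrict (S ×ˢ Ioo 0 T)

/-- The partial derivative in the space variable. -/
def dx (φ : ℝ × ℝ → ℝ) (z : ℝ × ℝ) : ℝ := fderiv ℝ φ z (1, 0)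

/-- The partial derivative in the time variable. -/
def dt (φ : ℝ × ℝ → ℝ) (z : ℝ × ℝ) : ℝ := fderiv ℝ φ z (0, 1)

/-- `u` belongs to `H¹_a(0,1)` with zero boundary values: the closure of `C_c^∞(0,1)` in the norm
`(‖u‖² + ‖√a u_x‖²)^{1/2}`. The function `g` is the derivative `u_x`. When `1/a` is integrable
these are the absolutely continuous functions on `[0,1]` that vanish at `0` and `1` and satisfy
`√a u_x ∈ L²(0,1)`. -/
def MemH1a (a : ℝ → ℝ) (u : ℝ → ℝ) : Prop :=
  ∃ g : ℝ → ℝ,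
    MemLp u 2 (volume.restrict (Ioo 0 1)) ∧
    MemLp (fun x => √(a x) * g x) 2 (volume.restrict (Ioo 0 1)) ∧
    ∃ φ : ℕ → ℝ → ℝ,
      (∀ n, ContDiff ℝ ∞ (φ n) ∧ HasCompactSupport (φ n) ∧ tsupport (φ n) ⊆ Ioo 0 1) ∧
      Tendsto (fun n => eLpNorm (fun x => φ n x - u x) 2 (volume.restrict (Ioo 0 1)))
        atTop (𝓝 0) ∧
      Tendsto (fun n => eLpNorm (fun x => √(a x) * (deriv (φ n) x - g x)) 2
        (volume.restrict (Ioo 0 1))) atTop (𝓝 0)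

/-- `y ∈ L²(0,T; H¹_a(0,1))` with spatial derivative `y_x = g`: the closure of `C_c^∞(Q)` in the
norm `(‖y‖²_{L²(Q)} + ‖√a y_x‖²_{L²(Q)})^{1/2}`. The homogeneous Dirichlet conditions on the lateral
boundary are part of this. -/
def IsL2H1a (a : ℝ → ℝ) (T : ℝ) (y g : ℝ × ℝ → ℝ) : Prop :=
  MemLp y 2 (cylMeasure (Ioo 0 1) T) ∧
  MemLp (fun z => √(a z.1) * g z) 2 (cylMeasure (Ioo 0 1) T) ∧
  ∃ φ : ℕ → ℝ × ℝ → ℝ,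
    (∀ n, ContDiff ℝ ∞ (φ n) ∧ HasCompactSupport (φ n) ∧ tsupport (φ n) ⊆ cylinder T) ∧
    Tendsto (fun n => eLpNorm (fun z => φ n z - y z) 2 (cylMeasure (Ioo 0 1) T))
      atTop (𝓝 0) ∧
    Tendsto (fun n => eLpNorm (fun z => √(a z.1) * (dx (φ n) z - g z)) 2
      (cylMeasure (Ioo 0 1) T)) atTop (𝓝 0)

/-! ### Hypotheses on the coefficients -/

/-- The conditions on the degenerate diffusion coefficient `a`. -/
structure IsDegenerateCoefficient (a : ℝ → ℝ) : Prop where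
  continuousOn : ContinuousOn a (Icc 0 1)
  contDiffOn : ContDiffOn ℝ 1 a (Ioc 0 1)
  pos : ∀ x ∈ Ioc (0 : ℝ) 1, 0 < a x
  zero : a 0 = 0
  growth : ∃ K ∈ Ioc (0 : ℝ) 1, ∀ x ∈ Ioc (0 : ℝ) 1, x * derivWithin a (Ioc 0 1) x ≤ K * a x
  mul : ∀ x ∈ Icc (0 : ℝ) 1, ∀ y ∈ Icc (0 : ℝ) 1, a (x * y) = a x * a y

/-- The length `ℓ(t)` of the moving interval `Ω_t = (0, ℓ(t))` is `C¹` and positive. The identity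
`a(ℓ(t) x) = a(ℓ(t)) a(x)` holds automatically when `ℓ(t) ≤ 1`; when `ℓ(t) > 1` it says that the
multiplicativity of `a` persists on `[0, ℓ(t)]`, where `a` has to be defined. -/
structure IsMovingLength (a : ℝ → ℝ) (T : ℝ) (ℓ : ℝ → ℝ) : Prop where
  contDiffOn : ContDiffOn ℝ 1 ℓ (Icc 0 T)
  pos : ∀ t ∈ Icc 0 T, 0 < ℓ t
  scaling : ∀ t ∈ Icc 0 T, ∀ x ∈ Icc (0 : ℝ) 1, a (ℓ t * x) = a (ℓ t) * a x

/-- The conditions on a coupling nonlinearity. -/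
structure IsCoupling (F : ℝ × ℝ → ℝ) : Prop where
  zero : F (0, 0) = 0
  contDiff : ContDiff ℝ 2 F
  bounded : ∃ M > 0, ∀ z, ‖fderiv ℝ F z‖ + ‖fderiv ℝ (fderiv ℝ F) z‖ ≤ M

/-- The conditions on the weight `ρ_*`: it is continuous on the open interval `(0,T)` and bounded
below by a positive constant; it may blow up at `t = 0` and `t = T`. -/
structure IsWeight (T : ℝ) (ρ : ℝ → ℝ) : Prop where
  continuousOn : ContinuousOn ρ (Ioo 0 T)
  lower : ∃ c > 0, ∀ t ∈ Ioo 0 T, c ≤ ρ t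

/-! ### The control problem -/

/-- The data of the problem, apart from the penalisation parameters `μ` and the leader control.
Index `0` of `Fin 2` stands for the first state component (or follower), index `1` for the
second. -/
structure Data where
  /-- final time -/
  T : ℝ
  /-- diffusion coefficient -/
  a : ℝ → ℝ
  /-- length of the moving interval -/
  ℓ : ℝ → ℝ
  /-- coupling nonlinearities -/
  F : Fin 2 → ℝ × ℝ → ℝ
  /-- domain of the leader control -/
  O : Set ℝ
  /-- domains of the follower controls -/
  Of : Fin 2 → Set ℝ
  /-- observation domains of the followers -/
  Od : Fin 2 → Set ℝ
  /-- observation weights of the followers -/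
  α : Fin 2 → ℝ
  /-- time weight in the cost of the followers' controls -/
  ρ : ℝ → ℝ
  /-- initial states -/
  y0 : Fin 2 → ℝ → ℝ
  /-- targets: `yd i k` is the target of follower `i` for the component `k` of the state -/
  yd : Fin 2 → Fin 2 → ℝ × ℝ → ℝ

namespace Data

variable (P : Data)

/-- `b(t) = a(ℓ(t)) / ℓ(t)²`. -/
def b (t : ℝ) : ℝ := P.a (P.ℓ t) / P.ℓ t ^ 2

/-- `B(x,t) = ℓ'(t) x / (ℓ(t) √a(x))`. -/
def B (z : ℝ × ℝ) : ℝ := deriv P.ℓ z.2 * z.1 / (P.ℓ z.2 * √(P.a z.1))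

/-- The right-hand sides: `h 1_O + v¹ 1_{O₁} + v² 1_{O₂}` in the first equation and `0` in the
second. -/
def source (h : ℝ × ℝ → ℝ) (v : Fin 2 → ℝ × ℝ → ℝ) (k : Fin 2) (z : ℝ × ℝ) : ℝ :=
  if k = 0 then
    (P.O ×ˢ univ).indicator h z + ∑ i, (P.Of i ×ˢ univ).indicator (v i) z
  else 0

/-- `y = (y₁, y₂)` is a weak solution of
`y_{k,t} - b (a y_{k,x})_x - B √a y_{k,x} + F_k(y₁,y₂) = source_k` in `Q`, with `y_k = 0` on the
lateral boundary and `y_k(0) = y_k⁰`. -/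
def IsState (h : ℝ × ℝ → ℝ) (v : Fin 2 → ℝ × ℝ → ℝ) (y : Fin 2 → ℝ × ℝ → ℝ) : Prop :=
  ∃ g : Fin 2 → ℝ × ℝ → ℝ, (∀ k, IsL2H1a P.a P.T (y k) (g k)) ∧
    ∀ k, ∀ φ : ℝ × ℝ → ℝ, ContDiff ℝ ∞ φ → HasCompactSupport φ →
      tsupport φ ⊆ Ioo 0 1 ×ˢ Iio P.T →
      ∫ z in cylinder P.T,
          (-(y k z * dt φ z) + P.b z.2 * P.a z.1 * g k z * dx φ z
            - P.B z * √(P.a z.1) * g k z * φ z + P.F k (y 0 z, y 1 z) * φ z) =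
        (∫ z in cylinder P.T, P.source h v k z * φ z) + ∫ x in Ioo (0 : ℝ) 1, P.y0 k x * φ (x, 0)

/-- The state associated with the leader control `h` and the follower controls `v = (v¹, v²)`. -/
def state (h : ℝ × ℝ → ℝ) (v : Fin 2 → ℝ × ℝ → ℝ) : Fin 2 → ℝ × ℝ → ℝ :=
  Classical.epsilon (P.IsState h v)

/-- The cost functional `J_i(h; v¹, v²)` of follower `i`. -/
def J (μ : Fin 2 → ℝ) (h : ℝ × ℝ → ℝ) (i : Fin 2) (v : Fin 2 → ℝ × ℝ → ℝ) : ℝ :=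
  P.α i / 2 * (∫ z in P.Od i ×ˢ Ioo 0 P.T,
      (|P.state h v 0 z - P.yd i 0 z| ^ 2 + |P.state h v 1 z - P.yd i 1 z| ^ 2)) +
    μ i / 2 * ∫ z in P.Of i ×ˢ Ioo 0 P.T, P.ρ z.2 ^ 2 * |v i z| ^ 2

/-- The controls of follower `i`: the functions `v ∈ L²(O_i × (0,T))` of finite cost, that is with
`ρ_* v ∈ L²(O_i × (0,T))`. This is all of `L²(O_i × (0,T))` if `ρ_*` is bounded; in general, the
other controls have infinite cost. -/
def followerSpace (i : Fin 2) : Submodule ℝ (ℝ × ℝ → ℝ) where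
  carrier := {v | MemLp v 2 (cylMeasure (P.Of i) P.T) ∧
    MemLp (fun z => P.ρ z.2 * v z) 2 (cylMeasure (P.Of i) P.T)}
  zero_mem' := ⟨MemLp.zero, by simp⟩
  add_mem' := by
    rintro v w ⟨hv, hv'⟩ ⟨hw, hw'⟩
    refine ⟨hv.add hw, ?_⟩
    have := hv'.add hw'
    refine this.ae_eq (Eventually.of_forall fun z => ?_)
    simp [mul_add]
  smul_mem' := by
    rintro c v ⟨hv, hv'⟩
    refine ⟨hv.const_smul c, ?_⟩
    have := hv'.const_smul c
    refine this.ae_eq (Eventually.of_forall fun z => ?_)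
    simp [mul_left_comm]

/-- The functional `w ↦ J_i(h; …, w, …)` in which only the `i`-th follower control varies. -/
def partialJ (μ : Fin 2 → ℝ) (h : ℝ × ℝ → ℝ) (v : Fin 2 → ℝ × ℝ → ℝ) (i : Fin 2)
    (w : ℝ × ℝ → ℝ) : ℝ :=
  P.J μ h i (Function.update v i w)

/-- The squared norm of `L²(O_i × (0,T))`. -/
def normSq (i : Fin 2) (w : ℝ × ℝ → ℝ) : ℝ := ∫ z in P.Of i ×ˢ Ioo 0 P.T, |w z| ^ 2

end Data

/-- `d` is the Gateaux derivative of `Φ` at `w` in the direction `δ`. -/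
def HasGateauxDeriv {E : Type*} [AddCommGroup E] [Module ℝ E] (Φ : E → ℝ) (w δ : E) (d : ℝ) :
    Prop :=
  HasDerivAt (fun s : ℝ => Φ (w + s • δ)) d 0

/-- `d` is the second Gateaux derivative `D²Φ(w)(δ, η)`: the derivative at `s = 0` of
`s ↦ ⟨DΦ(w + s δ), η⟩`. -/
def HasSecondGateauxDeriv {E : Type*} [AddCommGroup E] [Module ℝ E] (Φ : E → ℝ) (w δ η : E)
    (d : ℝ) : Prop :=
  ∃ p : ℝ → ℝ, (∀ s, HasGateauxDeriv Φ (w + s • δ) η (p s)) ∧ HasDerivAt p d 0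

namespace Data

variable (P : Data)

/-- Nash equilibrium: each `v i` minimises `J_i` with respect to the `i`-th follower control. -/
def IsNashEquilibrium (μ : Fin 2 → ℝ) (h : ℝ × ℝ → ℝ) (v : Fin 2 → ℝ × ℝ → ℝ) : Prop :=
  ∀ i, v i ∈ P.followerSpace i ∧
    ∀ w ∈ P.followerSpace i, P.J μ h i v ≤ P.partialJ μ h v i w

/-- Nash quasi-equilibrium: for each `i`, the derivative of `J_i` with respect to the `i`-th
follower control vanishes. -/
def IsNashQuasiEquilibrium (μ : Fin 2 → ℝ) (h : ℝ × ℝ → ℝ) (v : Fin 2 → ℝ × ℝ → ℝ) : Prop :=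
  ∀ i, v i ∈ P.followerSpace i ∧
    ∀ δ ∈ P.followerSpace i, HasGateauxDeriv (P.partialJ μ h v i) (v i) δ 0

/-- The standing assumptions on the data. -/
structure Admissible : Prop where
  T_pos : 0 < P.T
  a_degenerate : IsDegenerateCoefficient P.a
  ℓ_moving : IsMovingLength P.a P.T P.ℓ
  F_coupling : ∀ k, IsCoupling (P.F k)
  O_measurable : MeasurableSet P.O
  O_subset : P.O ⊆ Ioo 0 1
  Of_measurable : ∀ i, MeasurableSet (P.Of i)
  Of_subset : ∀ i, P.Of i ⊆ Ioo 0 1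
  Od_measurable : ∀ i, MeasurableSet (P.Od i)
  Od_subset : ∀ i, P.Od i ⊆ Ioo 0 1
  α_pos : ∀ i, 0 < P.α i
  ρ_weight : IsWeight P.T P.ρ
  y0_mem : ∀ k, MemH1a P.a (P.y0 k)
  yd_bounded : ∀ i k, MemLp (P.yd i k) ⊤ (cylMeasure (P.Od i) P.T)

end Data

end StackelbergNash

end

/-! The penalty contributes `μ ‖ρ_* δ‖²` to the second derivative of the cost of a follower. The
tracking term contributes at most a constant times `(1 + ‖source‖) ‖δ‖²`, and that constant does not
involve `μ`. So for large `μ` the cost is uniformly convex on every ball of controls of fixed radius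
(`second_ge`, `convexOn_ball`), provided the source at the quasi-equilibrium is bounded
independently of `μ`. This bound is automatic: testing criticality in the direction of the control
itself gives `μ c² ‖v‖ ≤ const (1 + ‖source‖)` (`norm_critical_le`), and the source is the leader
control plus the two follower controls, so both followers are small once `μ` is large. A critical
point is then a minimum on the ball of radius 2 by convexity. Outside that ball the penalty alone
exceeds the cost of the zero control, which lies inside the ball (`le_of_critical`).

The analytic work is to differentiate the tracking term twice with these bounds. Let `S` solve the
linear equation with zero initial state and let `y₀` be the linear solution with zero source. The
state is `y₀ + S g`, where the effective source `g` solves `g + F(y₀ + S g) = s`. If `S` is small on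
`L²`, this is a contraction problem, and its inverse is differentiated through the resolvent `(1 +
d𝒩)⁻¹` (`exists_tracking_derivs`). Superposition operators on `L²` are in general not Fréchet
differentiable; composition with an operator `S : L² → L⁴` repairs this, because the second order
terms are products of two `L⁴` functions (`isSmoothPerturbation`).

The linear theory lives in `L²(Q, e^{-2λt} dx dt)` and uses the equation integrated in time. There
the time primitive is accretive, with `λ ‖I f‖² ≤ ⟪I f, f⟫`. Since `b` depends on time only, it
commutes with all spatial operators. This permits solutions of the form `u = ι† w`, formally `w = u
- (a u_x)_x`, with `w` in `L²`: that is maximal regularity, obtained by a Lions duality argument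
(`exists_evolution_solver`, `exists_weak_solver`). A large `λ` absorbs the lower order terms and
makes `S` small.

The `L⁴` bound comes from `u_t ∈ L²`, hence `u ∈ L^∞(0,T; L²)`, together with a Ladyzhenskaya
inequality with weight `x` (`integral_pow_four_le`). The weight is admissible because `x ≤ a x`,
which follows from `a 1 = 1` and `K ≤ 1`. Finally `weakForm_iff` identifies the integrated
formulation with the distributional one, and `exists_state_operator` gives existence and uniqueness
of the state. -/

noncomputable section

namespace StackelbergNash

/-! ### Abstract solvability and the calculus of small perturbations of the identity. -/

section Abstract

open ContinuousLinearMap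
open scoped InnerProductSpace

/-- A Lions type existence result: if `N` and `I†` are compatible and `b` is coercive, then the
abstract evolution equation `N w + I (b w) = I f` is solvable with a bounded solution operator. -/
theorem exists_evolution_solver {X : Type*} [NormedAddCommGroup X] [InnerProductSpace ℝ X]
    [CompleteSpace X] (N I b : X →L[ℝ] X) {b₀ : ℝ} (hb₀ : 0 < b₀)
    (hN : ∀ u v, ⟪N u, v⟫_ℝ = ⟪u, N v⟫_ℝ) (hb : ∀ u v, ⟪b u, v⟫_ℝ = ⟪u, b v⟫_ℝ)
    (hNI : ∀ g, 0 ≤ ⟪N g, adjoint I g⟫_ℝ) (hcoer : ∀ g, b₀ * ‖g‖ ^ 2 ≤ ⟪b g, g⟫_ℝ)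
    (hinj : ∀ u, N u + I (b u) = 0 → u = 0) :
    ∃ W : X →L[ℝ] X, (∀ f, N (W f) + I (b (W f)) = I f) ∧ ∀ f, ‖W f‖ ≤ b₀⁻¹ * ‖f‖ := by
  -- As `N` and `b` are symmetric, this is the adjoint of `N + I b`. Pairing `T g` with `I† g` gives
  -- the a priori bound `key`.
  set T : X →L[ℝ] X := N + b ∘L adjoint I with hT
  have key : ∀ g, ‖adjoint I g‖ ≤ b₀⁻¹ * ‖T g‖ := by
    intro g
    have h1 : b₀ * ‖adjoint I g‖ ^ 2 ≤ ‖T g‖ * ‖adjoint I g‖ := by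
      calc b₀ * ‖adjoint I g‖ ^ 2 ≤ ⟪b (adjoint I g), adjoint I g⟫_ℝ := hcoer _
        _ ≤ ⟪T g, adjoint I g⟫_ℝ := by
          have : T g = N g + b (adjoint I g) := rfl
          rw [this, inner_add_left]
          linarith [hNI g]
        _ ≤ _ := real_inner_le_norm _ _
    rcases eq_or_lt_of_le (norm_nonneg (adjoint I g)) with h0 | h0
    · rw [← h0]; positivity
    · rw [inv_mul_eq_div, le_div_iff₀ hb₀]
      have : (b₀ * ‖adjoint I g‖) * ‖adjoint I g‖ ≤ ‖T g‖ * ‖adjoint I g‖ := by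
        nlinarith
      linarith [le_of_mul_le_mul_right this h0]
  have hTadj : ∀ u g, ⟪N u + I (b u), g⟫_ℝ = ⟪u, T g⟫_ℝ := by
    intro u g
    have : T g = N g + b (adjoint I g) := rfl
    rw [this, inner_add_left, inner_add_right, hN, ← hb, adjoint_inner_right]
  -- A vector orthogonal to the range of `T` lies in the kernel of `N + I b`, which is trivial by
  -- `hinj`.
  have hdense : DenseRange T := by
    have : (LinearMap.range (T : X →ₗ[ℝ] X)).topologicalClosure = ⊤ := by
      rw [Submodule.topologicalClosure_eq_top_iff, Submodule.eq_bot_iff]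
      intro u hu
      apply hinj
      refine ext_inner_right ℝ fun g => ?_
      rw [hTadj, inner_zero_left]
      rw [Submodule.mem_orthogonal'] at hu
      exact hu _ ⟨g, rfl⟩
    exact Submodule.dense_iff_topologicalClosure_eq_top.2 this
  -- By `key` the map `T g ↦ I† g` is well defined and bounded on a dense subspace. The identity `A
  -- T = I†` transposes to `(N + I b) A† = I`, so `A†` is the solver.
  let A : X →L[ℝ] X :=
    LinearMap.extendOfNorm (adjoint I : X →L[ℝ] X).toLinearMap (T : X →ₗ[ℝ] X)
  have hA : ∀ g, A (T g) = adjoint I g :=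
    fun g => LinearMap.extendOfNorm_eq (f := (adjoint I : X →L[ℝ] X).toLinearMap)
      (e := (T : X →ₗ[ℝ] X)) hdense ⟨b₀⁻¹, key⟩ g
  have hAn : ‖A‖ ≤ b₀⁻¹ := LinearMap.opNorm_extendOfNorm_le
      (f := (adjoint I : X →L[ℝ] X).toLinearMap)
      (e := (T : X →ₗ[ℝ] X)) hdense (by positivity) key
  refine ⟨adjoint A, fun f => ?_, fun f => ?_⟩
  · refine ext_inner_right ℝ fun g => ?_
    rw [hTadj, adjoint_inner_left, hA, adjoint_inner_right]
  · refine (le_opNorm _ _).trans ?_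
    rw [LinearIsometryEquiv.norm_map]
    gcongr

/-- A nonlinear perturbation of the identity with the regularity that superposition operators have:
it is Fréchet differentiable, its derivative is small and Lipschitz, and the derivative is itself
strongly Gateaux differentiable. -/
structure IsSmoothPerturbation {X : Type*} [NormedAddCommGroup X] [NormedSpace ℝ X]
    (𝒩 : X → X) (d𝒩 : X → X →L[ℝ] X) (dd𝒩 : X → X →L[ℝ] X →L[ℝ] X) (C : ℝ) : Prop where
  hasFDerivAt : ∀ g, HasFDerivAt 𝒩 (d𝒩 g) g
  norm_deriv_le : ∀ g, ‖d𝒩 g‖ ≤ 1 / 2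
  lipschitz_deriv : ∀ g g', ‖d𝒩 g - d𝒩 g'‖ ≤ C * ‖g - g'‖
  hasDerivAt_deriv : ∀ g δ η, HasDerivAt (fun s : ℝ => d𝒩 (g + s • δ) η) (dd𝒩 g δ η) 0
  norm_second_le : ∀ g, ‖dd𝒩 g‖ ≤ C

namespace IsSmoothPerturbation

variable {X : Type*} [NormedAddCommGroup X] [NormedSpace ℝ X]
  {𝒩 : X → X} {d𝒩 : X → X →L[ℝ] X} {dd𝒩 : X → X →L[ℝ] X →L[ℝ] X} {C : ℝ}

theorem nonneg (h : IsSmoothPerturbation 𝒩 d𝒩 dd𝒩 C) : 0 ≤ C :=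
  (norm_nonneg (dd𝒩 0)).trans (h.norm_second_le 0)

theorem norm_sub_le (h : IsSmoothPerturbation 𝒩 d𝒩 dd𝒩 C) (g g' : X) :
    ‖𝒩 g - 𝒩 g'‖ ≤ 1 / 2 * ‖g - g'‖ :=
  Convex.norm_image_sub_le_of_norm_hasFDerivWithin_le (s := univ)
    (fun x _ => (h.hasFDerivAt x).hasFDerivWithinAt) (fun x _ => h.norm_deriv_le x) convex_univ
    (mem_univ _) (mem_univ _)

theorem norm_inverse_sub_le (h : IsSmoothPerturbation 𝒩 d𝒩 dd𝒩 C) {Φ : X → X}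
    (hΦ : ∀ f, Φ f + 𝒩 (Φ f) = f) (f f' : X) : ‖Φ f - Φ f'‖ ≤ 2 * ‖f - f'‖ := by
  have h1 : Φ f - Φ f' = (f - f') - (𝒩 (Φ f) - 𝒩 (Φ f')) := by
    have e := hΦ f
    have e' := hΦ f'
    rw [← eq_sub_iff_add_eq] at e e'
    conv_lhs => rw [e, e']
    abel
  have h2 := h.norm_sub_le (Φ f) (Φ f')
  have h3 : ‖Φ f - Φ f'‖ ≤ ‖f - f'‖ + ‖𝒩 (Φ f) - 𝒩 (Φ f')‖ := by
    conv_lhs => rw [h1]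
    exact _root_.norm_sub_le _ _
  linarith

/-- The second derivative is only assumed along straight lines. Since `d𝒩` is Lipschitz, replacing a
curve by its tangent costs `o(s)`, so lines suffice. -/
theorem hasDerivAt_deriv_curve (h : IsSmoothPerturbation 𝒩 d𝒩 dd𝒩 C) {g : ℝ → X} {g' : X}
    (hg : HasDerivAt g g' 0) (η : X) :
    HasDerivAt (fun s : ℝ => d𝒩 (g s) η) (dd𝒩 (g 0) g' η) 0 := by
  have h1 := h.hasDerivAt_deriv (g 0) g' η
  have h2 : HasDerivAt (fun s : ℝ => d𝒩 (g s) η - d𝒩 (g 0 + s • g') η) 0 0 := by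
    rw [hasDerivAt_iff_isLittleO] at hg ⊢
    refine Asymptotics.IsBigO.trans_isLittleO ?_ hg
    refine Asymptotics.IsBigO.of_bound (C * ‖η‖) (Eventually.of_forall fun s => ?_)
    simp only [sub_zero, zero_smul, add_zero, sub_self, smul_zero]
    rw [← _root_.sub_apply]
    calc _ ≤ ‖d𝒩 (g s) - d𝒩 (g 0 + s • g')‖ * ‖η‖ := ContinuousLinearMap.le_opNorm _ _
      _ ≤ (C * ‖g s - (g 0 + s • g')‖) * ‖η‖ := by gcongr; exact h.lipschitz_deriv _ _
      _ = _ := by rw [← sub_sub]; ring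
  have h3 := h2.add h1
  rw [zero_add] at h3
  refine h3.congr_of_eventuallyEq (Eventually.of_forall fun s => ?_)
  simp

variable [CompleteSpace X]

/-- Banach's fixed point theorem for `g ↦ f - 𝒩 g`, a contraction with constant `1/2`. -/
theorem exists_inverse (h : IsSmoothPerturbation 𝒩 d𝒩 dd𝒩 C) :
    ∃ Φ : X → X, (∀ f, Φ f + 𝒩 (Φ f) = f) ∧ ∀ f g, g + 𝒩 g = f → g = Φ f := by
  have hex : ∀ f, ∃ g, g + 𝒩 g = f := by
    intro f
    have hc : ContractingWith (1 / 2) (fun g => f - 𝒩 g) := by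
      refine ⟨by norm_num, LipschitzWith.of_dist_le_mul fun x y => ?_⟩
      rw [dist_eq_norm, dist_eq_norm]
      have := h.norm_sub_le y x
      rw [sub_sub_sub_cancel_left, norm_sub_rev x y]
      simpa using this
    refine ⟨ContractingWith.fixedPoint _ hc, ?_⟩
    have : f - 𝒩 (ContractingWith.fixedPoint _ hc) = _ := hc.fixedPoint_isFixedPt
    nth_rw 1 [← this]
    abel
  choose Φ hΦ using hex
  refine ⟨Φ, hΦ, fun f g hg => ?_⟩
  have h1 : g - Φ f = -(𝒩 g - 𝒩 (Φ f)) := by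
    have := hg.trans (hΦ f).symm
    rw [← sub_eq_zero] at this ⊢
    rw [← this]; abel
  have h2 := h.norm_sub_le g (Φ f)
  rw [← norm_neg, ← h1] at h2
  have : ‖g - Φ f‖ = 0 := by linarith [norm_nonneg (g - Φ f)]
  rwa [norm_eq_zero, sub_eq_zero] at this

theorem exists_equiv (h : IsSmoothPerturbation 𝒩 d𝒩 dd𝒩 C) (g : X) :
    ∃ e : X ≃L[ℝ] X, (e : X →L[ℝ] X) = ContinuousLinearMap.id ℝ X + d𝒩 g := by
  have hlt : ‖-d𝒩 g‖ < 1 := by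
    rw [norm_neg]; exact (h.norm_deriv_le g).trans_lt (by norm_num)
  refine ⟨ContinuousLinearEquiv.ofUnit (Units.oneSub (-d𝒩 g) hlt), ?_⟩
  ext x
  change ((Units.oneSub (-d𝒩 g) hlt : (X →L[ℝ] X)ˣ) : X →L[ℝ] X) x = _
  simp [Units.val_oneSub]

/-- The inverse of `1 + d𝒩 g`. -/
def resolvent (h : IsSmoothPerturbation 𝒩 d𝒩 dd𝒩 C) (g : X) : X →L[ℝ] X :=
  ((h.exists_equiv g).choose.symm : X →L[ℝ] X)

theorem resolvent_spec (h : IsSmoothPerturbation 𝒩 d𝒩 dd𝒩 C) (g η : X) :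
    h.resolvent g η + d𝒩 g (h.resolvent g η) = η := by
  have h1 := (h.exists_equiv g).choose_spec
  have h2 := (h.exists_equiv g).choose.apply_symm_apply η
  have h3 := DFunLike.congr_fun h1 (h.resolvent g η)
  simp only [_root_.add_apply, ContinuousLinearMap.id_apply] at h3
  rw [← h3]
  exact h2

theorem resolvent_unique (h : IsSmoothPerturbation 𝒩 d𝒩 dd𝒩 C) {g η x : X}
    (hx : x + d𝒩 g x = η) : x = h.resolvent g η := by
  have h1 := (h.exists_equiv g).choose_spec
  have h3 := DFunLike.congr_fun h1 x
  simp only [_root_.add_apply, ContinuousLinearMap.id_apply] at h3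
  rw [← hx, ← h3]
  exact ((h.exists_equiv g).choose.symm_apply_apply x).symm

theorem norm_resolvent_apply_le (h : IsSmoothPerturbation 𝒩 d𝒩 dd𝒩 C) (g η : X) :
    ‖h.resolvent g η‖ ≤ 2 * ‖η‖ := by
  have h1 := h.resolvent_spec g η
  have h2 : ‖d𝒩 g (h.resolvent g η)‖ ≤ 1 / 2 * ‖h.resolvent g η‖ :=
    (d𝒩 g).le_of_opNorm_le (h.norm_deriv_le g) _
  have h3 : ‖h.resolvent g η‖ ≤ ‖η‖ + ‖d𝒩 g (h.resolvent g η)‖ := by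
    calc ‖h.resolvent g η‖ = ‖η - d𝒩 g (h.resolvent g η)‖ := by
          congr 1; exact eq_sub_of_add_eq h1
      _ ≤ _ := _root_.norm_sub_le _ _
  linarith

/-- The second resolvent identity, from which the resolvent is differentiated. -/
theorem resolvent_sub (h : IsSmoothPerturbation 𝒩 d𝒩 dd𝒩 C) (g g' η : X) :
    h.resolvent g' η - h.resolvent g η =
      -h.resolvent g ((d𝒩 g' - d𝒩 g) (h.resolvent g' η)) := by
  rw [← map_neg]
  apply h.resolvent_unique
  have h1 := h.resolvent_spec g η
  have h2 := h.resolvent_spec g' η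
  rw [map_sub, _root_.sub_apply]
  rw [← sub_eq_zero] at h1 h2 ⊢
  calc _ = (h.resolvent g' η + d𝒩 g' (h.resolvent g' η) - η) -
      (h.resolvent g η + d𝒩 g (h.resolvent g η) - η) := by abel
    _ = 0 := by rw [h1, h2, sub_zero]

theorem hasFDerivAt_inverse (h : IsSmoothPerturbation 𝒩 d𝒩 dd𝒩 C) {Φ : X → X}
    (hΦ : ∀ f, Φ f + 𝒩 (Φ f) = f) (f : X) : HasFDerivAt Φ (h.resolvent (Φ f)) f := by
  have hcont : ContinuousAt Φ f := by
    have : LipschitzWith 2 Φ := LipschitzWith.of_dist_le_mul fun x y => by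
      rw [dist_eq_norm, dist_eq_norm]; simpa using h.norm_inverse_sub_le hΦ x y
    exact this.continuous.continuousAt
  have hd : HasFDerivAt (fun g => g + 𝒩 g)
      ((h.exists_equiv (Φ f)).choose : X →L[ℝ] X) (Φ f) := by
    rw [(h.exists_equiv (Φ f)).choose_spec]
    exact (hasFDerivAt_id _).add (h.hasFDerivAt _)
  exact HasFDerivAt.of_local_left_inverse hcont hd (Eventually.of_forall hΦ)

theorem hasDerivAt_line (h : IsSmoothPerturbation 𝒩 d𝒩 dd𝒩 C) {Φ : X → X}
    (hΦ : ∀ f, Φ f + 𝒩 (Φ f) = f) (f δ : X) :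
    HasDerivAt (fun s : ℝ => Φ (f + s • δ)) (h.resolvent (Φ f) δ) 0 := by
  have h1 : HasDerivAt (fun s : ℝ => f + s • δ) δ 0 := by
    simpa using ((hasDerivAt_id (0 : ℝ)).smul_const δ).const_add f
  have h2 := h.hasFDerivAt_inverse hΦ f
  have h3 : HasFDerivAt Φ (h.resolvent (Φ f)) (f + (0 : ℝ) • δ) := by simpa using h2
  exact h3.comp_hasDerivAt (0 : ℝ) h1

/-- In the resolvent identity the vector `r s` still moves. Writing `r s = r 0 + (r s - r 0)`, the
first part is differentiated by `hasDerivAt_deriv_curve`; the second is a product of two increments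
of order `s`, hence negligible. -/
theorem hasDerivAt_resolvent_curve (h : IsSmoothPerturbation 𝒩 d𝒩 dd𝒩 C) {g : ℝ → X} {g' : X}
    (hg : HasDerivAt g g' 0) (η : X) :
    HasDerivAt (fun s : ℝ => h.resolvent (g s) η)
      (-h.resolvent (g 0) (dd𝒩 (g 0) g' (h.resolvent (g 0) η))) 0 := by
  set r : ℝ → X := fun s => h.resolvent (g s) η with hr
  have hC := h.nonneg
  have hrb : ∀ s, ‖r s - r 0‖ ≤ 4 * C * ‖η‖ * ‖g s - g 0‖ := by
    intro s
    rw [hr]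
    simp only
    rw [h.resolvent_sub, norm_neg]
    calc _ ≤ 2 * ‖(d𝒩 (g s) - d𝒩 (g 0)) (h.resolvent (g s) η)‖ := h.norm_resolvent_apply_le _ _
      _ ≤ 2 * (‖d𝒩 (g s) - d𝒩 (g 0)‖ * ‖h.resolvent (g s) η‖) := by
          gcongr; exact ContinuousLinearMap.le_opNorm _ _
      _ ≤ 2 * ((C * ‖g s - g 0‖) * (2 * ‖η‖)) := by
          gcongr
          · exact h.lipschitz_deriv _ _
          · exact h.norm_resolvent_apply_le _ _
      _ = _ := by ring
  have h1 : HasDerivAt (fun s : ℝ => (d𝒩 (g s) - d𝒩 (g 0)) (r 0)) (dd𝒩 (g 0) g' (r 0)) 0 := by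
    simpa using (h.hasDerivAt_deriv_curve hg (r 0)).sub_const (d𝒩 (g 0) (r 0))
  have h2 : HasDerivAt (fun s : ℝ => (d𝒩 (g s) - d𝒩 (g 0)) (r s - r 0)) 0 0 := by
    rw [hasDerivAt_iff_isLittleO]
    have hO : (fun s => g s - g 0) =O[𝓝 0] fun s : ℝ => s := by
      simpa using hg.isBigO_sub
    have hO2 : (fun s => ‖g s - g 0‖ ^ 2) =O[𝓝 0] fun s : ℝ => s ^ 2 := hO.norm_left.pow 2
    have ho : (fun s : ℝ => s ^ 2) =o[𝓝 0] fun s : ℝ => s - 0 := by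
      simpa using Asymptotics.isLittleO_pow_id (𝕜 := ℝ) (n := 2) (by norm_num)
    refine Asymptotics.IsBigO.trans_isLittleO ?_ (hO2.trans_isLittleO ho)
    refine Asymptotics.IsBigO.of_bound (C * (4 * C * ‖η‖)) (Eventually.of_forall fun s => ?_)
    simp only [sub_self, map_zero, sub_zero, smul_zero, norm_pow, norm_norm]
    calc _ ≤ ‖d𝒩 (g s) - d𝒩 (g 0)‖ * ‖r s - r 0‖ := ContinuousLinearMap.le_opNorm _ _
      _ ≤ (C * ‖g s - g 0‖) * (4 * C * ‖η‖ * ‖g s - g 0‖) := by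
          gcongr
          · exact h.lipschitz_deriv _ _
          · exact hrb s
      _ = _ := by ring
  have h3 := ((h.resolvent (g 0)).hasFDerivAt.comp_hasDerivAt (0 : ℝ) (h1.add h2)).neg.const_add
    (r 0)
  simp only [add_zero] at h3
  refine h3.congr_of_eventuallyEq (Eventually.of_forall fun s => ?_)
  change r s = r 0 + -h.resolvent (g 0)
    ((d𝒩 (g s) - d𝒩 (g 0)) (r 0) + (d𝒩 (g s) - d𝒩 (g 0)) (r s - r 0))
  rw [← map_add, add_sub_cancel, ← h.resolvent_sub (g 0) (g s) η, hr]
  simp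

/-- A quadratic tracking functional of the solution of `g + 𝒩 g = f` is twice Gateaux
differentiable in `f`, with natural bounds on the derivatives. -/
theorem exists_tracking_derivs (h : IsSmoothPerturbation 𝒩 d𝒩 dd𝒩 C) {Φ : X → X}
    (hΦ : ∀ f, Φ f + 𝒩 (Φ f) = f) {G : Type*} [NormedAddCommGroup G] [InnerProductSpace ℝ G]
    (L : X →L[ℝ] G) (c : G) :
    ∃ (q₁ : X → X →L[ℝ] ℝ) (q₂ : X → X →L[ℝ] X →L[ℝ] ℝ) (M : ℝ), 0 ≤ M ∧
      (∀ f η, HasDerivAt (fun s : ℝ => 1 / 2 * ‖c + L (Φ (f + s • η))‖ ^ 2) (q₁ f η) 0) ∧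
      (∀ f δ η, HasDerivAt (fun s : ℝ => q₁ (f + s • δ) η) (q₂ f δ η) 0) ∧
      (∀ f, 1 / 2 * ‖c + L (Φ f)‖ ^ 2 ≤ M * (1 + ‖f‖) ^ 2) ∧
      (∀ f η, |q₁ f η| ≤ M * (1 + ‖f‖) * ‖η‖) ∧
      (∀ f δ η, |q₂ f δ η| ≤ M * (1 + ‖f‖) * ‖δ‖ * ‖η‖) := by
  have hC := h.nonneg
  let R : X → X →L[ℝ] X := fun f => h.resolvent (Φ f)
  let q₁ : X → X →L[ℝ] ℝ := fun f => (innerSL ℝ (c + L (Φ f))) ∘L (L ∘L R f)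
  -- The derivative of `⟪c + L Φ, L R η⟫` in the direction `δ`: the product rule together with `R' =
  -- -R (dd𝒩 (R δ)) R`.
  let q₂ : X → X →L[ℝ] X →L[ℝ] ℝ := fun f =>
    (isBoundedBilinearMap_inner (𝕜 := ℝ) (E := G)).toContinuousLinearMap.bilinearComp (L ∘L R f) (L ∘L R f) -
      (ContinuousLinearMap.compL ℝ X X ℝ ((innerSL ℝ (c + L (Φ f))) ∘L (L ∘L R f))) ∘L
        (dd𝒩 (Φ f)).bilinearComp (R f) (R f)
  have hq₁ : ∀ f η, q₁ f η = ⟪c + L (Φ f), L (R f η)⟫_ℝ := fun f η => rfl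
  have hq₂ : ∀ f δ η, q₂ f δ η = ⟪L (R f δ), L (R f η)⟫_ℝ -
      ⟪c + L (Φ f), L (R f (dd𝒩 (Φ f) (R f δ) (R f η)))⟫_ℝ := fun f δ η => rfl
  set Λ : ℝ := ‖L‖ with hΛ
  have hΛ0 : 0 ≤ Λ := norm_nonneg _
  set m₀ : ℝ := ‖c + L (Φ 0)‖ + 2 * Λ with hm₀
  have hm₀0 : 0 ≤ m₀ := by positivity
  -- `Φ` is 2-Lipschitz, so the residual grows linearly. All other factors in the derivatives are
  -- bounded uniformly in `f`.
  have hcb : ∀ f, ‖c + L (Φ f)‖ ≤ m₀ * (1 + ‖f‖) := by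
    intro f
    have e : c + L (Φ f) = (c + L (Φ 0)) + L (Φ f - Φ 0) := by rw [map_sub]; abel
    have h1 : ‖L (Φ f - Φ 0)‖ ≤ Λ * (2 * ‖f‖) :=
      (L.le_opNorm _).trans (by gcongr; simpa using h.norm_inverse_sub_le hΦ f 0)
    rw [e]
    have h2 := norm_add_le (c + L (Φ 0)) (L (Φ f - Φ 0))
    nlinarith [norm_nonneg (c + L (Φ 0)), norm_nonneg f, mul_nonneg hΛ0 (norm_nonneg f),
      mul_nonneg (norm_nonneg (c + L (Φ 0))) (norm_nonneg f)]
  have hLR : ∀ f x, ‖L (R f x)‖ ≤ Λ * (2 * ‖x‖) := fun f x =>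
    (L.le_opNorm _).trans (by gcongr; exact h.norm_resolvent_apply_le _ _)
  have hRn : ∀ f x, ‖R f x‖ ≤ 2 * ‖x‖ := fun f x => h.norm_resolvent_apply_le _ _
  have hΦl := fun f δ => h.hasDerivAt_line hΦ f δ
  -- The first summand serves the value, the second the first derivative, and the last two the
  -- second derivative.
  refine ⟨q₁, q₂, m₀ ^ 2 + 2 * Λ * m₀ + 4 * Λ ^ 2 + 8 * Λ * C * m₀, by positivity,
    ?_, ?_, ?_, ?_, ?_⟩
  · intro f η
    have h1 : HasDerivAt (fun s : ℝ => c + L (Φ (f + s • η))) (L (R f η)) 0 :=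
      (L.hasFDerivAt.comp_hasDerivAt (0 : ℝ) (hΦl f η)).const_add c
    have h2 := (h1.norm_sq).const_mul (1 / 2 : ℝ)
    refine h2.congr_deriv ?_
    simp only [zero_smul, add_zero]
    rw [hq₁]; ring
  · intro f δ η
    have h1 : HasDerivAt (fun s : ℝ => c + L (Φ (f + s • δ))) (L (R f δ)) 0 :=
      (L.hasFDerivAt.comp_hasDerivAt (0 : ℝ) (hΦl f δ)).const_add c
    have h2 := h.hasDerivAt_resolvent_curve (hΦl f δ) η
    simp only [zero_smul, add_zero] at h2
    have h3 := L.hasFDerivAt.comp_hasDerivAt (0 : ℝ) h2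
    have h4 := h1.inner ℝ h3
    refine h4.congr_deriv ?_
    simp only [zero_smul, add_zero, Function.comp]
    rw [hq₂, map_neg, inner_neg_right]
    ring
  · intro f
    have := pow_le_pow_left₀ (norm_nonneg _) (hcb f) 2
    have e : (m₀ * (1 + ‖f‖)) ^ 2 = m₀ ^ 2 * (1 + ‖f‖) ^ 2 := by ring
    have : 0 ≤ (2 * Λ * m₀ + 4 * Λ ^ 2 + 8 * Λ * C * m₀) * (1 + ‖f‖) ^ 2 := by positivity
    nlinarith [sq_nonneg ‖c + L (Φ f)‖]
  · intro f η
    rw [hq₁]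
    calc _ ≤ ‖c + L (Φ f)‖ * ‖L (R f η)‖ := abs_real_inner_le_norm _ _
      _ ≤ (m₀ * (1 + ‖f‖)) * (Λ * (2 * ‖η‖)) := by gcongr; exacts [hcb f, hLR f η]
      _ = (2 * Λ * m₀) * (1 + ‖f‖) * ‖η‖ := by ring
      _ ≤ _ := by
        gcongr
        have : 0 ≤ m₀ ^ 2 + 4 * Λ ^ 2 + 8 * Λ * C * m₀ := by positivity
        linarith
  · intro f δ η
    rw [hq₂]
    have t1 : |⟪L (R f δ), L (R f η)⟫_ℝ| ≤ (4 * Λ ^ 2) * ‖δ‖ * ‖η‖ :=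
      calc _ ≤ ‖L (R f δ)‖ * ‖L (R f η)‖ := abs_real_inner_le_norm _ _
        _ ≤ (Λ * (2 * ‖δ‖)) * (Λ * (2 * ‖η‖)) := by gcongr; exacts [hLR f δ, hLR f η]
        _ = _ := by ring
    have t2 : |⟪c + L (Φ f), L (R f (dd𝒩 (Φ f) (R f δ) (R f η)))⟫_ℝ| ≤
        (8 * Λ * C * m₀) * (1 + ‖f‖) * ‖δ‖ * ‖η‖ :=
      calc _ ≤ ‖c + L (Φ f)‖ * ‖L (R f (dd𝒩 (Φ f) (R f δ) (R f η)))‖ :=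
            abs_real_inner_le_norm _ _
        _ ≤ (m₀ * (1 + ‖f‖)) * (Λ * (2 * (C * (2 * ‖δ‖) * (2 * ‖η‖)))) := by
            gcongr
            · exact hcb f
            · refine (hLR _ _).trans ?_
              gcongr
              refine (ContinuousLinearMap.le_opNorm₂ _ _ _).trans ?_
              gcongr
              exacts [h.norm_second_le _, hRn _ _, hRn _ _]
        _ = _ := by ring
    have t3 : (4 * Λ ^ 2) * ‖δ‖ * ‖η‖ ≤ (4 * Λ ^ 2) * (1 + ‖f‖) * ‖δ‖ * ‖η‖ := by
      have : (4 * Λ ^ 2) * 1 ≤ (4 * Λ ^ 2) * (1 + ‖f‖) := by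
        gcongr; linarith [norm_nonneg f]
      rw [mul_one] at this
      gcongr
    have t4 : 0 ≤ (m₀ ^ 2 + 2 * Λ * m₀) * (1 + ‖f‖) * ‖δ‖ * ‖η‖ := by positivity
    have t5 := abs_sub (⟪L (R f δ), L (R f η)⟫_ℝ)
      (⟪c + L (Φ f), L (R f (dd𝒩 (Φ f) (R f δ) (R f η)))⟫_ℝ)
    calc _ ≤ _ := t5
      _ ≤ _ := add_le_add (t1.trans t3) t2
      _ ≤ _ := by linarith

end IsSmoothPerturbation

end Abstract

/-! ### Superposition operators on `L²` composed with a map into `L⁴`. -/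

section Superposition

open scoped ENNReal

variable {α : Type*} [MeasurableSpace α] {m : Measure α}

theorem eLpNorm_two_eq_lintegral {E : Type*} [NormedAddCommGroup E] (f : α → E) :
    eLpNorm f 2 m = (∫⁻ a, ‖f a‖ₑ ^ 2 ∂m) ^ (1 / 2 : ℝ) := by
  rw [eLpNorm_eq_lintegral_rpow_enorm_toReal (by norm_num) (by norm_num)]
  simp

theorem tendsto_eLpNorm_two_of_dominated {E ι : Type*} [NormedAddCommGroup E] {l : Filter ι}
    [l.IsCountablyGenerated] {f : ι → α → E} {bound : α → ℝ}
    (hf : ∀ i, AEStronglyMeasurable (f i) m) (hbound : MemLp bound 2 m)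
    (hle : ∀ i, ∀ᵐ a ∂m, ‖f i a‖ ≤ bound a)
    (hlim : ∀ᵐ a ∂m, Tendsto (fun i => f i a) l (𝓝 0)) :
    Tendsto (fun i => eLpNorm (f i) 2 m) l (𝓝 0) := by
  simp only [eLpNorm_two_eq_lintegral]
  have h1 : Tendsto (fun i => ∫⁻ a, ‖f i a‖ₑ ^ 2 ∂m) l (𝓝 (∫⁻ _, 0 ∂m)) := by
    refine tendsto_lintegral_filter_of_dominated_convergence' (fun a => ‖bound a‖ₑ ^ 2)
      (Eventually.of_forall fun i => (hf i).enorm.pow_const 2)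
      (Eventually.of_forall fun i => ?_) ?_ ?_
    · filter_upwards [hle i] with a ha
      gcongr
      rw [enorm_le_iff_norm_le]
      exact ha.trans (le_abs_self _)
    · have := hbound.eLpNorm_ne_top
      rw [eLpNorm_two_eq_lintegral] at this
      intro h0
      rw [h0] at this
      simp at this
    · filter_upwards [hlim] with a ha
      have := ENNReal.Tendsto.pow (n := 2) ha.enorm
      simpa using this
  rw [lintegral_zero] at h1
  have := h1.ennrpow_const (1 / 2 : ℝ)
  simpa using this

/-- Hölder with `1/4 + 1/4 = 1/2`. Every second order term below is estimated through this. -/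
theorem eLpNorm_two_le_of_norm_le_mul {E E₁ E₂ : Type*} [NormedAddCommGroup E]
    [NormedAddCommGroup E₁] [NormedAddCommGroup E₂] {w : α → E} {u : α → E₁} {v : α → E₂}
    {M A B : ℝ} (hM : 0 ≤ M) (hA : 0 ≤ A) (hu : AEStronglyMeasurable u m)
    (hv : AEStronglyMeasurable v m)
    (h : ∀ᵐ a ∂m, ‖w a‖ ≤ M * ‖u a‖ * ‖v a‖) (hu4 : eLpNorm u 4 m ≤ ENNReal.ofReal A)
    (hv4 : eLpNorm v 4 m ≤ ENNReal.ofReal B) :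
    eLpNorm w 2 m ≤ ENNReal.ofReal (M * A * B) := by
  have hH : ENNReal.HolderTriple 4 4 2 := by
    refine ⟨?_⟩
    have : (4 : ℝ≥0∞) = 2 * 2 := by norm_num
    rw [this, ENNReal.mul_inv (by norm_num) (by norm_num), ← two_mul, ← mul_assoc,
      ENNReal.mul_inv_cancel (by norm_num) (by norm_num), one_mul]
  calc eLpNorm w 2 m ≤ eLpNorm (fun a => M * (‖u a‖ * ‖v a‖)) 2 m := by
        refine eLpNorm_mono_ae_real ?_
        filter_upwards [h] with a ha
        rwa [← mul_assoc]
    _ ≤ ENNReal.ofReal M * eLpNorm u 4 m * eLpNorm v 4 m := by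
        have := eLpNorm_le_eLpNorm_mul_eLpNorm'_of_norm (p := 4) (q := 4) (r := 2) (μ := m)
          hu hv (fun x y => M * (‖x‖ * ‖y‖)) M.toNNReal
          (Eventually.of_forall fun a => by
            rw [Real.norm_of_nonneg (by positivity), Real.coe_toNNReal _ hM, mul_assoc])
        exact this
    _ ≤ ENNReal.ofReal M * ENNReal.ofReal A * ENNReal.ofReal B := by gcongr
    _ = _ := by rw [ENNReal.ofReal_mul (mul_nonneg hM hA), ENNReal.ofReal_mul hM]

theorem norm_le_of_ae_le_mul_mul {E : Type*} [NormedAddCommGroup E] {w u v : Lp E 2 m} {M A B : ℝ}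
    (hM : 0 ≤ M) (hA : 0 ≤ A) (hB : 0 ≤ B)
    (h : ∀ᵐ a ∂m, ‖w a‖ ≤ M * ‖u a‖ * ‖v a‖) (hu4 : eLpNorm u 4 m ≤ ENNReal.ofReal A)
    (hv4 : eLpNorm v 4 m ≤ ENNReal.ofReal B) : ‖w‖ ≤ M * A * B := by
  rw [Lp.norm_def]
  exact ENNReal.toReal_le_of_le_ofReal (by positivity)
    (eLpNorm_two_le_of_norm_le_mul hM hA (Lp.aestronglyMeasurable u) (Lp.aestronglyMeasurable v)
      h hu4 hv4)

variable {E : Type*} [NormedAddCommGroup E] [NormedSpace ℝ E]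

/-- The conditions on the pointwise nonlinearity of a superposition operator. -/
structure IsSmoothNonlinearity (F : E → E) (M : ℝ) : Prop where
  zero : F 0 = 0
  contDiff : ContDiff ℝ 2 F
  norm_fderiv_le : ∀ z, ‖fderiv ℝ F z‖ ≤ M
  norm_fderiv_fderiv_le : ∀ z, ‖fderiv ℝ (fderiv ℝ F) z‖ ≤ M

namespace IsSmoothNonlinearity

variable {F : E → E} {M : ℝ}

theorem nonneg (h : IsSmoothNonlinearity F M) : 0 ≤ M :=
  (norm_nonneg _).trans (h.norm_fderiv_le 0)

theorem contDiff_fderiv (h : IsSmoothNonlinearity F M) : ContDiff ℝ 1 (fderiv ℝ F) :=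
  h.contDiff.fderiv_right (by norm_num)

theorem hasFDerivAt_fderiv (h : IsSmoothNonlinearity F M) (z : E) :
    HasFDerivAt (fderiv ℝ F) (fderiv ℝ (fderiv ℝ F) z) z :=
  ((h.contDiff_fderiv.differentiable (by norm_num)) z).hasFDerivAt

theorem norm_sub_le (h : IsSmoothNonlinearity F M) (z z' : E) : ‖F z - F z'‖ ≤ M * ‖z - z'‖ :=
  Convex.norm_image_sub_le_of_norm_fderiv_le (s := univ)
    (fun x _ => h.contDiff.differentiable (by norm_num) x) (fun x _ => h.norm_fderiv_le x)
    convex_univ (mem_univ _) (mem_univ _)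

theorem norm_le (h : IsSmoothNonlinearity F M) (z : E) : ‖F z‖ ≤ M * ‖z‖ := by
  simpa [h.zero] using h.norm_sub_le z 0

theorem norm_fderiv_sub_le (h : IsSmoothNonlinearity F M) (z z' : E) :
    ‖fderiv ℝ F z - fderiv ℝ F z'‖ ≤ M * ‖z - z'‖ :=
  Convex.norm_image_sub_le_of_norm_fderiv_le (s := univ)
    (fun x _ => h.contDiff_fderiv.differentiable (by norm_num) x)
    (fun x _ => h.norm_fderiv_fderiv_le x) convex_univ (mem_univ _) (mem_univ _)

/-- The mean value inequality on the segment, where `F'` stays within `M ‖z' - z‖` of `F' z`. The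
sharp factor `1/2` is not needed. -/
theorem norm_taylor_le (h : IsSmoothNonlinearity F M) (z z' : E) :
    ‖F z' - F z - fderiv ℝ F z (z' - z)‖ ≤ M * ‖z' - z‖ * ‖z' - z‖ := by
  refine Convex.norm_image_sub_le_of_norm_fderiv_le' (s := segment ℝ z z')
    (fun x _ => h.contDiff.differentiable (by norm_num) x) (fun x hx => ?_) (convex_segment _ _)
    (left_mem_segment _ _ _) (right_mem_segment _ _ _)
  refine (h.norm_fderiv_sub_le x z).trans ?_
  have hM := h.nonneg
  gcongr
  rw [segment_eq_image'] at hx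
  obtain ⟨θ, ⟨h0, h1⟩, rfl⟩ := hx
  rw [add_sub_cancel_left, norm_smul, Real.norm_of_nonneg h0]
  nlinarith [norm_nonneg (z' - z)]

theorem hasDerivAt_fderiv_line (h : IsSmoothNonlinearity F M) (z d e : E) :
    HasDerivAt (fun s : ℝ => fderiv ℝ F (z + s • d) e) (fderiv ℝ (fderiv ℝ F) z d e) 0 := by
  have h1 : HasDerivAt (fun s : ℝ => z + s • d) d 0 := by
    simpa using ((hasDerivAt_id (0 : ℝ)).smul_const d).const_add z
  have h2 : HasFDerivAt (fderiv ℝ F) (fderiv ℝ (fderiv ℝ F) z) (z + (0 : ℝ) • d) := by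
    simpa using h.hasFDerivAt_fderiv z
  have h3 : HasDerivAt (fun s : ℝ => fderiv ℝ F (z + s • d)) (fderiv ℝ (fderiv ℝ F) z d) 0 :=
    h2.comp_hasDerivAt (0 : ℝ) h1
  exact ((ContinuousLinearMap.apply ℝ E e).hasFDerivAt.comp_hasDerivAt (0 : ℝ) h3)

theorem continuous_fderiv_apply (h : IsSmoothNonlinearity F M) :
    Continuous fun p : E × E => fderiv ℝ F p.1 p.2 :=
  (h.contDiff_fderiv.continuous.comp continuous_fst).clm_apply continuous_snd

theorem continuous_fderiv_fderiv_apply (h : IsSmoothNonlinearity F M) :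
    Continuous fun p : E × E × E => fderiv ℝ (fderiv ℝ F) p.1 p.2.1 p.2.2 :=
  (((h.contDiff_fderiv.continuous_fderiv (by norm_num)).comp continuous_fst).clm_apply
    (continuous_fst.comp continuous_snd)).clm_apply (continuous_snd.comp continuous_snd)

theorem memLp_comp (h : IsSmoothNonlinearity F M) {y : α → E} (hy : MemLp y 2 m) :
    MemLp (fun a => F (y a)) 2 m :=
  hy.of_le_mul (c := M) (h.contDiff.continuous.comp_aestronglyMeasurable hy.1)
    (Eventually.of_forall fun _ => h.norm_le _)

theorem memLp_fderiv (h : IsSmoothNonlinearity F M) {y : α → E} (hy : AEStronglyMeasurable y m)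
    {u : α → E} (hu : MemLp u 2 m) : MemLp (fun a => fderiv ℝ F (y a) (u a)) 2 m :=
  hu.of_le_mul (c := M) (h.continuous_fderiv_apply.comp_aestronglyMeasurable (hy.prodMk hu.1))
    (Eventually.of_forall fun _ => (fderiv ℝ F _).le_of_opNorm_le (h.norm_fderiv_le _) _)

/-- The superposition operator `y ↦ F ∘ y` on `L²`. -/
def superpose (h : IsSmoothNonlinearity F M) (y : Lp E 2 m) : Lp E 2 m :=
  (h.memLp_comp (Lp.memLp y)).toLp

/-- Pointwise application of `F'(y)` on `L²`. -/
def superposeDeriv (h : IsSmoothNonlinearity F M) (y : Lp E 2 m) : Lp E 2 m →L[ℝ] Lp E 2 m :=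
  LinearMap.mkContinuous
    { toFun := fun u => (h.memLp_fderiv (Lp.aestronglyMeasurable y) (Lp.memLp u)).toLp
      map_add' := fun u v => by
        rw [← MemLp.toLp_add]
        refine MemLp.toLp_congr _ _ ?_
        filter_upwards [Lp.coeFn_add u v] with a ha
        rw [ha]; simp
      map_smul' := fun c u => by
        rw [RingHom.id_apply, ← MemLp.toLp_const_smul]
        refine MemLp.toLp_congr _ _ ?_
        filter_upwards [Lp.coeFn_smul c u] with a ha
        rw [ha]; simp } M fun u => by
      refine Lp.norm_le_mul_norm_of_ae_le_mul ?_
      filter_upwards [MemLp.coeFn_toLp (h.memLp_fderiv (Lp.aestronglyMeasurable y) (Lp.memLp u))]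
        with a ha
      exact (congrArg norm ha).trans_le
        ((fderiv ℝ F _).le_of_opNorm_le (h.norm_fderiv_le _) _)

theorem coeFn_superpose (h : IsSmoothNonlinearity F M) (y : Lp E 2 m) :
    h.superpose y =ᵐ[m] fun a => F (y a) :=
  MemLp.coeFn_toLp _

theorem coeFn_superposeDeriv (h : IsSmoothNonlinearity F M) (y u : Lp E 2 m) :
    h.superposeDeriv y u =ᵐ[m] fun a => fderiv ℝ F (y a) (u a) :=
  MemLp.coeFn_toLp (h.memLp_fderiv (Lp.aestronglyMeasurable y) (Lp.memLp u))

theorem norm_superposeDeriv_le (h : IsSmoothNonlinearity F M) (y : Lp E 2 m) :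
    ‖h.superposeDeriv y‖ ≤ M :=
  LinearMap.mkContinuous_norm_le _ h.nonneg _

variable {S : Lp E 2 m →L[ℝ] Lp E 2 m} {C₄ : ℝ}

theorem memLp_second (h : IsSmoothNonlinearity F M) (hC₄ : 0 ≤ C₄)
    (hS : ∀ g, eLpNorm (S g) 4 m ≤ ENNReal.ofReal (C₄ * ‖g‖)) (y δ η : Lp E 2 m) :
    MemLp (fun a => fderiv ℝ (fderiv ℝ F) (y a) (S δ a) (S η a)) 2 m := by
  refine ⟨h.continuous_fderiv_fderiv_apply.comp_aestronglyMeasurable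
    ((Lp.aestronglyMeasurable y).prodMk
      ((Lp.aestronglyMeasurable (S δ)).prodMk (Lp.aestronglyMeasurable (S η)))), ?_⟩
  refine (eLpNorm_two_le_of_norm_le_mul h.nonneg (by positivity) (Lp.aestronglyMeasurable (S δ))
    (Lp.aestronglyMeasurable (S η)) (Eventually.of_forall fun a => ?_) (hS δ) (hS η)).trans_lt
    ENNReal.ofReal_lt_top
  refine (ContinuousLinearMap.le_opNorm₂ _ _ _).trans ?_
  gcongr
  exact h.norm_fderiv_fderiv_le _

/-- The second derivative of the superposition operator, precomposed with `S`. -/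
def superposeSecond (h : IsSmoothNonlinearity F M) (hC₄ : 0 ≤ C₄)
    (hS : ∀ g, eLpNorm (S g) 4 m ≤ ENNReal.ofReal (C₄ * ‖g‖)) (y : Lp E 2 m) :
    Lp E 2 m →L[ℝ] Lp E 2 m →L[ℝ] Lp E 2 m :=
  LinearMap.mkContinuous₂
    (LinearMap.mk₂ ℝ (fun δ η => (h.memLp_second hC₄ hS y δ η).toLp)
      (fun δ δ' η => by
        rw [← MemLp.toLp_add]
        refine MemLp.toLp_congr _ _ ?_
        rw [map_add]
        filter_upwards [Lp.coeFn_add (S δ) (S δ')] with a ha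
        rw [ha]; simp)
      (fun c δ η => by
        rw [← MemLp.toLp_const_smul]
        refine MemLp.toLp_congr _ _ ?_
        rw [map_smul]
        filter_upwards [Lp.coeFn_smul c (S δ)] with a ha
        rw [ha]; simp)
      (fun δ η η' => by
        rw [← MemLp.toLp_add]
        refine MemLp.toLp_congr _ _ ?_
        rw [map_add]
        filter_upwards [Lp.coeFn_add (S η) (S η')] with a ha
        rw [ha]; simp)
      (fun c δ η => by
        rw [← MemLp.toLp_const_smul]
        refine MemLp.toLp_congr _ _ ?_
        rw [map_smul]
        filter_upwards [Lp.coeFn_smul c (S η)] with a ha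
        rw [ha]; simp)) (M * C₄ ^ 2) fun δ η => by
      have := norm_le_of_ae_le_mul_mul (w := (h.memLp_second hC₄ hS y δ η).toLp) h.nonneg
        (A := C₄ * ‖δ‖) (B := C₄ * ‖η‖)
        (by positivity) (by positivity) ?_ (hS δ) (hS η)
      · exact this.trans_eq (by ring)
      · filter_upwards [MemLp.coeFn_toLp (h.memLp_second hC₄ hS y δ η)] with a ha
        rw [ha]
        refine (ContinuousLinearMap.le_opNorm₂ _ _ _).trans ?_
        gcongr
        exact h.norm_fderiv_fderiv_le _

theorem coeFn_superposeSecond (h : IsSmoothNonlinearity F M) (hC₄ : 0 ≤ C₄)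
    (hS : ∀ g, eLpNorm (S g) 4 m ≤ ENNReal.ofReal (C₄ * ‖g‖)) (y δ η : Lp E 2 m) :
    h.superposeSecond hC₄ hS y δ η =ᵐ[m]
      fun a => fderiv ℝ (fderiv ℝ F) (y a) (S δ a) (S η a) :=
  MemLp.coeFn_toLp (h.memLp_second hC₄ hS y δ η)

theorem norm_superposeSecond_le (h : IsSmoothNonlinearity F M) (hC₄ : 0 ≤ C₄)
    (hS : ∀ g, eLpNorm (S g) 4 m ≤ ENNReal.ofReal (C₄ * ‖g‖)) (y : Lp E 2 m) :
    ‖h.superposeSecond hC₄ hS y‖ ≤ M * C₄ ^ 2 :=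
  LinearMap.mkContinuous₂_norm_le _ (mul_nonneg h.nonneg (sq_nonneg _)) _

/-- The pointwise Taylor remainder is bounded by `M |S (x - g)|²`, whose `L²` norm is controlled by
the square of an `L⁴` norm, hence by `‖x - g‖²`. -/
theorem hasFDerivAt_superpose (h : IsSmoothNonlinearity F M) (hC₄ : 0 ≤ C₄)
    (hS : ∀ g, eLpNorm (S g) 4 m ≤ ENNReal.ofReal (C₄ * ‖g‖)) (y₀ g : Lp E 2 m) :
    HasFDerivAt (fun g => h.superpose (y₀ + S g)) (h.superposeDeriv (y₀ + S g) ∘L S) g := by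
  rw [hasFDerivAt_iff_isLittleO]
  have hO : (fun x => h.superpose (y₀ + S x) - h.superpose (y₀ + S g) -
      (h.superposeDeriv (y₀ + S g) ∘L S) (x - g)) =O[𝓝 g] fun x => ‖x - g‖ ^ 2 := by
    refine Asymptotics.IsBigO.of_bound (M * C₄ ^ 2) (Eventually.of_forall fun x => ?_)
    rw [norm_pow, norm_norm]
    have := norm_le_of_ae_le_mul_mul (M := M) (u := S (x - g)) (v := S (x - g))
      (w := h.superpose (y₀ + S x) - h.superpose (y₀ + S g) -
        (h.superposeDeriv (y₀ + S g) ∘L S) (x - g)) h.nonneg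
        (A := C₄ * ‖x - g‖) (B := C₄ * ‖x - g‖)
        (by positivity) (by positivity) ?_ (hS _) (hS _)
    · exact this.trans_eq (by ring)
    · filter_upwards [Lp.coeFn_sub (h.superpose (y₀ + S x) - h.superpose (y₀ + S g))
        ((h.superposeDeriv (y₀ + S g) ∘L S) (x - g)),
        Lp.coeFn_sub (h.superpose (y₀ + S x)) (h.superpose (y₀ + S g)),
        h.coeFn_superpose (y₀ + S x), h.coeFn_superpose (y₀ + S g),
        h.coeFn_superposeDeriv (y₀ + S g) (S (x - g)),
        Lp.coeFn_sub (y₀ + S x) (y₀ + S g)] with a h1 h2 h3 h4 h5 h6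
      have e : y₀ + S x - (y₀ + S g) = S (x - g) := by rw [map_sub]; abel
      rw [e, Pi.sub_apply] at h6
      rw [h1, Pi.sub_apply, h2, Pi.sub_apply, h3, h4, ContinuousLinearMap.comp_apply, h5, h6]
      exact h.norm_taylor_le _ _
  refine hO.trans_isLittleO ?_
  have h2 : (fun x : Lp E 2 m => ‖x - g‖ ^ 2) =o[𝓝 g] fun x => ‖x - g‖ := by
    have h3 : Tendsto (fun x : Lp E 2 m => ‖x - g‖) (𝓝 g) (𝓝 0) := by
      have : Continuous fun x : Lp E 2 m => ‖x - g‖ := by fun_prop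
      simpa using this.tendsto g
    simpa [Function.comp_def] using
      (Asymptotics.isLittleO_pow_id (𝕜 := ℝ) (n := 2) (by norm_num)).comp_tendsto h3
  exact h2.trans_isBigO (Asymptotics.isBigO_refl _ _).norm_left

theorem norm_superposeDeriv_sub_le (h : IsSmoothNonlinearity F M) (hC₄ : 0 ≤ C₄)
    (hS : ∀ g, eLpNorm (S g) 4 m ≤ ENNReal.ofReal (C₄ * ‖g‖)) (y₀ g g' : Lp E 2 m) :
    ‖h.superposeDeriv (y₀ + S g) ∘L S - h.superposeDeriv (y₀ + S g') ∘L S‖ ≤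
      M * C₄ ^ 2 * ‖g - g'‖ := by
  have hM := h.nonneg
  refine ContinuousLinearMap.opNorm_le_bound _ (by positivity) fun u => ?_
  have := norm_le_of_ae_le_mul_mul (M := M) (u := S (g - g')) (v := S u)
      (w := (h.superposeDeriv (y₀ + S g) ∘L S - h.superposeDeriv (y₀ + S g') ∘L S) u) h.nonneg
        (A := C₄ * ‖g - g'‖) (B := C₄ * ‖u‖)
        (by positivity) (by positivity) ?_ (hS _) (hS _)
  · exact this.trans_eq (by ring)
  · filter_upwards [Lp.coeFn_sub (h.superposeDeriv (y₀ + S g) (S u))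
        (h.superposeDeriv (y₀ + S g') (S u)),
        h.coeFn_superposeDeriv (y₀ + S g) (S u), h.coeFn_superposeDeriv (y₀ + S g') (S u),
        Lp.coeFn_sub (y₀ + S g) (y₀ + S g')] with a h1 h2 h3 h4
    have e : y₀ + S g - (y₀ + S g') = S (g - g') := by rw [map_sub]; abel
    rw [e, Pi.sub_apply] at h4
    rw [_root_.sub_apply, ContinuousLinearMap.comp_apply, ContinuousLinearMap.comp_apply, h1,
      Pi.sub_apply, h2, h3, ← _root_.sub_apply, h4]
    exact (ContinuousLinearMap.le_opNorm _ _).trans (by gcongr; exact h.norm_fderiv_sub_le _ _)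

/-- `F''` is merely continuous and bounded, so no rate is available. Dominated convergence applies
with majorant `2 M |S δ| |S η|`, which is in `L²` by Hölder; this is why the second derivative is
taken only in fixed directions. -/
theorem tendsto_eLpNorm_slope (h : IsSmoothNonlinearity F M) (hC₄ : 0 ≤ C₄)
    (hS : ∀ g, eLpNorm (S g) 4 m ≤ ENNReal.ofReal (C₄ * ‖g‖)) (y δ η : Lp E 2 m) :
    Tendsto (fun s : ℝ => eLpNorm (fun a => s⁻¹ • (fderiv ℝ F (y a + s • S δ a) (S η a) -
      fderiv ℝ F (y a) (S η a)) - fderiv ℝ (fderiv ℝ F) (y a) (S δ a) (S η a)) 2 m)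
      (𝓝[≠] 0) (𝓝 0) := by
  have hmy := Lp.aestronglyMeasurable y
  have hmδ := Lp.aestronglyMeasurable (S δ)
  have hmη := Lp.aestronglyMeasurable (S η)
  have hM := h.nonneg
  refine tendsto_eLpNorm_two_of_dominated (bound := fun a => 2 * M * ‖S δ a‖ * ‖S η a‖)
    (fun s => ?_) ?_ (fun s => ?_) ?_
  · refine AEStronglyMeasurable.sub (AEStronglyMeasurable.const_smul
      (AEStronglyMeasurable.sub ?_ ?_) _) (h.memLp_second hC₄ hS y δ η).1
    · exact h.continuous_fderiv_apply.comp_aestronglyMeasurable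
        ((hmy.add (hmδ.const_smul s)).prodMk hmη)
    · exact h.continuous_fderiv_apply.comp_aestronglyMeasurable (hmy.prodMk hmη)
  · refine ⟨(hmδ.norm.const_mul _).mul hmη.norm, ?_⟩
    refine (eLpNorm_two_le_of_norm_le_mul (M := 2 * M) (by positivity) (by positivity)
      hmδ hmη (Eventually.of_forall fun a => ?_) (hS δ) (hS η)).trans_lt ENNReal.ofReal_lt_top
    rw [Real.norm_of_nonneg (by positivity)]
  · refine Eventually.of_forall fun a => ?_
    have t1 : ‖s⁻¹ • (fderiv ℝ F (y a + s • S δ a) (S η a) - fderiv ℝ F (y a) (S η a))‖ ≤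
        M * ‖S δ a‖ * ‖S η a‖ := by
      rcases eq_or_ne s 0 with rfl | hs
      · simp; positivity
      · rw [norm_smul, ← _root_.sub_apply, norm_inv]
        have t2 : ‖fderiv ℝ F (y a + s • S δ a) - fderiv ℝ F (y a)‖ ≤ M * (‖s‖ * ‖S δ a‖) := by
          simpa [norm_smul] using h.norm_fderiv_sub_le (y a + s • S δ a) (y a)
        calc _ ≤ ‖s‖⁻¹ * ((M * (‖s‖ * ‖S δ a‖)) * ‖S η a‖) := by
              gcongr
              exact (ContinuousLinearMap.le_opNorm _ _).trans (by gcongr)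
          _ = _ := by
              have : ‖s‖ ≠ 0 := norm_ne_zero_iff.2 hs
              field_simp
    have t3 : ‖fderiv ℝ (fderiv ℝ F) (y a) (S δ a) (S η a)‖ ≤ M * ‖S δ a‖ * ‖S η a‖ := by
      refine (ContinuousLinearMap.le_opNorm₂ _ _ _).trans ?_
      gcongr
      exact h.norm_fderiv_fderiv_le _
    calc _ ≤ _ := _root_.norm_sub_le _ _
      _ ≤ _ := add_le_add t1 t3
      _ = _ := by ring
  · refine Eventually.of_forall fun a => ?_
    have h3 := h.hasDerivAt_fderiv_line (y a) (S δ a) (S η a)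
    rw [hasDerivAt_iff_tendsto_slope_zero] at h3
    have h4 := h3.sub_const (fderiv ℝ (fderiv ℝ F) (y a) (S δ a) (S η a))
    simpa using h4

theorem hasDerivAt_superposeDeriv (h : IsSmoothNonlinearity F M) (hC₄ : 0 ≤ C₄)
    (hS : ∀ g, eLpNorm (S g) 4 m ≤ ENNReal.ofReal (C₄ * ‖g‖)) (y₀ g δ η : Lp E 2 m) :
    HasDerivAt (fun s : ℝ => (h.superposeDeriv (y₀ + S (g + s • δ)) ∘L S) η)
      (h.superposeSecond hC₄ hS (y₀ + S g) δ η) 0 := by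
  rw [hasDerivAt_iff_tendsto_slope_zero, tendsto_iff_norm_sub_tendsto_zero]
  set y := y₀ + S g with hy
  have h0 := (ENNReal.tendsto_toReal ENNReal.zero_ne_top).comp
    (h.tendsto_eLpNorm_slope hC₄ hS y δ η)
  rw [ENNReal.toReal_zero] at h0
  refine h0.congr fun s => ?_
  rw [Function.comp_apply, Lp.norm_def]
  congr 1
  refine eLpNorm_congr_ae ?_
  simp only [zero_add, zero_smul, add_zero, ContinuousLinearMap.comp_apply]
  have e : y₀ + S (g + s • δ) = y + s • S δ := by rw [map_add, map_smul, hy]; abel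
  rw [e, ← hy]
  filter_upwards [Lp.coeFn_sub (s⁻¹ • (h.superposeDeriv (y + s • S δ) (S η) -
      h.superposeDeriv y (S η))) (h.superposeSecond hC₄ hS y δ η),
    Lp.coeFn_smul s⁻¹ (h.superposeDeriv (y + s • S δ) (S η) - h.superposeDeriv y (S η)),
    Lp.coeFn_sub (h.superposeDeriv (y + s • S δ) (S η)) (h.superposeDeriv y (S η)),
    h.coeFn_superposeDeriv (y + s • S δ) (S η), h.coeFn_superposeDeriv y (S η),
    h.coeFn_superposeSecond hC₄ hS y δ η, Lp.coeFn_add y (s • S δ), Lp.coeFn_smul s (S δ)]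
    with a h1 h2 h3 h4 h5 h6 h7 h8
  rw [h1, Pi.sub_apply, h2, Pi.smul_apply, h3, Pi.sub_apply, h4, h5, h6, h7, Pi.add_apply, h8,
    Pi.smul_apply]

/-- A superposition operator composed with a smoothing operator `S : L² → L⁴` of small `L²` norm
is a smooth perturbation of the identity. -/
theorem isSmoothPerturbation (h : IsSmoothNonlinearity F M) (hC₄ : 0 ≤ C₄)
    (hS : ∀ g, eLpNorm (S g) 4 m ≤ ENNReal.ofReal (C₄ * ‖g‖)) (hSM : M * ‖S‖ ≤ 1 / 2)
    (y₀ : Lp E 2 m) :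
    IsSmoothPerturbation (fun g => h.superpose (y₀ + S g))
      (fun g => h.superposeDeriv (y₀ + S g) ∘L S)
      (fun g => h.superposeSecond hC₄ hS (y₀ + S g)) (M * C₄ ^ 2) where
  hasFDerivAt := h.hasFDerivAt_superpose hC₄ hS y₀
  norm_deriv_le _ := (ContinuousLinearMap.opNorm_comp_le _ _).trans
    ((mul_le_mul_of_nonneg_right (h.norm_superposeDeriv_le _) (norm_nonneg _)).trans hSM)
  lipschitz_deriv := h.norm_superposeDeriv_sub_le hC₄ hS y₀
  hasDerivAt_deriv := h.hasDerivAt_superposeDeriv hC₄ hS y₀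
  norm_second_le _ := h.norm_superposeSecond_le hC₄ hS _

end IsSmoothNonlinearity

end Superposition

/-! ### The exponentially weighted measure and the primitive in time. -/

section Volterra

open scoped ENNReal InnerProductSpace

/-- Lebesgue measure on the cylinder with the exponential weight `e^{-2 λ t}`. -/
def weightedMeasure (T lam : ℝ) : Measure (ℝ × ℝ) :=
  (cylMeasure (Ioo 0 1) T).withDensity fun z => ENNReal.ofReal (Real.exp (-(2 * lam * z.2)))

theorem cylMeasure_eq_prod (S : Set ℝ) (T : ℝ) :
    cylMeasure S T = (volume.restrict S).prod (volume.restrict (Ioo 0 T)) := by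
  rw [cylMeasure, Measure.volume_eq_prod, Measure.prod_restrict]

theorem ae_mem_cylinder (T : ℝ) : ∀ᵐ z ∂cylMeasure (Ioo 0 1) T, z ∈ cylinder T :=
  ae_restrict_mem (measurableSet_Ioo.prod measurableSet_Ioo)

instance (T : ℝ) : IsFiniteMeasure (cylMeasure (Ioo 0 1) T) := by
  rw [cylMeasure_eq_prod]; infer_instance

theorem measurable_expWeight (lam : ℝ) :
    Measurable fun z : ℝ × ℝ => ENNReal.ofReal (Real.exp (-(2 * lam * z.2))) := by fun_prop

theorem weightedMeasure_le {T lam : ℝ} (hlam : 0 ≤ lam) :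
    weightedMeasure T lam ≤ cylMeasure (Ioo 0 1) T := by
  calc weightedMeasure T lam ≤ (cylMeasure (Ioo 0 1) T).withDensity 1 := by
        refine withDensity_mono ?_
        filter_upwards [ae_mem_cylinder T] with z hz
        refine ENNReal.ofReal_le_one.2 (Real.exp_le_one_iff.2 ?_)
        have := hz.2.1
        simp only [Left.neg_nonpos_iff]
        positivity
    _ = _ := withDensity_one

/-- On the bounded interval `(0,T)` the weight is bounded below by `e^{-2λT}`. Hence both measures
have the same null sets and the same `L²` functions, and statements move freely between them. -/
theorem cylMeasure_le_smul {T lam : ℝ} (hlam : 0 ≤ lam) :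
    cylMeasure (Ioo 0 1) T ≤ ENNReal.ofReal (Real.exp (2 * lam * T)) • weightedMeasure T lam := by
  rw [weightedMeasure, ← withDensity_smul _ (measurable_expWeight lam)]
  calc cylMeasure (Ioo 0 1) T = (cylMeasure (Ioo 0 1) T).withDensity 1 := withDensity_one.symm
    _ ≤ _ := by
        refine withDensity_mono ?_
        filter_upwards [ae_mem_cylinder T] with z hz
        rw [Pi.smul_apply, smul_eq_mul, ← ENNReal.ofReal_mul (by positivity), ← Real.exp_add]
        refine ENNReal.one_le_ofReal.2 (Real.one_le_exp ?_)
        have := hz.2.2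
        nlinarith

instance (T : ℝ) (lam : ℝ) [Fact (0 ≤ lam)] : IsFiniteMeasure (weightedMeasure T lam) :=
  isFiniteMeasure_of_le _ (weightedMeasure_le Fact.out)

theorem ae_weightedMeasure_iff {T lam : ℝ} (hlam : 0 ≤ lam) {p : ℝ × ℝ → Prop} :
    (∀ᵐ z ∂weightedMeasure T lam, p z) ↔ ∀ᵐ z ∂cylMeasure (Ioo 0 1) T, p z := by
  refine ⟨fun h => ?_, fun h => ?_⟩
  · exact (Measure.absolutelyContinuous_of_le_smul (cylMeasure_le_smul hlam)).ae_le h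
  · exact (weightedMeasure_le hlam).absolutelyContinuous.ae_le h

theorem eLpNorm_weightedMeasure_le {E : Type*} [NormedAddCommGroup E] {T lam : ℝ} (hlam : 0 ≤ lam)
    (f : ℝ × ℝ → E) (p : ℝ≥0∞) :
    eLpNorm f p (weightedMeasure T lam) ≤ eLpNorm f p (cylMeasure (Ioo 0 1) T) :=
  eLpNorm_mono_measure _ (weightedMeasure_le hlam)

theorem eLpNorm_two_cylMeasure_le {E : Type*} [NormedAddCommGroup E] {T lam : ℝ} (hlam : 0 ≤ lam)
    (f : ℝ × ℝ → E) :
    eLpNorm f 2 (cylMeasure (Ioo 0 1) T) ≤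
      ENNReal.ofReal (Real.exp (lam * T)) * eLpNorm f 2 (weightedMeasure T lam) := by
  refine (eLpNorm_mono_measure f (cylMeasure_le_smul hlam)).trans_eq ?_
  rw [eLpNorm_smul_measure_of_ne_top (by norm_num), smul_eq_mul,
    ENNReal.ofReal_rpow_of_pos (by positivity), ← Real.exp_mul]
  congr 3
  simp only [one_div, ENNReal.toReal_inv, ENNReal.toReal_ofNat]
  ring

theorem memLp_weightedMeasure_iff {E : Type*} [NormedAddCommGroup E] {T lam : ℝ} (hlam : 0 ≤ lam)
    {f : ℝ × ℝ → E} :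
    MemLp f 2 (weightedMeasure T lam) ↔ MemLp f 2 (cylMeasure (Ioo 0 1) T) := by
  refine ⟨fun h => ⟨?_, ?_⟩, fun h => h.mono_measure (weightedMeasure_le hlam)⟩
  · exact h.1.mono_ac (Measure.absolutelyContinuous_of_le_smul (cylMeasure_le_smul hlam))
  · exact (eLpNorm_two_cylMeasure_le hlam f).trans_lt
      (ENNReal.mul_lt_top ENNReal.ofReal_lt_top h.2)

theorem integral_weightedMeasure {T lam : ℝ} (f : ℝ × ℝ → ℝ) :
    ∫ z, f z ∂weightedMeasure T lam =
      ∫ z, Real.exp (-(2 * lam * z.2)) * f z ∂cylMeasure (Ioo 0 1) T := by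
  rw [weightedMeasure, integral_withDensity_eq_integral_toReal_smul (measurable_expWeight lam)
    (Eventually.of_forall fun _ => ENNReal.ofReal_lt_top)]
  simp only [ENNReal.toReal_ofReal (Real.exp_pos _).le, smul_eq_mul]

theorem inner_toLp_weightedMeasure {T lam : ℝ} (f g : Lp ℝ 2 (weightedMeasure T lam)) :
    ⟪f, g⟫_ℝ = ∫ z, Real.exp (-(2 * lam * z.2)) * (f z * g z) ∂cylMeasure (Ioo 0 1) T := by
  rw [L2.inner_def, ← integral_weightedMeasure]
  simp only [RCLike.inner_apply, conj_trivial, mul_comm]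

theorem sq_lintegral_le {α : Type*} [MeasurableSpace α] {μ : Measure α} {f : α → ℝ≥0∞}
    (hf : AEMeasurable f μ) : (∫⁻ a, f a ∂μ) ^ 2 ≤ μ univ * ∫⁻ a, f a ^ 2 ∂μ := by
  have h := ENNReal.lintegral_mul_le_Lp_mul_Lq μ (p := 2) (q := 2) Real.HolderConjugate.two_two hf
    (g := 1) aemeasurable_const
  simp only [mul_one, Pi.one_apply, ENNReal.rpow_ofNat, one_pow, lintegral_one] at h
  calc (∫⁻ a, f a ∂μ) ^ 2 ≤ ((∫⁻ a, f a ^ 2 ∂μ) ^ (1 / 2 : ℝ) * μ univ ^ (1 / 2 : ℝ)) ^ 2 := by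
        gcongr
    _ = _ := by
        rw [mul_pow, ← ENNReal.rpow_natCast, ← ENNReal.rpow_natCast, ← ENNReal.rpow_mul,
          ← ENNReal.rpow_mul]
        norm_num
        rw [mul_comm]

/-- The primitive in time `∫₀ᵗ f(x,s) ds`. -/
def primitive (f : ℝ × ℝ → ℝ) (z : ℝ × ℝ) : ℝ := ∫ s in Ioo 0 z.2, f (z.1, s)

theorem ae_cyl_of_ae_fst {T : ℝ} {p : ℝ → Prop} (h : ∀ᵐ x ∂volume.restrict (Ioo (0 : ℝ) 1), p x) :
    ∀ᵐ z ∂cylMeasure (Ioo 0 1) T, p z.1 := by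
  rw [cylMeasure_eq_prod]
  exact Measure.quasiMeasurePreserving_fst.ae h

/-- By Fubini, almost every `x`-section of `f` and `g` agrees almost everywhere in time, so the
primitive descends to classes of functions. -/
theorem primitive_congr {T : ℝ} {f g : ℝ × ℝ → ℝ} (h : f =ᵐ[cylMeasure (Ioo 0 1) T] g) :
    primitive f =ᵐ[cylMeasure (Ioo 0 1) T] primitive g := by
  have h1 : ∀ᵐ x ∂volume.restrict (Ioo (0 : ℝ) 1), ∀ᵐ t ∂volume.restrict (Ioo (0 : ℝ) T),
      f (x, t) = g (x, t) := by
    rw [cylMeasure_eq_prod] at h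
    exact Measure.ae_ae_of_ae_prod h
  filter_upwards [ae_cyl_of_ae_fst h1, ae_mem_cylinder T] with z hz hzT
  refine integral_congr_ae ?_
  exact ae_restrict_of_ae_restrict_of_subset (Ioo_subset_Ioo_right hzT.2.2.le) hz

theorem measurable_primitive {f : ℝ × ℝ → ℝ} (hf : StronglyMeasurable f) :
    StronglyMeasurable (primitive f) := by
  have h1 : StronglyMeasurable fun p : (ℝ × ℝ) × ℝ =>
      {p : (ℝ × ℝ) × ℝ | p.2 ∈ Ioo 0 p.1.2}.indicator (fun p => f (p.1.1, p.2)) p := by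
    refine StronglyMeasurable.indicator ?_ ?_
    · exact hf.comp_measurable (by fun_prop)
    · exact (measurableSet_lt measurable_const measurable_snd).inter
        (measurableSet_lt measurable_snd (by fun_prop))
  have h2 := h1.integral_prod_right' (ν := (volume : Measure ℝ))
  convert h2 using 1
  ext z
  rw [primitive, ← integral_indicator measurableSet_Ioo]
  rfl

theorem aestronglyMeasurable_primitive {T : ℝ} {f : ℝ × ℝ → ℝ}
    (hf : AEStronglyMeasurable f (cylMeasure (Ioo 0 1) T)) :
    AEStronglyMeasurable (primitive f) (cylMeasure (Ioo 0 1) T) :=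
  ((measurable_primitive hf.stronglyMeasurable_mk).aestronglyMeasurable).congr
    (primitive_congr hf.ae_eq_mk).symm

theorem enorm_primitive_sq_le {T : ℝ} {f : ℝ × ℝ → ℝ}
    {x t : ℝ} (hf : AEStronglyMeasurable (fun s => f (x, s)) (volume.restrict (Ioo 0 T)))
    (ht : t ∈ Ioo 0 T) :
    ‖primitive f (x, t)‖ₑ ^ 2 ≤ ENNReal.ofReal T * ∫⁻ s in Ioo 0 T, ‖f (x, s)‖ₑ ^ 2 := by
  calc ‖primitive f (x, t)‖ₑ ^ 2 ≤ (∫⁻ s in Ioo 0 t, ‖f (x, s)‖ₑ) ^ 2 := by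
        gcongr; exact enorm_integral_le_lintegral_enorm _
    _ ≤ (∫⁻ s in Ioo 0 T, ‖f (x, s)‖ₑ) ^ 2 := by
        gcongr; exact ht.2.le
    _ ≤ _ := by
        refine (sq_lintegral_le hf.enorm).trans_eq ?_
        simp

/-- Uniform bound in time for the spatial `L²` norm of a primitive. -/
theorem lintegral_primitive_sq_le {T : ℝ} {f : ℝ × ℝ → ℝ}
    (hf : AEStronglyMeasurable f (cylMeasure (Ioo 0 1) T)) {t : ℝ} (ht : t ∈ Ioo 0 T) :
    ∫⁻ x in Ioo 0 1, ‖primitive f (x, t)‖ₑ ^ 2 ≤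
      ENNReal.ofReal T * ∫⁻ z, ‖f z‖ₑ ^ 2 ∂cylMeasure (Ioo 0 1) T := by
  rw [cylMeasure_eq_prod] at hf ⊢
  rw [lintegral_prod _ (hf.enorm.pow_const 2), ← lintegral_const_mul' _ _ ENNReal.ofReal_ne_top]
  refine lintegral_mono_ae ?_
  filter_upwards [hf.prodMk_left] with x hx
  exact enorm_primitive_sq_le hx ht

theorem lintegral_cyl_swap {T : ℝ} {f : ℝ × ℝ → ℝ≥0∞}
    (hf : AEMeasurable f (cylMeasure (Ioo 0 1) T)) :
    ∫⁻ z, f z ∂cylMeasure (Ioo 0 1) T = ∫⁻ t in Ioo 0 T, ∫⁻ x in Ioo 0 1, f (x, t) := by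
  rw [cylMeasure_eq_prod] at hf ⊢
  exact lintegral_prod_symm _ hf

theorem lintegral_primitive_sq_le' {T : ℝ} {f : ℝ × ℝ → ℝ}
    (hf : AEStronglyMeasurable f (cylMeasure (Ioo 0 1) T)) :
    ∫⁻ z, ‖primitive f z‖ₑ ^ 2 ∂cylMeasure (Ioo 0 1) T ≤
      ENNReal.ofReal T ^ 2 * ∫⁻ z, ‖f z‖ₑ ^ 2 ∂cylMeasure (Ioo 0 1) T := by
  rw [lintegral_cyl_swap ((aestronglyMeasurable_primitive hf).enorm.pow_const 2)]
  calc _ ≤ ∫⁻ t in Ioo 0 T, ENNReal.ofReal T * ∫⁻ z, ‖f z‖ₑ ^ 2 ∂cylMeasure (Ioo 0 1) T := by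
        refine setLIntegral_mono_ae' measurableSet_Ioo (Eventually.of_forall fun t ht => ?_)
        exact lintegral_primitive_sq_le hf ht
    _ = _ := by
        rw [lintegral_const]
        simp only [MeasurableSet.univ, Measure.restrict_apply, univ_inter, Real.volume_Ioo,
          sub_zero]
        ring

theorem eLpNorm_primitive_le {T : ℝ} {f : ℝ × ℝ → ℝ}
    (hf : AEStronglyMeasurable f (cylMeasure (Ioo 0 1) T)) :
    eLpNorm (primitive f) 2 (cylMeasure (Ioo 0 1) T) ≤
      ENNReal.ofReal T * eLpNorm f 2 (cylMeasure (Ioo 0 1) T) := by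
  rw [eLpNorm_two_eq_lintegral, eLpNorm_two_eq_lintegral]
  calc _ ≤ (ENNReal.ofReal T ^ 2 * ∫⁻ z, ‖f z‖ₑ ^ 2 ∂cylMeasure (Ioo 0 1) T) ^ (1 / 2 : ℝ) := by
        gcongr; exact lintegral_primitive_sq_le' hf
    _ = _ := by
        rw [ENNReal.mul_rpow_of_nonneg _ _ (by norm_num), ← ENNReal.rpow_natCast,
          ← ENNReal.rpow_mul]
        norm_num

theorem memLp_primitive {T : ℝ} {f : ℝ × ℝ → ℝ} (hf : MemLp f 2 (cylMeasure (Ioo 0 1) T)) :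
    MemLp (primitive f) 2 (cylMeasure (Ioo 0 1) T) :=
  ⟨aestronglyMeasurable_primitive hf.1, (eLpNorm_primitive_le hf.1).trans_lt
    (ENNReal.mul_lt_top ENNReal.ofReal_lt_top hf.2)⟩

theorem ae_integrableOn_section {T : ℝ} {f : ℝ × ℝ → ℝ}
    (hf : MemLp f 2 (cylMeasure (Ioo 0 1) T)) :
    ∀ᵐ x ∂volume.restrict (Ioo (0 : ℝ) 1), IntegrableOn (fun s => f (x, s)) (Ioo 0 T) := by
  have h1 : Integrable f (cylMeasure (Ioo 0 1) T) := hf.integrable (by norm_num)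
  rw [cylMeasure_eq_prod] at h1
  exact h1.prod_right_ae

theorem primitive_add {T : ℝ} {f g : ℝ × ℝ → ℝ} (hf : MemLp f 2 (cylMeasure (Ioo 0 1) T))
    (hg : MemLp g 2 (cylMeasure (Ioo 0 1) T)) :
    primitive (fun z => f z + g z) =ᵐ[cylMeasure (Ioo 0 1) T]
      fun z => primitive f z + primitive g z := by
  filter_upwards [ae_cyl_of_ae_fst (ae_integrableOn_section hf),
    ae_cyl_of_ae_fst (ae_integrableOn_section hg), ae_mem_cylinder T] with z h1 h2 hz
  have hs : Ioo 0 z.2 ⊆ Ioo 0 T := Ioo_subset_Ioo_right hz.2.2.le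
  exact integral_add (h1.mono_set hs) (h2.mono_set hs)

theorem primitive_const_mul (c : ℝ) (f : ℝ × ℝ → ℝ) :
    primitive (fun z => c * f z) = fun z => c * primitive f z := by
  ext z; exact integral_const_mul _ _

theorem ae_weightedMeasure_eq_iff {T lam : ℝ} (hlam : 0 ≤ lam) {f g : ℝ × ℝ → ℝ} :
    f =ᵐ[weightedMeasure T lam] g ↔ f =ᵐ[cylMeasure (Ioo 0 1) T] g :=
  ae_weightedMeasure_iff hlam

/-- The primitive in time as a bounded operator on the weighted space. -/
def primitiveL (T lam : ℝ) [hlam : Fact (0 ≤ lam)] :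
    Lp ℝ 2 (weightedMeasure T lam) →L[ℝ] Lp ℝ 2 (weightedMeasure T lam) :=
  LinearMap.mkContinuous
    { toFun := fun f => ((memLp_weightedMeasure_iff hlam.out).2
        (memLp_primitive ((memLp_weightedMeasure_iff hlam.out).1 (Lp.memLp f)))).toLp
      map_add' := fun f g => by
        rw [← MemLp.toLp_add]
        refine MemLp.toLp_congr _ _ ?_
        rw [ae_weightedMeasure_eq_iff hlam.out]
        refine (primitive_congr ((ae_weightedMeasure_eq_iff hlam.out).1 (Lp.coeFn_add f g))).trans
          (primitive_add ((memLp_weightedMeasure_iff hlam.out).1 (Lp.memLp f))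
            ((memLp_weightedMeasure_iff hlam.out).1 (Lp.memLp g)))
      map_smul' := fun c f => by
        rw [RingHom.id_apply, ← MemLp.toLp_const_smul]
        refine MemLp.toLp_congr _ _ ?_
        rw [ae_weightedMeasure_eq_iff hlam.out]
        refine (primitive_congr
          ((ae_weightedMeasure_eq_iff hlam.out).1 (Lp.coeFn_smul c f))).trans ?_
        exact Eventually.of_forall fun z => congrFun (primitive_const_mul c f) z }
    (max T 0 * Real.exp (lam * T)) fun f => by
      have h0 := (memLp_weightedMeasure_iff hlam.out).1 (Lp.memLp f)
      have h1 : eLpNorm (primitive f) 2 (weightedMeasure T lam) ≤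
          ENNReal.ofReal T * (ENNReal.ofReal (Real.exp (lam * T)) *
            eLpNorm f 2 (weightedMeasure T lam)) :=
        (eLpNorm_weightedMeasure_le hlam.out _ _).trans ((eLpNorm_primitive_le h0.1).trans
          (by gcongr; exact eLpNorm_two_cylMeasure_le hlam.out _))
      have h2 := ENNReal.toReal_mono (by finiteness [(Lp.memLp f).2]) h1
      rw [LinearMap.coe_mk, AddHom.coe_mk, Lp.norm_toLp, Lp.norm_def]
      refine h2.trans_eq ?_
      rw [ENNReal.toReal_mul, ENNReal.toReal_mul, ENNReal.toReal_ofReal (Real.exp_pos _).le,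
        ENNReal.toReal_ofReal', mul_assoc]

theorem coeFn_primitiveL {T lam : ℝ} [hlam : Fact (0 ≤ lam)]
    (f : Lp ℝ 2 (weightedMeasure T lam)) :
    primitiveL T lam f =ᵐ[weightedMeasure T lam] primitive f :=
  MemLp.coeFn_toLp ((memLp_weightedMeasure_iff hlam.out).2
        (memLp_primitive ((memLp_weightedMeasure_iff hlam.out).1 (Lp.memLp f))))

theorem integral_integral_Ioo_mul {T : ℝ} {f θ : ℝ → ℝ} (hf : IntegrableOn f (Ioo 0 T))
    (hθ : IntegrableOn θ (Ioo 0 T)) :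
    ∫ t in Ioo 0 T, (∫ s in Ioo 0 t, f s) * θ t =
      ∫ s in Ioo 0 T, f s * ∫ t in Ioo s T, θ t := by
  have hi : Integrable (Function.uncurry fun t s => (Iio t).indicator f s * θ t)
      ((volume.restrict (Ioo 0 T)).prod (volume.restrict (Ioo 0 T))) := by
    have h1 : Integrable (fun z : ℝ × ℝ => θ z.1 * f z.2)
        ((volume.restrict (Ioo 0 T)).prod (volume.restrict (Ioo 0 T))) := hθ.mul_prod hf
    have h2 := h1.indicator (s := {z : ℝ × ℝ | z.2 < z.1})
      (measurableSet_lt measurable_snd measurable_fst)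
    refine h2.congr (Eventually.of_forall fun z => ?_)
    simp only [Function.uncurry, indicator, mem_ofPred_eq, mem_Iio]
    split_ifs <;> ring
  have h3 := integral_integral_swap hi
  calc _ = ∫ t in Ioo 0 T, ∫ s in Ioo 0 T, (Iio t).indicator f s * θ t := by
        refine setIntegral_congr_fun measurableSet_Ioo fun t ht => ?_
        rw [integral_mul_const, setIntegral_indicator measurableSet_Iio, Ioo_inter_Iio,
          min_eq_right ht.2.le]
    _ = _ := h3
    _ = _ := by
        refine setIntegral_congr_fun measurableSet_Ioo fun s hs => ?_
        rw [← integral_const_mul, ← integral_indicator measurableSet_Ioo,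
          ← integral_indicator measurableSet_Ioo]
        congr 1
        ext t
        simp only [indicator, mem_Iio, mem_Ioo]
        by_cases h1 : s < t <;> by_cases h2 : t < T <;> simp [h1, h2]
        intro h3; linarith [hs.1]

/-- Fubini's theorem on time triangles. -/
theorem integral_primitive_mul {T : ℝ} {f θ : ℝ × ℝ → ℝ}
    (hf : MemLp f 2 (cylMeasure (Ioo 0 1) T)) (hθ : MemLp θ 2 (cylMeasure (Ioo 0 1) T))
    (hΘ : MemLp (fun z => ∫ s in Ioo z.2 T, θ (z.1, s)) 2 (cylMeasure (Ioo 0 1) T)) :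
    ∫ z, primitive f z * θ z ∂cylMeasure (Ioo 0 1) T =
      ∫ z, f z * (∫ s in Ioo z.2 T, θ (z.1, s)) ∂cylMeasure (Ioo 0 1) T := by
  have h1 : Integrable (fun z => primitive f z * θ z) (cylMeasure (Ioo 0 1) T) :=
    (memLp_primitive hf).integrable_mul hθ
  have h2 : Integrable (fun z => f z * ∫ s in Ioo z.2 T, θ (z.1, s)) (cylMeasure (Ioo 0 1) T) :=
    hf.integrable_mul hΘ
  have h3 := ae_integrableOn_section hf
  have h4 := ae_integrableOn_section hθ
  rw [cylMeasure_eq_prod] at h1 h2 ⊢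
  rw [integral_prod _ h1, integral_prod _ h2]
  refine integral_congr_ae ?_
  filter_upwards [h3, h4] with x hx hx'
  exact integral_integral_Ioo_mul hx hx'

/-- With `U` the primitive of `f`, the integrand is the derivative of `½ e^{-2λt} U²`. This vanishes
at `0` and is nonnegative at `T`. -/
theorem weighted_primitive_nonneg {T lam : ℝ} (hT : 0 ≤ T) {f : ℝ → ℝ} (hf : Continuous f) :
    0 ≤ ∫ t in Ioo 0 T, Real.exp (-(2 * lam * t)) * ((∫ s in Ioo 0 t, f s) * f t -
      lam * (∫ s in Ioo 0 t, f s) ^ 2) := by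
  set U : ℝ → ℝ := fun t => ∫ s in (0 : ℝ)..t, f s with hU
  have hUd : ∀ t, HasDerivAt U (f t) t := fun t =>
    intervalIntegral.integral_hasDerivAt_right (hf.intervalIntegrable _ _)
      hf.stronglyMeasurable.stronglyMeasurableAtFilter hf.continuousAt
  have hUc : Continuous U := continuous_iff_continuousAt.2 fun t => (hUd t).continuousAt
  have hd : ∀ t, HasDerivAt (fun t => 1 / 2 * (Real.exp (-(2 * lam * t)) * U t ^ 2))
      (Real.exp (-(2 * lam * t)) * (U t * f t - lam * U t ^ 2)) t := by
    intro t
    have h1 : HasDerivAt (fun t : ℝ => -(2 * lam * t)) (-(2 * lam)) t := by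
      simpa [neg_mul] using (hasDerivAt_id t).const_mul (-(2 * lam))
    have h2 := ((h1.exp.mul ((hUd t).pow 2)).const_mul (1 / 2 : ℝ))
    refine h2.congr_deriv ?_
    simp only [Pi.pow_apply]
    push_cast
    ring
  have h3 : ∫ t in Ioo 0 T, Real.exp (-(2 * lam * t)) * ((∫ s in Ioo 0 t, f s) * f t -
      lam * (∫ s in Ioo 0 t, f s) ^ 2) =
      ∫ t in (0 : ℝ)..T, Real.exp (-(2 * lam * t)) * (U t * f t - lam * U t ^ 2) := by
    rw [intervalIntegral.integral_of_le hT, integral_Ioc_eq_integral_Ioo]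
    refine setIntegral_congr_fun measurableSet_Ioo fun t ht => ?_
    simp only [hU]
    rw [intervalIntegral.integral_of_le ht.1.le, integral_Ioc_eq_integral_Ioo]
  rw [h3, intervalIntegral.integral_eq_sub_of_hasDerivAt (fun t _ => hd t)
    (by apply Continuous.intervalIntegrable; fun_prop)]
  simp only [hU, intervalIntegral.integral_same]
  have : 0 ≤ Real.exp (-(2 * lam * T)) * (∫ s in (0 : ℝ)..T, f s) ^ 2 := by positivity
  linarith

/-- Both sides are continuous in `f`, so smooth compactly supported `f` suffice; for those,
`weighted_primitive_nonneg` is integrated over `x`. Together with Cauchy–Schwarz it yields `λ ‖I f‖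
≤ ‖f‖`, the source of all smallness for large `λ`. -/
theorem primitiveL_accretive {T lam : ℝ} (hT : 0 ≤ T) [hlam : Fact (0 ≤ lam)]
    (f : Lp ℝ 2 (weightedMeasure T lam)) :
    lam * ‖primitiveL T lam f‖ ^ 2 ≤ ⟪primitiveL T lam f, f⟫_ℝ := by
  have hclosed : IsClosed {f : Lp ℝ 2 (weightedMeasure T lam) |
      lam * ‖primitiveL T lam f‖ ^ 2 ≤ ⟪primitiveL T lam f, f⟫_ℝ} :=
    isClosed_le (by fun_prop) (by fun_prop)
  have hdense := Lp.dense_hasCompactSupport_contDiff (E := ℝ × ℝ) (F := ℝ)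
    (μ := weightedMeasure T lam) (p := 2) (by norm_num)
  refine hclosed.closure_subset_iff.2 ?_ (hdense f)
  rintro f ⟨g, hfg, hgs, hgc⟩
  have hg : MemLp g 2 (weightedMeasure T lam) := (Lp.memLp f).ae_eq hfg
  have hg' := (memLp_weightedMeasure_iff hlam.out).1 hg
  have hp : primitiveL T lam f =ᵐ[cylMeasure (Ioo 0 1) T] primitive g :=
    ((ae_weightedMeasure_eq_iff hlam.out).1 (coeFn_primitiveL f)).trans
      (primitive_congr ((ae_weightedMeasure_eq_iff hlam.out).1 hfg))
  have hpg := memLp_primitive hg'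
  have hfg' := (ae_weightedMeasure_eq_iff hlam.out).1 hfg
  have hexp : ∀ᵐ z ∂cylMeasure (Ioo 0 1) T, ‖Real.exp (-(2 * lam * z.2))‖ ≤ 1 := by
    filter_upwards [ae_mem_cylinder T] with z hz
    rw [Real.norm_of_nonneg (Real.exp_pos _).le]
    refine Real.exp_le_one_iff.2 ?_
    have := hz.2.1
    have := hlam.out
    simp only [Left.neg_nonpos_iff]
    positivity
  have hexpm : AEStronglyMeasurable (fun z : ℝ × ℝ => Real.exp (-(2 * lam * z.2)))
      (cylMeasure (Ioo 0 1) T) := by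
    apply Continuous.aestronglyMeasurable; fun_prop
  have i1 : Integrable (fun z => Real.exp (-(2 * lam * z.2)) * (primitive g z * g z))
      (cylMeasure (Ioo 0 1) T) := (hpg.integrable_mul hg').bdd_mul hexpm hexp
  have i2 : Integrable (fun z => Real.exp (-(2 * lam * z.2)) * (primitive g z * primitive g z))
      (cylMeasure (Ioo 0 1) T) := (hpg.integrable_mul hpg).bdd_mul hexpm hexp
  have i3 := i1.sub (i2.const_mul lam)
  have e1 : ⟪primitiveL T lam f, f⟫_ℝ =
      ∫ z, Real.exp (-(2 * lam * z.2)) * (primitive g z * g z) ∂cylMeasure (Ioo 0 1) T := by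
    rw [inner_toLp_weightedMeasure]
    refine integral_congr_ae ?_
    filter_upwards [hp, hfg'] with z h1 h2
    rw [h1, h2]
  have e2 : ‖primitiveL T lam f‖ ^ 2 = ∫ z, Real.exp (-(2 * lam * z.2)) *
      (primitive g z * primitive g z) ∂cylMeasure (Ioo 0 1) T := by
    rw [← real_inner_self_eq_norm_sq, inner_toLp_weightedMeasure]
    refine integral_congr_ae ?_
    filter_upwards [hp] with z h1
    rw [h1]
  rw [mem_ofPred_eq, e1, e2, ← sub_nonneg, ← integral_const_mul, ← integral_sub i1
    (i2.const_mul lam)]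
  rw [cylMeasure_eq_prod] at i3 ⊢
  have e3 := integral_prod _ i3
  simp only [Pi.sub_apply] at e3
  rw [e3]
  refine integral_nonneg fun x => ?_
  have := weighted_primitive_nonneg (lam := lam) hT (f := fun s => g (x, s))
    (hgc.continuous.comp (by fun_prop))
  refine this.trans_eq (integral_congr_ae (Eventually.of_forall fun t => ?_))
  simp only [primitive]
  ring

end Volterra

/-! ### Smooth test functions, their time primitives and time cutoffs. -/

section SmoothFunctions

/-- Smooth functions on the plane whose support projects to a compact subset of `(0,1)`. -/
def IsLateral (φ : ℝ × ℝ → ℝ) : Prop :=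
  ContDiff ℝ ∞ φ ∧ ∃ K : Set ℝ, IsCompact K ∧ K ⊆ Ioo 0 1 ∧ ∀ z : ℝ × ℝ, z.1 ∉ K → φ z = 0

theorem contDiff_dx {φ : ℝ × ℝ → ℝ} (hφ : ContDiff ℝ ∞ φ) : ContDiff ℝ ∞ (dx φ) :=
  (hφ.fderiv_right (m := ∞) (by simp)).clm_apply contDiff_const

theorem contDiff_dt {φ : ℝ × ℝ → ℝ} (hφ : ContDiff ℝ ∞ φ) : ContDiff ℝ ∞ (dt φ) :=
  (hφ.fderiv_right (m := ∞) (by simp)).clm_apply contDiff_const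

theorem hasDerivAt_dx {φ : ℝ × ℝ → ℝ} {x t : ℝ} (hφ : DifferentiableAt ℝ φ (x, t)) :
    HasDerivAt (fun x => φ (x, t)) (dx φ (x, t)) x := by
  have h1 : HasDerivAt (fun x : ℝ => (x, t)) ((1 : ℝ), (0 : ℝ)) x :=
    (hasDerivAt_id x).prodMk (hasDerivAt_const x t)
  exact hφ.hasFDerivAt.comp_hasDerivAt x h1

theorem hasDerivAt_dt {φ : ℝ × ℝ → ℝ} {x t : ℝ} (hφ : DifferentiableAt ℝ φ (x, t)) :
    HasDerivAt (fun t => φ (x, t)) (dt φ (x, t)) t := by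
  have h1 : HasDerivAt (fun t : ℝ => (x, t)) ((0 : ℝ), (1 : ℝ)) t :=
    (hasDerivAt_const t x).prodMk (hasDerivAt_id t)
  exact hφ.hasFDerivAt.comp_hasDerivAt t h1

theorem dx_eq_zero {φ : ℝ × ℝ → ℝ} {K : Set ℝ} (hK : IsClosed K)
    (h : ∀ z : ℝ × ℝ, z.1 ∉ K → φ z = 0) {z : ℝ × ℝ} (hz : z.1 ∉ K) : fderiv ℝ φ z = 0 := by
  have h1 : φ =ᶠ[𝓝 z] fun _ => 0 := by
    have : {w : ℝ × ℝ | w.1 ∉ K} ∈ 𝓝 z :=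
      (hK.isOpen_compl.preimage continuous_fst).mem_nhds hz
    filter_upwards [this] with w hw using h w hw
  rw [h1.fderiv_eq]; simp

theorem dx_time_mul {θ : ℝ → ℝ} (hθ : Differentiable ℝ θ) {φ : ℝ × ℝ → ℝ}
    (hφ : Differentiable ℝ φ) (z : ℝ × ℝ) :
    dx (fun z => θ z.2 * φ z) z = θ z.2 * dx φ z := by
  have hd : DifferentiableAt ℝ (fun z : ℝ × ℝ => θ z.2 * φ z) z :=
    ((hθ z.2).comp z differentiableAt_snd).mul (hφ z)
  have h1 := hasDerivAt_dx (x := z.1) (t := z.2) hd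
  have h2 := (hasDerivAt_dx (x := z.1) (t := z.2) (hφ z)).const_mul (θ z.2)
  exact h1.unique h2

theorem dt_time_mul {θ : ℝ → ℝ} (hθ : Differentiable ℝ θ) {φ : ℝ × ℝ → ℝ}
    (hφ : Differentiable ℝ φ) (z : ℝ × ℝ) :
    dt (fun z => θ z.2 * φ z) z = deriv θ z.2 * φ z + θ z.2 * dt φ z := by
  have hd : DifferentiableAt ℝ (fun z : ℝ × ℝ => θ z.2 * φ z) z :=
    ((hθ z.2).comp z differentiableAt_snd).mul (hφ z)
  have h1 := hasDerivAt_dt (x := z.1) (t := z.2) hd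
  have h2 := (hθ z.2).hasDerivAt.mul (hasDerivAt_dt (x := z.1) (t := z.2) (hφ z))
  exact h1.unique h2

theorem dx_dt_comm {φ : ℝ × ℝ → ℝ} (hφ : ContDiff ℝ ∞ φ) (z : ℝ × ℝ) :
    dx (dt φ) z = dt (dx φ) z := by
  have hd : DifferentiableAt ℝ (fderiv ℝ φ) z :=
    (hφ.fderiv_right (m := ∞) (by simp)).differentiable (by simp) z
  have h1 : ∀ v w : ℝ × ℝ, fderiv ℝ (fun z => fderiv ℝ φ z v) z w =
      fderiv ℝ (fderiv ℝ φ) z w v := fun v w => by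
    rw [fderiv_clm_apply hd (differentiableAt_const v)]
    simp
  have h2 : IsSymmSndFDerivAt ℝ φ z :=
    (contDiff_infty.1 hφ 2).contDiffAt.isSymmSndFDerivAt (by simp)
  change fderiv ℝ (fun z => fderiv ℝ φ z (0, 1)) z (1, 0) =
    fderiv ℝ (fun z => fderiv ℝ φ z (1, 0)) z (0, 1)
  rw [h1, h1]
  exact h2 _ _

/-- The smooth primitive in time. -/
def timePrimitive (φ : ℝ × ℝ → ℝ) (z : ℝ × ℝ) : ℝ := ∫ s in (0 : ℝ)..z.2, φ (z.1, s)

theorem timePrimitive_eq_primitive (φ : ℝ × ℝ → ℝ) {z : ℝ × ℝ} (hz : 0 ≤ z.2) :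
    timePrimitive φ z = primitive φ z := by
  rw [timePrimitive, primitive, intervalIntegral.integral_of_le hz, integral_Ioc_eq_integral_Ioo]

theorem continuous_timePrimitive {φ : ℝ × ℝ → ℝ} (hφ : Continuous φ) :
    Continuous (timePrimitive φ) :=
  intervalIntegral.continuous_parametric_intervalIntegral_of_continuous
    (f := fun (z : ℝ × ℝ) s => φ (z.1, s)) (by unfold Function.uncurry; fun_prop) continuous_snd

theorem hasDerivAt_timePrimitive_fst {φ : ℝ × ℝ → ℝ} (hφ : ContDiff ℝ ∞ φ) (x t : ℝ) :
    HasDerivAt (fun x => timePrimitive φ (x, t)) (timePrimitive (dx φ) (x, t)) x := by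
  have hc := (contDiff_dx hφ).continuous
  obtain ⟨C, hC⟩ := ((isCompact_closedBall x 1).prod (isCompact_uIcc (a := (0 : ℝ)) (b := t))
    ).exists_bound_of_continuousOn hc.continuousOn
  refine (intervalIntegral.hasDerivAt_integral_of_dominated_loc_of_deriv_le
    (F := fun x s => φ (x, s)) (F' := fun x s => dx φ (x, s)) (bound := fun _ => C)
    (Metric.closedBall_mem_nhds x one_pos) (Eventually.of_forall fun y => ?_) ?_ ?_ ?_ ?_ ?_).2
  · exact (hφ.continuous.comp (by fun_prop : Continuous fun s : ℝ => (y, s))).aestronglyMeasurable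
  · exact (hφ.continuous.comp
      (by fun_prop : Continuous fun s : ℝ => (x, s))).intervalIntegrable _ _
  · exact (hc.comp (by fun_prop : Continuous fun s : ℝ => (x, s))).aestronglyMeasurable
  · exact Eventually.of_forall fun s hs y hy => hC (y, s) ⟨hy, uIoc_subset_uIcc hs⟩
  · exact intervalIntegrable_const
  · exact Eventually.of_forall fun s _ y _ => hasDerivAt_dx (hφ.differentiable (by simp) _)

theorem hasDerivAt_timePrimitive_snd {φ : ℝ × ℝ → ℝ} (hφ : Continuous φ) (x t : ℝ) :
    HasDerivAt (fun t => timePrimitive φ (x, t)) (φ (x, t)) t := by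
  have h : Continuous fun s : ℝ => φ (x, s) := hφ.comp (by fun_prop)
  exact intervalIntegral.integral_hasDerivAt_right (h.intervalIntegrable _ _)
    h.stronglyMeasurable.stronglyMeasurableAtFilter h.continuousAt

/-- Both partial derivatives exist and are continuous, which implies differentiability. -/
theorem hasFDerivAt_timePrimitive {φ : ℝ × ℝ → ℝ} (hφ : ContDiff ℝ ∞ φ) (z : ℝ × ℝ) :
    HasFDerivAt (timePrimitive φ) (timePrimitive (dx φ) z • ContinuousLinearMap.fst ℝ ℝ ℝ +
      φ z • ContinuousLinearMap.snd ℝ ℝ ℝ) z := by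
  have h := hasStrictFDerivAt_uncurry_coprod (𝕜 := ℝ) (u := z)
    (f := fun x t => timePrimitive φ (x, t))
    (f₁ := fun x t => timePrimitive (dx φ) (x, t) • ContinuousLinearMap.id ℝ ℝ)
    (f₂ := fun x t => φ (x, t) • ContinuousLinearMap.id ℝ ℝ)
    (Eventually.of_forall fun v => ?_) (Eventually.of_forall fun v => ?_) ?_ ?_
  · refine h.hasFDerivAt.congr_fderiv ?_
    ext <;> simp [Function.HasUncurry.uncurry]
  · have := (hasDerivAt_timePrimitive_fst hφ v.1 v.2).hasFDerivAt
    refine this.congr_fderiv ?_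
    ext; simp [Function.HasUncurry.uncurry]
  · have := (hasDerivAt_timePrimitive_snd hφ.continuous v.1 v.2).hasFDerivAt
    refine this.congr_fderiv ?_
    ext; simp [Function.HasUncurry.uncurry]
  · exact ((continuous_timePrimitive (contDiff_dx hφ).continuous).smul
      continuous_const).continuousAt
  · exact (hφ.continuous.smul continuous_const).continuousAt

/-- Induction on the order of smoothness, for all `φ` at once: the `x`-derivative of the primitive
is again a primitive, and its `t`-derivative is `φ`. -/
theorem contDiff_timePrimitive {φ : ℝ × ℝ → ℝ} (hφ : ContDiff ℝ ∞ φ) :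
    ContDiff ℝ ∞ (timePrimitive φ) := by
  rw [contDiff_infty]
  intro n
  induction n generalizing φ with
  | zero =>
    rw [Nat.cast_zero, contDiff_zero]
    exact continuous_timePrimitive hφ.continuous
  | succ n ih =>
    rw [Nat.cast_add, Nat.cast_one, contDiff_succ_iff_fderiv]
    refine ⟨fun z => (hasFDerivAt_timePrimitive hφ z).differentiableAt, by simp, ?_⟩
    have : fderiv ℝ (timePrimitive φ) = fun z =>
        timePrimitive (dx φ) z • ContinuousLinearMap.fst ℝ ℝ ℝ +
          φ z • ContinuousLinearMap.snd ℝ ℝ ℝ :=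
      funext fun z => (hasFDerivAt_timePrimitive hφ z).fderiv
    rw [this]
    exact ((ih (contDiff_dx hφ)).smul contDiff_const).add
      ((hφ.of_le (by exact_mod_cast le_top)).smul contDiff_const)

theorem dx_timePrimitive {φ : ℝ × ℝ → ℝ} (hφ : ContDiff ℝ ∞ φ) :
    dx (timePrimitive φ) = timePrimitive (dx φ) := by
  ext z
  rw [dx, (hasFDerivAt_timePrimitive hφ z).fderiv]
  simp

theorem dt_timePrimitive {φ : ℝ × ℝ → ℝ} (hφ : ContDiff ℝ ∞ φ) :
    dt (timePrimitive φ) = φ := by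
  ext z
  rw [dt, (hasFDerivAt_timePrimitive hφ z).fderiv]
  simp

namespace IsLateral

variable {φ ψ : ℝ × ℝ → ℝ}

theorem continuous (h : IsLateral φ) : Continuous φ := h.1.continuous

theorem differentiable (h : IsLateral φ) : Differentiable ℝ φ := h.1.differentiable (by simp)

theorem dx (h : IsLateral φ) : IsLateral (dx φ) := by
  obtain ⟨hc, K, hK, hK1, hK0⟩ := h
  refine ⟨contDiff_dx hc, K, hK, hK1, fun z hz => ?_⟩
  rw [StackelbergNash.dx, dx_eq_zero hK.isClosed hK0 hz]; simp

theorem dt (h : IsLateral φ) : IsLateral (dt φ) := by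
  obtain ⟨hc, K, hK, hK1, hK0⟩ := h
  refine ⟨contDiff_dt hc, K, hK, hK1, fun z hz => ?_⟩
  rw [StackelbergNash.dt, dx_eq_zero hK.isClosed hK0 hz]; simp

theorem time_mul (h : IsLateral φ) {θ : ℝ → ℝ} (hθ : ContDiff ℝ ∞ θ) :
    IsLateral fun z => θ z.2 * φ z := by
  obtain ⟨hc, K, hK, hK1, hK0⟩ := h
  exact ⟨(hθ.comp contDiff_snd).mul hc, K, hK, hK1, fun z hz => by simp [hK0 z hz]⟩

theorem timePrimitive (h : IsLateral φ) : IsLateral (timePrimitive φ) := by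
  obtain ⟨hc, K, hK, hK1, hK0⟩ := h
  refine ⟨contDiff_timePrimitive hc, K, hK, hK1, fun z hz => ?_⟩
  rw [StackelbergNash.timePrimitive]
  have : ∀ s : ℝ, φ (z.1, s) = 0 := fun s => hK0 _ hz
  simp [this]

theorem comp_const_time (h : IsLateral φ) (T : ℝ) : IsLateral fun z => φ (z.1, T) := by
  obtain ⟨hc, K, hK, hK1, hK0⟩ := h
  exact ⟨hc.comp (by fun_prop), K, hK, hK1, fun z hz => hK0 _ hz⟩

theorem sub (h : IsLateral φ) (h' : IsLateral ψ) : IsLateral fun z => φ z - ψ z := by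
  obtain ⟨hc, K, hK, hK1, hK0⟩ := h
  obtain ⟨hc', K', hK', hK1', hK0'⟩ := h'
  refine ⟨hc.sub hc', K ∪ K', hK.union hK', union_subset hK1 hK1', fun z hz => ?_⟩
  rw [mem_union, not_or] at hz
  simp [hK0 z hz.1, hK0' z hz.2]

theorem of_tsupport_subset {J : Set ℝ} (hφ : ContDiff ℝ ∞ φ) (hs : HasCompactSupport φ)
    (h : tsupport φ ⊆ Ioo 0 1 ×ˢ J) : IsLateral φ := by
  refine ⟨hφ, Prod.fst '' tsupport φ, hs.isCompact.image continuous_fst, ?_, fun z hz => ?_⟩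
  · rintro _ ⟨z, hz, rfl⟩
    exact (h hz).1
  · by_contra h0
    exact hz ⟨z, subset_tsupport φ h0, rfl⟩

theorem exists_bound (h : IsLateral φ) (T : ℝ) : ∃ C, ∀ z ∈ cylinder T, ‖φ z‖ ≤ C := by
  obtain ⟨C, hC⟩ := ((isCompact_Icc (a := (0 : ℝ)) (b := 1)).prod
    (isCompact_Icc (a := (0 : ℝ)) (b := T))).exists_bound_of_continuousOn h.continuous.continuousOn
  exact ⟨C, fun z hz => hC z ⟨Ioo_subset_Icc_self hz.1, Ioo_subset_Icc_self hz.2⟩⟩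

theorem memLp (h : IsLateral φ) (T : ℝ) : MemLp φ 2 (cylMeasure (Ioo 0 1) T) := by
  obtain ⟨C, hC⟩ := h.exists_bound T
  refine MemLp.of_bound h.continuous.aestronglyMeasurable C ?_
  filter_upwards [ae_mem_cylinder T] with z hz using hC z hz

end IsLateral

/-- A time cutoff that vanishes near `0` and `T`. -/
def timeCutoff (T : ℝ) (n : ℕ) (t : ℝ) : ℝ :=
  Real.smoothTransition (n * t - 1) * Real.smoothTransition (n * (T - t) - 1)

theorem contDiff_timeCutoff (T : ℝ) (n : ℕ) : ContDiff ℝ ∞ (timeCutoff T n) := by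
  have h : ContDiff ℝ ∞ Real.smoothTransition := Real.smoothTransition.contDiff
  exact (h.comp (by fun_prop : ContDiff ℝ ∞ fun t : ℝ => n * t - 1)).mul
    (h.comp (by fun_prop : ContDiff ℝ ∞ fun t : ℝ => n * (T - t) - 1))

theorem abs_timeCutoff_le (T : ℝ) (n : ℕ) (t : ℝ) : |timeCutoff T n t| ≤ 1 := by
  rw [timeCutoff, abs_mul, abs_of_nonneg (Real.smoothTransition.nonneg _),
    abs_of_nonneg (Real.smoothTransition.nonneg _)]
  exact mul_le_one₀ (Real.smoothTransition.le_one _) (Real.smoothTransition.nonneg _)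
    (Real.smoothTransition.le_one _)

theorem timeCutoff_tendsto {T t : ℝ} (ht : t ∈ Ioo 0 T) :
    Tendsto (fun n => timeCutoff T n t) atTop (𝓝 1) := by
  have h : ∀ s : ℝ, 0 < s → ∀ᶠ n : ℕ in atTop, Real.smoothTransition (n * s - 1) = 1 := by
    intro s hs
    have : Tendsto (fun n : ℕ => (n : ℝ) * s) atTop atTop :=
      tendsto_natCast_atTop_atTop.atTop_mul_const hs
    filter_upwards [this.eventually_ge_atTop 2] with n hn
    exact Real.smoothTransition.one_of_one_le (by linarith)
  refine tendsto_const_nhds.congr' ?_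
  filter_upwards [h t ht.1, h (T - t) (sub_pos.2 ht.2)] with n h1 h2
  rw [timeCutoff, h1, h2, one_mul]

/-- The cutoff vanishes unless `1/(n+1) ≤ t ≤ T - 1/(n+1)`. The shift from `n` to `n + 1` avoids
division by zero. -/
theorem IsLateral.cutoff {φ : ℝ × ℝ → ℝ} (h : IsLateral φ) (T : ℝ) (n : ℕ) :
    HasCompactSupport (fun z : ℝ × ℝ => timeCutoff T (n + 1) z.2 * φ z) ∧
      tsupport (fun z : ℝ × ℝ => timeCutoff T (n + 1) z.2 * φ z) ⊆ cylinder T := by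
  obtain ⟨hc, K, hK, hK1, hK0⟩ := h
  set J : Set ℝ := Icc (1 / ((n : ℝ) + 1)) (T - 1 / ((n : ℝ) + 1)) with hJ
  have hn : (0 : ℝ) < (n : ℝ) + 1 := by positivity
  have hz : ∀ z : ℝ × ℝ, z ∉ K ×ˢ J → timeCutoff T (n + 1) z.2 * φ z = 0 := by
    intro z hz
    by_cases h1 : z.1 ∈ K
    · have h2 : z.2 ∉ J := fun h2 => hz ⟨h1, h2⟩
      rw [hJ, mem_Icc, not_and_or, not_le, not_le] at h2
      have : timeCutoff T (n + 1) z.2 = 0 := by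
        rw [timeCutoff]
        push_cast
        rcases h2 with h2 | h2
        · rw [lt_div_iff₀ hn] at h2
          rw [Real.smoothTransition.zero_of_nonpos (by linarith), zero_mul]
        · have h3 : T - z.2 < 1 / ((n : ℝ) + 1) := by linarith
          rw [lt_div_iff₀ hn] at h3
          rw [Real.smoothTransition.zero_of_nonpos (x := ((n : ℝ) + 1) * (T - z.2) - 1)
            (by linarith), mul_zero]
      rw [this, zero_mul]
    · rw [hK0 z h1, mul_zero]
  have hcomp : IsCompact (K ×ˢ J) := hK.prod isCompact_Icc
  refine ⟨HasCompactSupport.intro hcomp fun z h => hz z h, ?_⟩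
  have h1 : tsupport (fun z : ℝ × ℝ => timeCutoff T (n + 1) z.2 * φ z) ⊆ K ×ˢ J :=
    closure_minimal (fun z hz' => by_contra fun h => hz' (hz z h)) hcomp.isClosed
  refine h1.trans (prod_mono hK1 fun t ht => ?_)
  have : 0 < 1 / ((n : ℝ) + 1) := by positivity
  exact ⟨by linarith [ht.1], by linarith [ht.2]⟩

end SmoothFunctions

/-! ### The energy space and the time operators acting on it. -/

section EnergySpace

open scoped ENNReal InnerProductSpace
open ContinuousLinearMap (adjoint)

/-- The weighted space `L²(Q, e^{-2λt} dx dt)`. -/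
abbrev L2Q (T lam : ℝ) := Lp ℝ 2 (weightedMeasure T lam)

/-- Pairs of functions in `L²(Q)`: a function and its weighted spatial derivative. -/
abbrev L2Pair (T lam : ℝ) := WithLp 2 (L2Q T lam × L2Q T lam)

/-- The pairs `(φ, √a φ_x)` with `φ ∈ C_c^∞(Q)`. -/
def testSpace (a : ℝ → ℝ) (T lam : ℝ) : Submodule ℝ (L2Pair T lam) where
  carrier := {p | ∃ φ : ℝ × ℝ → ℝ, ContDiff ℝ ∞ φ ∧ HasCompactSupport φ ∧
    tsupport φ ⊆ cylinder T ∧ p.fst =ᵐ[weightedMeasure T lam] φ ∧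
    p.snd =ᵐ[weightedMeasure T lam] fun z => √(a z.1) * dx φ z}
  zero_mem' := by
    refine ⟨fun _ => 0, contDiff_const, HasCompactSupport.zero, by simp [tsupport], ?_, ?_⟩
    · exact Lp.coeFn_zero _ _ _
    · refine (Lp.coeFn_zero _ _ _).trans (Eventually.of_forall fun z => ?_)
      simp [dx]
  add_mem' := by
    rintro p q ⟨φ, h1, h2, h3, h4, h5⟩ ⟨ψ, k1, k2, k3, k4, k5⟩
    refine ⟨fun z => φ z + ψ z, h1.add k1, h2.add k2,
      (tsupport_add φ ψ).trans (union_subset h3 k3), ?_, ?_⟩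
    · filter_upwards [Lp.coeFn_add p.fst q.fst, h4, k4] with z e1 e2 e3
      rw [WithLp.add_fst, e1, Pi.add_apply, e2, e3]
    · filter_upwards [Lp.coeFn_add p.snd q.snd, h5, k5] with z e1 e2 e3
      rw [WithLp.add_snd, e1, Pi.add_apply, e2, e3, dx, dx, dx,
        fderiv_fun_add (h1.differentiable (by simp) z) (k1.differentiable (by simp) z)]
      simp [mul_add]
  smul_mem' := by
    rintro c p ⟨φ, h1, h2, h3, h4, h5⟩
    refine ⟨fun z => c * φ z, contDiff_const.mul h1, h2.mul_left,
      (tsupport_mul_subset_right).trans h3, ?_, ?_⟩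
    · filter_upwards [Lp.coeFn_smul c p.fst, h4] with z e1 e2
      rw [WithLp.smul_fst, e1, Pi.smul_apply, e2, smul_eq_mul]
    · filter_upwards [Lp.coeFn_smul c p.snd, h5] with z e1 e2
      rw [WithLp.smul_snd, e1, Pi.smul_apply, e2, dx, dx,
        fderiv_const_mul (h1.differentiable (by simp) z)]
      simp [mul_left_comm]

/-- The energy space: the closure of the test functions. -/
def energySpace (a : ℝ → ℝ) (T lam : ℝ) : Submodule ℝ (L2Pair T lam) :=
  (testSpace a T lam).topologicalClosure

theorem isClosed_energySpace (a : ℝ → ℝ) (T lam : ℝ) :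
    IsClosed (energySpace a T lam : Set (L2Pair T lam)) :=
  Submodule.isClosed_topologicalClosure _

instance (a : ℝ → ℝ) (T lam : ℝ) : CompleteSpace (energySpace a T lam) :=
  (isClosed_energySpace a T lam).completeSpace_coe

/-- The function component. -/
def toFn (a : ℝ → ℝ) (T lam : ℝ) : energySpace a T lam →L[ℝ] L2Q T lam :=
  WithLp.fstL 2 ℝ (L2Q T lam) (L2Q T lam) ∘L (energySpace a T lam).subtypeL

/-- The weighted derivative component. -/
def toGrad (a : ℝ → ℝ) (T lam : ℝ) : energySpace a T lam →L[ℝ] L2Q T lam :=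
  WithLp.sndL 2 ℝ (L2Q T lam) (L2Q T lam) ∘L (energySpace a T lam).subtypeL

variable {a : ℝ → ℝ} {T lam : ℝ}

theorem energySpace_inner (U W : energySpace a T lam) :
    ⟪U, W⟫_ℝ = ⟪toFn a T lam U, toFn a T lam W⟫_ℝ + ⟪toGrad a T lam U, toGrad a T lam W⟫_ℝ := by
  rw [Submodule.coe_inner, WithLp.prod_inner_apply]
  rfl

theorem energySpace_norm_sq (U : energySpace a T lam) :
    ‖U‖ ^ 2 = ‖toFn a T lam U‖ ^ 2 + ‖toGrad a T lam U‖ ^ 2 := by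
  rw [← real_inner_self_eq_norm_sq, energySpace_inner, real_inner_self_eq_norm_sq,
    real_inner_self_eq_norm_sq]

theorem norm_toFn_le (U : energySpace a T lam) : ‖toFn a T lam U‖ ≤ ‖U‖ :=
  le_of_sq_le_sq (by rw [energySpace_norm_sq U]; nlinarith [sq_nonneg ‖toGrad a T lam U‖])
    (norm_nonneg _)

theorem norm_toGrad_le (U : energySpace a T lam) : ‖toGrad a T lam U‖ ≤ ‖U‖ :=
  le_of_sq_le_sq (by rw [energySpace_norm_sq U]; nlinarith [sq_nonneg ‖toFn a T lam U‖])
    (norm_nonneg _)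

theorem aestronglyMeasurable_sqrt (ha : ContinuousOn a (Icc 0 1)) :
    AEStronglyMeasurable (fun z : ℝ × ℝ => √(a z.1)) (cylMeasure (Ioo 0 1) T) := by
  have : ContinuousOn (fun z : ℝ × ℝ => √(a z.1)) (cylinder T) :=
    (ha.comp continuousOn_fst fun z hz => Ioo_subset_Icc_self hz.1).sqrt
  exact this.aestronglyMeasurable (measurableSet_Ioo.prod measurableSet_Ioo)

theorem exists_sqrt_bound (ha : ContinuousOn a (Icc 0 1)) :
    ∃ C, ∀ x ∈ Icc (0 : ℝ) 1, ‖√(a x)‖ ≤ C :=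
  isCompact_Icc.exists_bound_of_continuousOn ha.sqrt

theorem memLp_sqrt_mul (ha : ContinuousOn a (Icc 0 1)) {f : ℝ × ℝ → ℝ}
    (hf : MemLp f 2 (cylMeasure (Ioo 0 1) T)) :
    MemLp (fun z => √(a z.1) * f z) 2 (cylMeasure (Ioo 0 1) T) := by
  obtain ⟨C, hC⟩ := exists_sqrt_bound ha
  refine hf.of_le_mul (c := C) ((aestronglyMeasurable_sqrt ha).mul hf.1) ?_
  filter_upwards [ae_mem_cylinder T] with z hz
  rw [norm_mul]
  gcongr
  exact hC _ (Ioo_subset_Icc_self hz.1)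

theorem tendsto_cutoff_toLp [hlam : Fact (0 ≤ lam)] {g : ℝ × ℝ → ℝ}
    (hg : MemLp g 2 (cylMeasure (Ioo 0 1) T)) :
    Tendsto (fun n : ℕ => eLpNorm (fun z => timeCutoff T (n + 1) z.2 * g z - g z) 2
      (weightedMeasure T lam)) atTop (𝓝 0) := by
  have hg' := (memLp_weightedMeasure_iff hlam.out).2 hg
  refine tendsto_eLpNorm_two_of_dominated (bound := fun z => 2 * ‖g z‖) (fun n => ?_)
    (hg'.norm.const_mul 2) (fun n => Eventually.of_forall fun z => ?_) ?_
  · refine AEStronglyMeasurable.sub (AEStronglyMeasurable.mul ?_ hg'.1) hg'.1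
    exact ((contDiff_timeCutoff T (n + 1)).continuous.comp continuous_snd).aestronglyMeasurable
  · have h1 := norm_sub_le (timeCutoff T (n + 1) z.2 * g z) (g z)
    have h2 : ‖timeCutoff T (n + 1) z.2 * g z‖ ≤ 1 * ‖g z‖ := by
      rw [norm_mul]; gcongr; exact abs_timeCutoff_le T (n + 1) z.2
    linarith
  · rw [ae_weightedMeasure_iff hlam.out]
    filter_upwards [ae_mem_cylinder T] with z hz
    have h1 := ((timeCutoff_tendsto hz.2).comp (tendsto_add_atTop_nat 1)).mul_const (g z)
    have h2 := h1.sub_const (g z)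
    simpa using h2

theorem tendsto_toLp_pair {p : L2Pair T lam} {u v : ℕ → L2Q T lam}
    (hu : Tendsto u atTop (𝓝 p.fst)) (hv : Tendsto v atTop (𝓝 p.snd)) :
    Tendsto (fun n => (WithLp.toLp 2 (u n, v n) : L2Pair T lam)) atTop (𝓝 p) :=
  ((WithLp.prod_continuous_toLp 2 (L2Q T lam) (L2Q T lam)).tendsto (p.fst, p.snd)).comp
    (hu.prodMk_nhds hv)

/-- Lateral functions belong to the energy space. -/
theorem mem_energySpace_of_isLateral [hlam : Fact (0 ≤ lam)] (ha : ContinuousOn a (Icc 0 1))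
    {φ : ℝ × ℝ → ℝ} (hφ : IsLateral φ) {p : L2Pair T lam}
    (h1 : p.fst =ᵐ[weightedMeasure T lam] φ)
    (h2 : p.snd =ᵐ[weightedMeasure T lam] fun z => √(a z.1) * dx φ z) :
    p ∈ energySpace a T lam := by
  have hm : ∀ n : ℕ, MemLp (fun z : ℝ × ℝ => timeCutoff T (n + 1) z.2 * φ z) 2
      (weightedMeasure T lam) := fun n =>
    (memLp_weightedMeasure_iff hlam.out).2 ((hφ.time_mul (contDiff_timeCutoff T (n + 1))).memLp T)
  have hm' : ∀ n : ℕ, MemLp (fun z : ℝ × ℝ => timeCutoff T (n + 1) z.2 *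
      (√(a z.1) * dx φ z)) 2 (weightedMeasure T lam) := fun n => by
    have := memLp_sqrt_mul (T := T) ha
      ((hφ.dx.time_mul (contDiff_timeCutoff T (n + 1))).memLp T)
    refine (memLp_weightedMeasure_iff hlam.out).2
      (this.ae_eq (Eventually.of_forall fun z => ?_))
    ring
  have t1 : Tendsto (fun n => (hm n).toLp) atTop (𝓝 p.fst) := by
    rw [Lp.tendsto_Lp_iff_tendsto_eLpNorm']
    refine (tendsto_cutoff_toLp (hφ.memLp T)).congr fun n => eLpNorm_congr_ae ?_
    filter_upwards [(hm n).coeFn_toLp, h1] with z e1 e2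
    rw [Pi.sub_apply, e1, e2]
  have t2 : Tendsto (fun n => (hm' n).toLp) atTop (𝓝 p.snd) := by
    rw [Lp.tendsto_Lp_iff_tendsto_eLpNorm']
    refine (tendsto_cutoff_toLp (memLp_sqrt_mul ha (hφ.dx.memLp T))).congr
      fun n => eLpNorm_congr_ae ?_
    filter_upwards [(hm' n).coeFn_toLp, h2] with z e1 e2
    rw [Pi.sub_apply, e1, e2]
  -- The energy norm contains no time derivative, so cutting off near `t = 0` and `t = T` is
  -- harmless. Elements of the energy space therefore carry no condition at these times.
  refine mem_closure_of_tendsto (tendsto_toLp_pair t1 t2) (Eventually.of_forall fun n => ?_)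
  refine ⟨fun z => timeCutoff T (n + 1) z.2 * φ z,
    (hφ.time_mul (contDiff_timeCutoff T (n + 1))).1, (hφ.cutoff T n).1, (hφ.cutoff T n).2,
    (hm n).coeFn_toLp, (hm' n).coeFn_toLp.trans (Eventually.of_forall fun z => ?_)⟩
  change _ = √(a z.1) * dx (fun z => timeCutoff T (n + 1) z.2 * φ z) z
  rw [dx_time_mul ((contDiff_timeCutoff T (n + 1)).differentiable (by simp)) hφ.differentiable]
  ring

/-- The action of an operator on both components of a pair. -/
def diag (A : L2Q T lam →L[ℝ] L2Q T lam) : L2Pair T lam →L[ℝ] L2Pair T lam :=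
  ((WithLp.prodContinuousLinearEquiv 2 ℝ (L2Q T lam) (L2Q T lam)).symm :
    L2Q T lam × L2Q T lam →L[ℝ] L2Pair T lam) ∘L (A.prodMap A) ∘L
    ((WithLp.prodContinuousLinearEquiv 2 ℝ (L2Q T lam) (L2Q T lam)) :
      L2Pair T lam →L[ℝ] L2Q T lam × L2Q T lam)

theorem diag_fst (A : L2Q T lam →L[ℝ] L2Q T lam) (p : L2Pair T lam) :
    (diag A p).fst = A p.fst := rfl

theorem diag_snd (A : L2Q T lam →L[ℝ] L2Q T lam) (p : L2Pair T lam) :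
    (diag A p).snd = A p.snd := rfl

/-- The operator maps the energy space to itself. -/
def Preserves (a : ℝ → ℝ) (A : L2Q T lam →L[ℝ] L2Q T lam) : Prop :=
  ∀ p ∈ energySpace a T lam, diag A p ∈ energySpace a T lam

/-- A bounded operator maps closures into closures, so invariance need only be checked on smooth
functions. -/
theorem preserves_of_testSpace {A : L2Q T lam →L[ℝ] L2Q T lam}
    (h : ∀ p ∈ testSpace a T lam, diag A p ∈ energySpace a T lam) : Preserves a A := by
  have : MapsTo (diag A) (closure (testSpace a T lam)) (closure (energySpace a T lam)) :=
    MapsTo.closure (fun p hp => h p hp) (diag A).continuous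
  intro p hp
  have := this hp
  rwa [(isClosed_energySpace a T lam).closure_eq] at this

/-- The restriction of an operator to the energy space. -/
def Preserves.restrict {A : L2Q T lam →L[ℝ] L2Q T lam} (h : Preserves a A) :
    energySpace a T lam →L[ℝ] energySpace a T lam :=
  (diag A ∘L (energySpace a T lam).subtypeL).codRestrict _ fun p => h p p.2

theorem Preserves.toFn_restrict {A : L2Q T lam →L[ℝ] L2Q T lam} (h : Preserves a A)
    (U : energySpace a T lam) : toFn a T lam (h.restrict U) = A (toFn a T lam U) := rfl

theorem Preserves.toGrad_restrict {A : L2Q T lam →L[ℝ] L2Q T lam} (h : Preserves a A)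
    (U : energySpace a T lam) : toGrad a T lam (h.restrict U) = A (toGrad a T lam U) := rfl

/-- Integration in time commutes with `∂_x` and with the factor `√a`. The result need not vanish
near `t = T`, but it keeps its lateral support. -/
theorem preserves_primitiveL [hlam : Fact (0 ≤ lam)] (ha : ContinuousOn a (Icc 0 1)) :
    Preserves a (primitiveL T lam) := by
  refine preserves_of_testSpace ?_
  rintro p ⟨φ, h1, h2, h3, h4, h5⟩
  have hφ : IsLateral φ := IsLateral.of_tsupport_subset h1 h2 h3
  have hpt : ∀ ψ : ℝ × ℝ → ℝ, primitive ψ =ᵐ[cylMeasure (Ioo 0 1) T] timePrimitive ψ := by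
    intro ψ
    filter_upwards [ae_mem_cylinder T] with z hz
    exact (timePrimitive_eq_primitive ψ hz.2.1.le).symm
  refine mem_energySpace_of_isLateral ha hφ.timePrimitive ?_ ?_
  · rw [diag_fst]
    refine (coeFn_primitiveL _).trans ?_
    rw [ae_weightedMeasure_eq_iff hlam.out]
    exact (primitive_congr ((ae_weightedMeasure_eq_iff hlam.out).1 h4)).trans (hpt φ)
  · rw [diag_snd]
    refine (coeFn_primitiveL _).trans ?_
    rw [ae_weightedMeasure_eq_iff hlam.out, dx_timePrimitive h1]
    refine (primitive_congr ((ae_weightedMeasure_eq_iff hlam.out).1 h5)).trans ?_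
    filter_upwards [hpt (dx φ)] with z hz
    rw [← hz, primitive, primitive, ← integral_const_mul]

/-- The adjoint of the primitive on smooth functions. -/
def backwardPrimitive (T lam : ℝ) (φ : ℝ × ℝ → ℝ) (z : ℝ × ℝ) : ℝ :=
  Real.exp (2 * lam * z.2) * (timePrimitive (fun w => Real.exp (-(2 * lam * w.2)) * φ w) (z.1, T) -
    timePrimitive (fun w => Real.exp (-(2 * lam * w.2)) * φ w) z)

theorem contDiff_exp_mul (c : ℝ) : ContDiff ℝ ∞ fun t : ℝ => Real.exp (c * t) := by fun_prop

theorem contDiff_exp_neg (c : ℝ) : ContDiff ℝ ∞ fun t : ℝ => Real.exp (-(c * t)) := by fun_prop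

theorem IsLateral.backwardPrimitive {φ : ℝ × ℝ → ℝ} (hφ : IsLateral φ) :
    IsLateral (backwardPrimitive T lam φ) := by
  have h1 := (hφ.time_mul (contDiff_exp_neg (2 * lam))).timePrimitive
  exact ((h1.comp_const_time T).sub h1).time_mul (contDiff_exp_mul (2 * lam))

theorem dx_backwardPrimitive {φ : ℝ × ℝ → ℝ} (hφ : IsLateral φ) :
    dx (backwardPrimitive T lam φ) = backwardPrimitive T lam (dx φ) := by
  have h0 := hφ.time_mul (contDiff_exp_neg (2 * lam))
  have h1 := h0.timePrimitive
  ext z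
  unfold backwardPrimitive
  rw [dx_time_mul ((contDiff_exp_mul (2 * lam)).differentiable (by simp))
    ((h1.comp_const_time T).sub h1).differentiable]
  congr 1
  have e1 : dx (fun w => Real.exp (-(2 * lam * w.2)) * φ w) =
      fun w => Real.exp (-(2 * lam * w.2)) * dx φ w := by
    ext w
    exact dx_time_mul ((contDiff_exp_neg (2 * lam)).differentiable (by simp)) hφ.differentiable w
  have e2 := hasDerivAt_dx (x := z.1) (t := z.2) (((h1.comp_const_time T).sub h1).differentiable z)
  have e3 := (hasDerivAt_dx (x := z.1) (t := T) (h1.differentiable (z.1, T))).sub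
    (hasDerivAt_dx (x := z.1) (t := z.2) (h1.differentiable z))
  have e4 := e2.unique e3
  rw [dx_timePrimitive h0.1, e1] at e4
  exact e4

theorem integral_Ioo_exp_mul {φ : ℝ × ℝ → ℝ} (hφ : Continuous φ) {z : ℝ × ℝ}
    (hz : z ∈ cylinder T) :
    ∫ s in Ioo z.2 T, Real.exp (-(2 * lam * s)) * φ (z.1, s) =
      Real.exp (-(2 * lam * z.2)) * backwardPrimitive T lam φ z := by
  have hc : Continuous fun s : ℝ => Real.exp (-(2 * lam * s)) * φ (z.1, s) := by
    have : Continuous fun s : ℝ => φ (z.1, s) := hφ.comp (by fun_prop)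
    fun_prop
  rw [backwardPrimitive, ← mul_assoc, ← Real.exp_add, neg_add_cancel, Real.exp_zero, one_mul,
    timePrimitive, timePrimitive, intervalIntegral.integral_interval_sub_left
    (hc.intervalIntegrable _ _) (hc.intervalIntegrable _ _),
    intervalIntegral.integral_of_le hz.2.2.le, integral_Ioc_eq_integral_Ioo]

/-- Fubini on the triangle `s < t` gives `I† φ = e^{2λt} ∫_t^T e^{-2λs} φ ds`. The spatial factor
`c` lets one statement cover both components `φ` and `√a φ_x` of a pair. -/
theorem adjoint_primitiveL_ae [hlam : Fact (0 ≤ lam)] {φ : ℝ × ℝ → ℝ} (hφ : IsLateral φ)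
    {c : ℝ → ℝ} (hc : AEStronglyMeasurable (fun z : ℝ × ℝ => c z.1) (cylMeasure (Ioo 0 1) T))
    {C : ℝ} (hC : ∀ x ∈ Ioo (0 : ℝ) 1, ‖c x‖ ≤ C) {u : L2Q T lam}
    (hu : u =ᵐ[weightedMeasure T lam] fun z => c z.1 * φ z) :
    adjoint (primitiveL T lam) u =ᵐ[weightedMeasure T lam]
      fun z => c z.1 * backwardPrimitive T lam φ z := by
  have hmul : ∀ {ψ : ℝ × ℝ → ℝ}, IsLateral ψ →
      MemLp (fun z => c z.1 * ψ z) 2 (cylMeasure (Ioo 0 1) T) := fun {ψ} hψ => by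
    refine (hψ.memLp T).of_le_mul (c := C) (hc.mul (hψ.memLp T).1) ?_
    filter_upwards [ae_mem_cylinder T] with z hz
    rw [norm_mul]
    gcongr
    exact hC _ hz.1
  have hJ := (memLp_weightedMeasure_iff hlam.out).2
    (hmul (hφ.backwardPrimitive (T := T) (lam := lam)))
  suffices h : adjoint (primitiveL T lam) u = hJ.toLp by
    rw [h]; exact hJ.coeFn_toLp
  refine ext_inner_left ℝ fun f => ?_
  rw [ContinuousLinearMap.adjoint_inner_right, inner_toLp_weightedMeasure,
    inner_toLp_weightedMeasure]
  have hf := (memLp_weightedMeasure_iff hlam.out).1 (Lp.memLp f)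
  set θ : ℝ × ℝ → ℝ := fun z => Real.exp (-(2 * lam * z.2)) * (c z.1 * φ z) with hθ
  have hθm : MemLp θ 2 (cylMeasure (Ioo 0 1) T) := by
    refine (hmul (hφ.time_mul (contDiff_exp_neg (2 * lam)))).ae_eq
      (Eventually.of_forall fun z => ?_)
    simp only [hθ]; ring
  have hΘe : ∀ z ∈ cylinder T, ∫ s in Ioo z.2 T, θ (z.1, s) =
      c z.1 * (Real.exp (-(2 * lam * z.2)) * backwardPrimitive T lam φ z) := by
    intro z hz
    rw [← integral_Ioo_exp_mul hφ.continuous hz, ← integral_const_mul]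
    congr 1
    ext s
    simp only [hθ]; ring
  have hΘ : MemLp (fun z => ∫ s in Ioo z.2 T, θ (z.1, s)) 2 (cylMeasure (Ioo 0 1) T) := by
    refine (hmul ((hφ.backwardPrimitive (T := T) (lam := lam)).time_mul
      (contDiff_exp_neg (2 * lam)))).ae_eq ?_
    filter_upwards [ae_mem_cylinder T] with z hz
    exact (hΘe z hz).symm
  calc _ = ∫ z, primitive f z * θ z ∂cylMeasure (Ioo 0 1) T := by
        refine integral_congr_ae ?_
        filter_upwards [(ae_weightedMeasure_eq_iff hlam.out).1 (coeFn_primitiveL f),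
          (ae_weightedMeasure_eq_iff hlam.out).1 hu] with z e1 e2
        rw [e1, e2]
        simp only [hθ]; ring
    _ = _ := integral_primitive_mul hf hθm hΘ
    _ = _ := by
        refine integral_congr_ae ?_
        filter_upwards [ae_mem_cylinder T,
          (ae_weightedMeasure_eq_iff hlam.out).1 hJ.coeFn_toLp] with z hz e1
        rw [hΘe z hz, e1]; ring

theorem preserves_adjoint_primitiveL [hlam : Fact (0 ≤ lam)] (ha : ContinuousOn a (Icc 0 1)) :
    Preserves a (adjoint (primitiveL T lam)) := by
  refine preserves_of_testSpace ?_
  rintro p ⟨φ, h1, h2, h3, h4, h5⟩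
  have hφ : IsLateral φ := IsLateral.of_tsupport_subset h1 h2 h3
  obtain ⟨C, hC⟩ := exists_sqrt_bound ha
  refine mem_energySpace_of_isLateral ha (hφ.backwardPrimitive (T := T) (lam := lam)) ?_ ?_
  · rw [diag_fst]
    have := adjoint_primitiveL_ae (T := T) (lam := lam) hφ (c := fun _ => 1) (C := 1)
      aestronglyMeasurable_const (by simp) (u := p.fst) (by simpa using h4)
    simpa using this
  · rw [diag_snd, dx_backwardPrimitive hφ]
    exact adjoint_primitiveL_ae hφ.dx (aestronglyMeasurable_sqrt ha)
      (fun x hx => hC x (Ioo_subset_Icc_self hx)) h5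

open Classical in
/-- Multiplication by an essentially bounded function. -/
def mulOp (T lam : ℝ) (g : ℝ × ℝ → ℝ) : L2Q T lam →L[ℝ] L2Q T lam :=
  if h : MemLp g ⊤ (weightedMeasure T lam) then
    (ContinuousLinearMap.mul ℝ ℝ).holderL (weightedMeasure T lam) ⊤ 2 2 h.toLp
  else 0

theorem coeFn_mulOp {g : ℝ × ℝ → ℝ} (hg : MemLp g ⊤ (weightedMeasure T lam)) (f : L2Q T lam) :
    mulOp T lam g f =ᵐ[weightedMeasure T lam] fun z => g z * f z := by
  rw [mulOp, dif_pos hg]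
  filter_upwards [ContinuousLinearMap.coeFn_holder (ContinuousLinearMap.mul ℝ ℝ) (r := 2)
    hg.toLp f, hg.coeFn_toLp] with z e1 e2
  rw [ContinuousLinearMap.holderL_apply_apply, e1, e2]
  rfl

theorem norm_mulOp_apply_le {g : ℝ × ℝ → ℝ} (hg : MemLp g ⊤ (weightedMeasure T lam)) {C : ℝ}
    (hC : ∀ᵐ z ∂weightedMeasure T lam, ‖g z‖ ≤ C) (f : L2Q T lam) :
    ‖mulOp T lam g f‖ ≤ C * ‖f‖ := by
  refine Lp.norm_le_mul_norm_of_ae_le_mul ?_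
  filter_upwards [coeFn_mulOp hg f, hC] with z e1 e2
  rw [e1, norm_mul]
  gcongr

theorem mulOp_symm {g : ℝ × ℝ → ℝ} (hg : MemLp g ⊤ (weightedMeasure T lam)) (f f' : L2Q T lam) :
    ⟪mulOp T lam g f, f'⟫_ℝ = ⟪f, mulOp T lam g f'⟫_ℝ := by
  rw [inner_toLp_weightedMeasure, inner_toLp_weightedMeasure, ← integral_weightedMeasure,
    ← integral_weightedMeasure]
  refine integral_congr_ae ?_
  filter_upwards [coeFn_mulOp hg f, coeFn_mulOp hg f'] with z e1 e2
  rw [e1, e2]; ring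

theorem mulOp_coercive {g : ℝ × ℝ → ℝ} (hg : MemLp g ⊤ (weightedMeasure T lam)) {b₀ : ℝ}
    (hb : ∀ᵐ z ∂weightedMeasure T lam, b₀ ≤ g z) (f : L2Q T lam) :
    b₀ * ‖f‖ ^ 2 ≤ ⟪mulOp T lam g f, f⟫_ℝ := by
  have hff : Integrable (fun z => f z * f z) (weightedMeasure T lam) :=
    (Lp.memLp f).integrable_mul (Lp.memLp f)
  have h2 : Integrable (fun z => mulOp T lam g f z * f z) (weightedMeasure T lam) :=
    (Lp.memLp _).integrable_mul (Lp.memLp f)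
  rw [← real_inner_self_eq_norm_sq, inner_toLp_weightedMeasure, inner_toLp_weightedMeasure,
    ← integral_weightedMeasure, ← integral_weightedMeasure, ← integral_const_mul]
  refine integral_mono_ae (hff.const_mul _) h2 ?_
  filter_upwards [coeFn_mulOp hg f, hb] with z e1 e2
  rw [e1]
  nlinarith [mul_self_nonneg (f z)]

theorem memLp_top_weightedMeasure {g : ℝ × ℝ → ℝ} [hlam : Fact (0 ≤ lam)] {C : ℝ}
    (hg : AEStronglyMeasurable g (cylMeasure (Ioo 0 1) T)) (hC : ∀ z ∈ cylinder T, ‖g z‖ ≤ C) :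
    MemLp g ⊤ (weightedMeasure T lam) := by
  refine MemLp.mono_measure (weightedMeasure_le hlam.out) (memLp_top_of_bound hg C ?_)
  filter_upwards [ae_mem_cylinder T] with z hz using hC z hz

theorem preserves_mulOp_smooth [hlam : Fact (0 ≤ lam)] {θ : ℝ → ℝ} (hθ : ContDiff ℝ ∞ θ) :
    Preserves a (mulOp T lam fun z => θ z.2) := by
  obtain ⟨C, hC⟩ := (isCompact_Icc (a := (0 : ℝ)) (b := T)).exists_bound_of_continuousOn
    hθ.continuous.continuousOn
  have hm : MemLp (fun z : ℝ × ℝ => θ z.2) ⊤ (weightedMeasure T lam) :=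
    memLp_top_weightedMeasure (C := C) (hθ.continuous.comp continuous_snd).aestronglyMeasurable
      fun z hz => hC _ (Ioo_subset_Icc_self hz.2)
  refine preserves_of_testSpace ?_
  rintro p ⟨φ, h1, h2, h3, h4, h5⟩
  refine Submodule.le_topologicalClosure _ ⟨fun z => θ z.2 * φ z, (hθ.comp contDiff_snd).mul h1,
    h2.mul_left, (tsupport_mul_subset_right).trans h3, ?_, ?_⟩
  · rw [diag_fst]
    filter_upwards [coeFn_mulOp hm p.fst, h4] with z e1 e2
    rw [e1, e2]
  · rw [diag_snd]
    filter_upwards [coeFn_mulOp hm p.snd, h5] with z e1 e2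
    rw [e1, e2, dx_time_mul (hθ.differentiable (by simp)) (h1.differentiable (by simp))]
    ring

/-- As `b` is only continuous, multiplication does not preserve smooth functions. Weierstrass
approximation by polynomials reduces to the smooth case, because the energy space is closed. -/
theorem preserves_mulOp [hlam : Fact (0 ≤ lam)] {b : ℝ → ℝ} (hb : ContinuousOn b (Icc 0 T))
    (hbm : MemLp (fun z : ℝ × ℝ => b z.2) ⊤ (weightedMeasure T lam)) :
    Preserves a (mulOp T lam fun z => b z.2) := by
  intro p hp
  have hpoly : ∀ n : ℕ, ∃ q : Polynomial ℝ, ∀ t ∈ Icc 0 T, |q.eval t - b t| < 1 / ((n : ℝ) + 1) :=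
    fun n => exists_polynomial_near_of_continuousOn 0 T b hb _ (by positivity)
  choose q hq using hpoly
  have hqs : ∀ n, ContDiff ℝ ∞ fun t => (q n).eval t := fun n => by
    simpa only [Polynomial.coe_aeval_eq_eval] using Polynomial.contDiff_aeval (𝕜 := ℝ) (q n) ∞
  have hqm : ∀ n, MemLp (fun z : ℝ × ℝ => (q n).eval z.2) ⊤ (weightedMeasure T lam) := fun n => by
    obtain ⟨C, hC⟩ := (isCompact_Icc (a := (0 : ℝ)) (b := T)).exists_bound_of_continuousOn
      (hqs n).continuous.continuousOn
    exact memLp_top_weightedMeasure (C := C) ((hqs n).continuous.comp continuous_snd).aestronglyMeasurable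
      fun z hz => hC _ (Ioo_subset_Icc_self hz.2)
  have ht : ∀ f : L2Q T lam, Tendsto (fun n => mulOp T lam (fun z => (q n).eval z.2) f) atTop
      (𝓝 (mulOp T lam (fun z => b z.2) f)) := by
    intro f
    rw [tendsto_iff_norm_sub_tendsto_zero]
    refine squeeze_zero (fun _ => norm_nonneg _)
      (g := fun n : ℕ => 1 / ((n : ℝ) + 1) * ‖f‖) (fun n => ?_) ?_
    · refine Lp.norm_le_mul_norm_of_ae_le_mul ?_
      have hz : ∀ᵐ z ∂weightedMeasure T lam, z ∈ cylinder T :=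
        (ae_weightedMeasure_iff hlam.out).2 (ae_mem_cylinder T)
      filter_upwards [Lp.coeFn_sub (mulOp T lam (fun z => (q n).eval z.2) f)
        (mulOp T lam (fun z => b z.2) f), coeFn_mulOp (hqm n) f, coeFn_mulOp hbm f, hz]
        with z e1 e2 e3 e4
      rw [e1, Pi.sub_apply, e2, e3, ← sub_mul, norm_mul]
      gcongr
      exact (hq n _ (Ioo_subset_Icc_self e4.2)).le
    · simpa using tendsto_one_div_add_atTop_nhds_zero_nat.mul_const ‖f‖
  exact (isClosed_energySpace a T lam).mem_of_tendsto
    (tendsto_toLp_pair (p := diag (mulOp T lam fun z => b z.2) p) (ht p.fst) (ht p.snd))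
    (Eventually.of_forall fun n => preserves_mulOp_smooth (hqs n) p hp)

end EnergySpace

/-! ### A weighted Ladyzhenskaya inequality and the bound in `L⁴(Q)`. -/

section Ladyzhenskaya

open scoped ENNReal

/-- A weighted Ladyzhenskaya inequality on `(0,1)`. -/
theorem integral_pow_four_le {φ φ' : ℝ → ℝ} (hφ : ∀ x, HasDerivAt φ (φ' x) x)
    (hφ' : Continuous φ') (h1 : φ 1 = 0) :
    ∫ x in (0 : ℝ)..1, φ x ^ 4 ≤
      8 * ((∫ x in (0 : ℝ)..1, φ x ^ 2) * ∫ x in (0 : ℝ)..1, (√x * φ' x) ^ 2) := by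
  have hc : Continuous φ := continuous_iff_continuousAt.2 fun x => (hφ x).continuousAt
  set N := ∫ s in (0 : ℝ)..1, |φ s| * (√s * |φ' s|) with hN
  -- Since `φ 1 = 0`, `φ(x)²` is minus the integral of `2 φ φ'` over `(x,1)`, and there `√x ≤ √s`.
  -- Integrating from the nondegenerate end is what allows the weight.
  have hpt : ∀ x ∈ Icc (0 : ℝ) 1, √x * φ x ^ 2 ≤ 2 * N := by
    intro x hx
    have e1 : ∫ s in x..1, 2 * φ s * φ' s = φ 1 ^ 2 - φ x ^ 2 := by
      refine intervalIntegral.integral_eq_sub_of_hasDerivAt (f := fun s => φ s ^ 2)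
        (fun s _ => ?_) (Continuous.intervalIntegrable (by fun_prop) _ _)
      exact ((hφ s).pow 2).congr_deriv (by simp)
    calc √x * φ x ^ 2 = ∫ s in x..1, -(√x * (2 * φ s * φ' s)) := by
          rw [intervalIntegral.integral_neg, intervalIntegral.integral_const_mul, e1, h1]; ring
      _ ≤ ∫ s in x..1, 2 * (|φ s| * (√s * |φ' s|)) := by
          refine intervalIntegral.integral_mono_on hx.2
            (Continuous.intervalIntegrable (by fun_prop) _ _)
            (Continuous.intervalIntegrable (by fun_prop) _ _) fun s hs => ?_
          calc -(√x * (2 * φ s * φ' s)) ≤ |√x * (2 * φ s * φ' s)| := neg_le_abs _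
            _ = 2 * (|φ s| * (√x * |φ' s|)) := by
                rw [abs_mul, abs_mul, abs_mul, abs_of_nonneg (Real.sqrt_nonneg x), abs_two]; ring
            _ ≤ _ := by gcongr; exact hs.1
      _ ≤ ∫ s in (0 : ℝ)..1, 2 * (|φ s| * (√s * |φ' s|)) := by
          refine intervalIntegral.integral_mono_interval hx.1 hx.2 le_rfl
            (Eventually.of_forall fun s => by positivity)
            (Continuous.intervalIntegrable (by fun_prop) _ _)
      _ = 2 * N := intervalIntegral.integral_const_mul _ _
  -- Integrating `(x φ⁴)'` supplies a factor `x = √x √x`: one root goes to `φ²` through `hpt`, the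
  -- other to `φ'`.
  have e2 : ∫ x in (0 : ℝ)..1, (φ x ^ 4 + x * (4 * φ x ^ 3 * φ' x)) = 1 * φ 1 ^ 4 - 0 * φ 0 ^ 4 := by
    refine intervalIntegral.integral_eq_sub_of_hasDerivAt (f := fun x => x * φ x ^ 4)
      (fun s _ => ?_) (Continuous.intervalIntegrable (by fun_prop) _ _)
    exact ((hasDerivAt_id s).mul ((hφ s).pow 4)).congr_deriv (by simp)
  have e3 : ∫ x in (0 : ℝ)..1, φ x ^ 4 = ∫ x in (0 : ℝ)..1, -(x * (4 * φ x ^ 3 * φ' x)) := by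
    rw [intervalIntegral.integral_add (Continuous.intervalIntegrable (by fun_prop) _ _)
      (Continuous.intervalIntegrable (by fun_prop) _ _), h1] at e2
    rw [intervalIntegral.integral_neg]
    linarith
  have hQ : ∫ x in (0 : ℝ)..1, φ x ^ 4 ≤ 8 * N ^ 2 := by
    rw [e3]
    calc _ ≤ ∫ x in (0 : ℝ)..1, 8 * N * (|φ x| * (√x * |φ' x|)) := by
          refine intervalIntegral.integral_mono_on zero_le_one
            (Continuous.intervalIntegrable (by fun_prop) _ _)
            (Continuous.intervalIntegrable (by fun_prop) _ _) fun x hx => ?_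
          have hs : √x * √x = x := Real.mul_self_sqrt hx.1
          calc -(x * (4 * φ x ^ 3 * φ' x)) ≤ |x * (4 * φ x ^ 3 * φ' x)| := neg_le_abs _
            _ = 4 * (√x * φ x ^ 2) * (|φ x| * (√x * |φ' x|)) := by
                rw [abs_mul, abs_mul, abs_mul, abs_pow, abs_of_nonneg hx.1, ← sq_abs (φ x)]
                rw [show |(4 : ℝ)| = 4 by norm_num]
                linear_combination (-4 * |φ x| ^ 3 * |φ' x|) * hs
            _ ≤ 4 * (2 * N) * (|φ x| * (√x * |φ' x|)) := by
                refine mul_le_mul_of_nonneg_right ?_ (by positivity)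
                linarith [hpt x hx]
            _ = _ := by ring
      _ = 8 * N ^ 2 := by rw [intervalIntegral.integral_const_mul]; ring
  -- Cauchy–Schwarz, as nonpositivity of the discriminant of a nonnegative quadratic polynomial in
  -- `r`.
  have hCS : N ^ 2 ≤ (∫ x in (0 : ℝ)..1, φ x ^ 2) * ∫ x in (0 : ℝ)..1, (√x * φ' x) ^ 2 := by
    have := discrim_le_zero (a := ∫ x in (0 : ℝ)..1, φ x ^ 2) (b := -(2 * N))
      (c := ∫ x in (0 : ℝ)..1, (√x * φ' x) ^ 2) fun r => by
      have : ∫ x in (0 : ℝ)..1, (r * |φ x| - √x * |φ' x|) ^ 2 =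
          (∫ x in (0 : ℝ)..1, φ x ^ 2) * (r * r) + -(2 * N) * r +
            ∫ x in (0 : ℝ)..1, (√x * φ' x) ^ 2 := by
        rw [← intervalIntegral.integral_mul_const, neg_mul, hN,
          ← intervalIntegral.integral_const_mul, ← intervalIntegral.integral_mul_const,
          ← intervalIntegral.integral_neg,
          ← intervalIntegral.integral_add (Continuous.intervalIntegrable (by fun_prop) _ _)
            (Continuous.intervalIntegrable (by fun_prop) _ _),
          ← intervalIntegral.integral_add (Continuous.intervalIntegrable (by fun_prop) _ _)
            (Continuous.intervalIntegrable (by fun_prop) _ _)]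
        congr 1
        ext x
        rw [← sq_abs (φ x), mul_pow, ← sq_abs (φ' x)]
        ring
      rw [← this]
      exact intervalIntegral.integral_nonneg zero_le_one fun x _ => sq_nonneg _
    rw [discrim] at this
    nlinarith
  linarith

theorem lintegral_enorm_pow_eq {f : ℝ → ℝ} (hf : Continuous f) {n : ℕ} (hn : Even n) :
    ∫⁻ x in Ioo (0 : ℝ) 1, ‖f x‖ₑ ^ n = ENNReal.ofReal (∫ x in (0 : ℝ)..1, f x ^ n) := by
  rw [intervalIntegral.integral_of_le zero_le_one, integral_Ioc_eq_integral_Ioo,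
    ofReal_integral_eq_lintegral_ofReal]
  · refine lintegral_congr fun x => ?_
    rw [← hn.pow_abs, ENNReal.ofReal_pow (abs_nonneg _), Real.enorm_eq_ofReal_abs]
  · exact (hf.pow n).continuousOn.integrableOn_Icc.mono_set Ioo_subset_Icc_self
  · exact Eventually.of_forall fun x => hn.pow_nonneg _

theorem lintegral_pow_four_le {φ φ' : ℝ → ℝ} (hφ : ∀ x, HasDerivAt φ (φ' x) x)
    (hφ' : Continuous φ') (h1 : φ 1 = 0) :
    ∫⁻ x in Ioo (0 : ℝ) 1, ‖φ x‖ₑ ^ 4 ≤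
      8 * ((∫⁻ x in Ioo (0 : ℝ) 1, ‖φ x‖ₑ ^ 2) * ∫⁻ x in Ioo (0 : ℝ) 1, ‖√x * φ' x‖ₑ ^ 2) := by
  have hc : Continuous φ := continuous_iff_continuousAt.2 fun x => (hφ x).continuousAt
  rw [lintegral_enorm_pow_eq hc (by decide), lintegral_enorm_pow_eq hc (by decide),
    lintegral_enorm_pow_eq (f := fun x => √x * φ' x) (by fun_prop) (by decide),
    ← ENNReal.ofReal_mul (intervalIntegral.integral_nonneg zero_le_one fun x _ => by positivity),
    show (8 : ℝ≥0∞) = ENNReal.ofReal 8 by simp, ← ENNReal.ofReal_mul (by norm_num)]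
  exact ENNReal.ofReal_le_ofReal (integral_pow_four_le hφ hφ' h1)

theorem ae_snd_of_ae_cyl {T : ℝ} {p : ℝ × ℝ → Prop} (h : ∀ᵐ z ∂cylMeasure (Ioo 0 1) T, p z) :
    ∀ᵐ t ∂volume.restrict (Ioo (0 : ℝ) T), ∀ᵐ x ∂volume.restrict (Ioo (0 : ℝ) 1), p (x, t) := by
  rw [cylMeasure_eq_prod] at h
  exact Measure.ae_ae_of_ae_prod (Measure.measurePreserving_swap.quasiMeasurePreserving.ae h)

theorem aestronglyMeasurable_slice {T : ℝ} {f : ℝ × ℝ → ℝ}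
    (hf : AEStronglyMeasurable f (cylMeasure (Ioo 0 1) T)) :
    ∀ᵐ t ∂volume.restrict (Ioo (0 : ℝ) T),
      AEStronglyMeasurable (fun x => f (x, t)) (volume.restrict (Ioo (0 : ℝ) 1)) := by
  rw [cylMeasure_eq_prod] at hf
  exact hf.prod_swap.prodMk_left

/-- Convergence in `L²(Q)` alone gives slice convergence only along a subsequence. Summability makes
the series of slice norms finite for almost every `t`, so its terms tend to zero. -/
theorem tendsto_slice_of_summable {T : ℝ} {f : ℕ → ℝ × ℝ → ℝ}
    (hf : ∀ n, AEStronglyMeasurable (f n) (cylMeasure (Ioo 0 1) T))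
    (hs : ∑' n, ∫⁻ z, ‖f n z‖ₑ ^ 2 ∂cylMeasure (Ioo 0 1) T ≠ ⊤) :
    ∀ᵐ t ∂volume.restrict (Ioo (0 : ℝ) T), Tendsto (fun n => eLpNorm (fun x => f n (x, t)) 2
      (volume.restrict (Ioo (0 : ℝ) 1))) atTop (𝓝 0) := by
  have hm : ∀ n, AEMeasurable (fun t => ∫⁻ x in Ioo (0 : ℝ) 1, ‖f n (x, t)‖ₑ ^ 2)
      (volume.restrict (Ioo (0 : ℝ) T)) := fun n => by
    have := (hf n).enorm.pow_const 2
    rw [cylMeasure_eq_prod] at this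
    exact this.prod_swap.lintegral_prod_right'
  have h1 : ∫⁻ t in Ioo (0 : ℝ) T, ∑' n, ∫⁻ x in Ioo (0 : ℝ) 1, ‖f n (x, t)‖ₑ ^ 2 ≠ ⊤ := by
    rw [lintegral_tsum hm]
    convert hs using 3 with n
    exact (lintegral_cyl_swap ((hf n).enorm.pow_const 2)).symm
  filter_upwards [ae_lt_top' (AEMeasurable.tsum hm) h1] with t ht
  have h2 := ENNReal.tendsto_atTop_zero_of_tsum_ne_top ht.ne
  have h3 := (ENNReal.continuous_rpow_const (y := (1 / 2 : ℝ))).tendsto 0 |>.comp h2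
  rw [ENNReal.zero_rpow_of_pos (by norm_num)] at h3
  refine h3.congr fun n => ?_
  rw [eLpNorm_two_eq_lintegral]
  rfl

theorem tendsto_ae_of_summable {α : Type*} [MeasurableSpace α] {m : Measure α} {f : ℕ → α → ℝ}
    (hf : ∀ n, AEStronglyMeasurable (f n) m) (hs : ∑' n, ∫⁻ z, ‖f n z‖ₑ ^ 2 ∂m ≠ ⊤) :
    ∀ᵐ z ∂m, Tendsto (fun n => f n z) atTop (𝓝 0) := by
  have hm := fun n => (hf n).enorm.pow_const 2
  rw [← lintegral_tsum hm] at hs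
  filter_upwards [ae_lt_top' (AEMeasurable.tsum hm) hs] with z hz
  have h2 := ENNReal.tendsto_atTop_zero_of_tsum_ne_top hz.ne
  rw [tendsto_zero_iff_enorm_tendsto_zero]
  have h3 := (ENNReal.continuous_rpow_const (y := (1 / 2 : ℝ))).tendsto 0 |>.comp h2
  rw [ENNReal.zero_rpow_of_pos (by norm_num)] at h3
  refine h3.congr fun n => ?_
  simp only [Function.comp_apply]
  rw [← ENNReal.rpow_natCast, ← ENNReal.rpow_mul]
  norm_num

theorem eLpNorm_two_sq {α E : Type*} [MeasurableSpace α] {m : Measure α} [NormedAddCommGroup E]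
    (f : α → E) : eLpNorm f 2 m ^ 2 = ∫⁻ a, ‖f a‖ₑ ^ 2 ∂m := by
  rw [eLpNorm_two_eq_lintegral, ← ENNReal.rpow_natCast, ← ENNReal.rpow_mul]
  norm_num

theorem eLpNorm_four_pow {α E : Type*} [MeasurableSpace α] {m : Measure α} [NormedAddCommGroup E]
    (f : α → E) : eLpNorm f 4 m ^ 4 = ∫⁻ a, ‖f a‖ₑ ^ 4 ∂m := by
  rw [eLpNorm_eq_lintegral_rpow_enorm_toReal (by norm_num) (by norm_num), ← ENNReal.rpow_natCast,
    ← ENNReal.rpow_mul]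
  norm_num

/-- Fatou's lemma for the fourth powers on the left; the `L²` norms on the right converge. -/
theorem lintegral_pow_four_le_of_tendsto {ν : Measure ℝ} {φ g : ℕ → ℝ → ℝ} {u G : ℝ → ℝ}
    (hφ : ∀ n, AEStronglyMeasurable (φ n) ν) (hg : ∀ n, AEStronglyMeasurable (g n) ν)
    (hu : MemLp u 2 ν) (hG : MemLp G 2 ν)
    (hlad : ∀ n, ∫⁻ x, ‖φ n x‖ₑ ^ 4 ∂ν ≤ 8 * (eLpNorm (φ n) 2 ν ^ 2 * eLpNorm (g n) 2 ν ^ 2))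
    (h1 : Tendsto (fun n => eLpNorm (fun x => φ n x - u x) 2 ν) atTop (𝓝 0))
    (h2 : Tendsto (fun n => eLpNorm (fun x => g n x - G x) 2 ν) atTop (𝓝 0))
    (h3 : ∀ᵐ x ∂ν, Tendsto (fun n => φ n x - u x) atTop (𝓝 0)) :
    ∫⁻ x, ‖u x‖ₑ ^ 4 ∂ν ≤ 8 * (eLpNorm u 2 ν ^ 2 * eLpNorm G 2 ν ^ 2) := by
  have htri : ∀ {f : ℕ → ℝ → ℝ} {w : ℝ → ℝ}, (∀ n, AEStronglyMeasurable (f n) ν) →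
      MemLp w 2 ν → ∀ n, eLpNorm (f n) 2 ν ≤
        eLpNorm (fun x => f n x - w x) 2 ν + eLpNorm w 2 ν := fun {f w} hf hw n => by
    refine le_trans (le_of_eq ?_)
      (eLpNorm_add_le (f := fun x => f n x - w x) (g := w) ((hf n).sub hw.1) hw.1 (by norm_num))
    congr 1
    ext x
    simp
  have hlim : Tendsto (fun n => 8 * ((eLpNorm (fun x => φ n x - u x) 2 ν + eLpNorm u 2 ν) ^ 2 *
      (eLpNorm (fun x => g n x - G x) 2 ν + eLpNorm G 2 ν) ^ 2)) atTop
      (𝓝 (8 * ((0 + eLpNorm u 2 ν) ^ 2 * (0 + eLpNorm G 2 ν) ^ 2))) := by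
    have fin1 : (0 + eLpNorm u 2 ν) ^ 2 ≠ ⊤ := by simpa using hu.2.ne
    have fin2 : (0 + eLpNorm G 2 ν) ^ 2 ≠ ⊤ := by simpa using hG.2.ne
    refine ENNReal.Tendsto.const_mul ?_ (Or.inr (by simp))
    exact ENNReal.Tendsto.mul (ENNReal.Tendsto.pow (h1.add tendsto_const_nhds)) (Or.inr fin2)
      (ENNReal.Tendsto.pow (h2.add tendsto_const_nhds)) (Or.inr fin1)
  rw [zero_add, zero_add] at hlim
  calc ∫⁻ x, ‖u x‖ₑ ^ 4 ∂ν = ∫⁻ x, liminf (fun n => ‖φ n x‖ₑ ^ 4) atTop ∂ν := by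
        refine lintegral_congr_ae ?_
        filter_upwards [h3] with x hx
        have h4 : Tendsto (fun n => φ n x) atTop (𝓝 (u x)) := by
          simpa using hx.add_const (u x)
        exact ((ENNReal.Tendsto.pow h4.enorm).liminf_eq).symm
    _ ≤ liminf (fun n => ∫⁻ x, ‖φ n x‖ₑ ^ 4 ∂ν) atTop :=
        lintegral_liminf_le' fun n => (hφ n).enorm.pow_const 4
    _ ≤ liminf (fun n => 8 * ((eLpNorm (fun x => φ n x - u x) 2 ν + eLpNorm u 2 ν) ^ 2 *
        (eLpNorm (fun x => g n x - G x) 2 ν + eLpNorm G 2 ν) ^ 2)) atTop := by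
        refine liminf_le_liminf (Eventually.of_forall fun n => ?_)
        refine (hlad n).trans ?_
        gcongr
        · exact htri hφ hu n
        · exact htri hg hG n
    _ = _ := hlim.liminf_eq

theorem ae_slice_pow_four_le {a : ℝ → ℝ} {T lam : ℝ} [hlam : Fact (0 ≤ lam)]
    (ha : ContinuousOn a (Icc 0 1)) (hax : ∀ x ∈ Ioo (0 : ℝ) 1, x ≤ a x)
    (U : energySpace a T lam) :
    ∀ᵐ t ∂volume.restrict (Ioo (0 : ℝ) T),
      ∫⁻ x in Ioo (0 : ℝ) 1, ‖toFn a T lam U (x, t)‖ₑ ^ 4 ≤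
        8 * ((∫⁻ x in Ioo (0 : ℝ) 1, ‖toFn a T lam U (x, t)‖ₑ ^ 2) *
          ∫⁻ x in Ioo (0 : ℝ) 1, ‖toGrad a T lam U (x, t)‖ₑ ^ 2) := by
  -- Approximation at a geometric rate makes the squared errors summable, so no subsequences are
  -- needed for the slices.
  have happ : ∀ n : ℕ, ∃ p ∈ testSpace a T lam, dist (U : L2Pair T lam) p < (1 / 2) ^ n :=
    fun n => Metric.mem_closure_iff.1 U.2 _ (by positivity)
  choose p hp hpd using happ
  choose φ hφ hφs hφc hφ1 hφ2 using hp
  have hmu := (memLp_weightedMeasure_iff hlam.out).1 (Lp.memLp (toFn a T lam U))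
  have hmG := (memLp_weightedMeasure_iff hlam.out).1 (Lp.memLp (toGrad a T lam U))
  have hlat : ∀ n, IsLateral (φ n) := fun n => IsLateral.of_tsupport_subset (hφ n) (hφs n) (hφc n)
  have hmφ := fun n => (hlat n).memLp T
  have hmg : ∀ n, MemLp (fun z => √(a z.1) * dx (φ n) z) 2 (cylMeasure (Ioo 0 1) T) :=
    fun n => memLp_sqrt_mul ha ((hlat n).dx.memLp T)
  have hsum : ∀ (f : ℕ → L2Q T lam) (w : L2Q T lam) (ψ : ℕ → ℝ × ℝ → ℝ),
      (∀ n, f n =ᵐ[weightedMeasure T lam] ψ n) → (∀ n, ‖f n - w‖ ≤ (1 / 2) ^ n) →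
      ∑' n, ∫⁻ z, ‖ψ n z - w z‖ₑ ^ 2 ∂cylMeasure (Ioo 0 1) T ≠ ⊤ := by
    intro f w ψ hf hfw
    have hn : ∀ n, ∫⁻ z, ‖ψ n z - w z‖ₑ ^ 2 ∂cylMeasure (Ioo 0 1) T ≤
        ENNReal.ofReal (Real.exp (lam * T)) ^ 2 * (1 / 4) ^ n := by
      intro n
      have e1 : eLpNorm (fun z => ψ n z - w z) 2 (weightedMeasure T lam) =
          ENNReal.ofReal ‖f n - w‖ := by
        rw [Lp.norm_def, ENNReal.ofReal_toReal (Lp.eLpNorm_ne_top _)]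
        refine eLpNorm_congr_ae ?_
        filter_upwards [hf n, Lp.coeFn_sub (f n) w] with z e1 e2
        rw [e2, Pi.sub_apply, e1]
      rw [← eLpNorm_two_sq]
      calc _ ≤ (ENNReal.ofReal (Real.exp (lam * T)) * ENNReal.ofReal ((1 / 2) ^ n)) ^ 2 := by
            gcongr
            refine (eLpNorm_two_cylMeasure_le hlam.out _).trans ?_
            rw [e1]
            gcongr
            exact hfw n
        _ = _ := by
            rw [mul_pow, ← ENNReal.ofReal_pow (p := (1 / 2) ^ n) (by positivity), ← pow_mul, mul_comm n 2, pow_mul,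
              show ((1 : ℝ) / 2) ^ 2 = 1 / 4 by norm_num, ENNReal.ofReal_pow (by norm_num)]
            congr 2
            rw [ENNReal.ofReal_div_of_pos (by norm_num)]
            simp
    refine ne_top_of_le_ne_top ?_ (ENNReal.tsum_le_tsum hn)
    rw [ENNReal.tsum_mul_left, ENNReal.tsum_geometric]
    refine ENNReal.mul_ne_top (by simp) ?_
    rw [ENNReal.inv_ne_top]
    exact (tsub_pos_of_lt (by rw [one_div]; exact ENNReal.inv_lt_one.2 (by norm_num))).ne'
  have hsplit : ∀ n, ‖(p n).fst - toFn a T lam U‖ ≤ (1 / 2) ^ n ∧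
      ‖(p n).snd - toGrad a T lam U‖ ≤ (1 / 2) ^ n := by
    intro n
    have h1 : ‖p n - U‖ ≤ (1 / 2) ^ n := by
      rw [← dist_eq_norm, dist_comm]; exact (hpd n).le
    have h2 := WithLp.prod_norm_sq_eq_of_L2 (p n - (U : L2Pair T lam))
    refine ⟨le_trans (le_of_sq_le_sq (b := ‖p n - U‖) ?_ (norm_nonneg _)) h1,
      le_trans (le_of_sq_le_sq (b := ‖p n - U‖) ?_ (norm_nonneg _)) h1⟩
    · rw [h2]
      exact le_add_of_nonneg_right (sq_nonneg _)
    · rw [h2]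
      exact le_add_of_nonneg_left (sq_nonneg _)
  have s1 := hsum (fun n => (p n).fst) (toFn a T lam U) φ hφ1 fun n => (hsplit n).1
  have s2 := hsum (fun n => (p n).snd) (toGrad a T lam U) _ hφ2 fun n => (hsplit n).2
  have m1 := fun n => (hmφ n).1.sub hmu.1
  have m2 := fun n => (hmg n).1.sub hmG.1
  have fin : ∀ {w : ℝ × ℝ → ℝ}, MemLp w 2 (cylMeasure (Ioo 0 1) T) →
      ∀ᵐ t ∂volume.restrict (Ioo (0 : ℝ) T),
        MemLp (fun x => w (x, t)) 2 (volume.restrict (Ioo (0 : ℝ) 1)) := by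
    intro w hw
    have hm := hw.1.enorm.pow_const 2
    have h1 : ∫⁻ t in Ioo (0 : ℝ) T, ∫⁻ x in Ioo (0 : ℝ) 1, ‖w (x, t)‖ₑ ^ 2 ≠ ⊤ := by
      rw [← lintegral_cyl_swap hm, ← eLpNorm_two_sq]
      exact ENNReal.pow_ne_top hw.2.ne
    have hm' : AEMeasurable (fun t => ∫⁻ x in Ioo (0 : ℝ) 1, ‖w (x, t)‖ₑ ^ 2)
        (volume.restrict (Ioo (0 : ℝ) T)) := by
      rw [cylMeasure_eq_prod] at hm
      exact hm.prod_swap.lintegral_prod_right'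
    filter_upwards [aestronglyMeasurable_slice hw.1, ae_lt_top' hm' h1] with t e1 e2
    refine ⟨e1, ?_⟩
    rw [← eLpNorm_two_sq] at e2
    exact (ENNReal.pow_lt_top_iff).1 e2 |>.resolve_right (by norm_num)
  filter_upwards [fin hmu, fin hmG, tendsto_slice_of_summable m1 s1, tendsto_slice_of_summable m2 s2,
    ae_snd_of_ae_cyl (tendsto_ae_of_summable m1 s1),
    ae_all_iff.2 fun n => aestronglyMeasurable_slice (hmg n).1] with t e1 e2 e3 e4 e5 e6
  rw [← eLpNorm_two_sq, ← eLpNorm_two_sq]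
  refine lintegral_pow_four_le_of_tendsto (φ := fun n x => φ n (x, t))
    (g := fun n x => √(a x) * dx (φ n) (x, t)) (fun n => ?_) e6 e1 e2 (fun n => ?_) e3 e4 e5
  · exact ((hφ n).continuous.comp (by fun_prop)).aestronglyMeasurable
  · refine (lintegral_pow_four_le (φ' := fun x => dx (φ n) (x, t)) (fun x =>
      hasDerivAt_dx ((hlat n).differentiable _))
      ((hlat n).dx.continuous.comp (by fun_prop)) ?_).trans ?_
    · obtain ⟨-, K, -, hK, hK0⟩ := hlat n
      exact hK0 _ fun h => (hK h).2.false
    · rw [eLpNorm_two_sq, eLpNorm_two_sq]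
      gcongr 8 * (_ * ?_)
      refine setLIntegral_mono_ae' measurableSet_Ioo (Eventually.of_forall fun x hx => ?_)
      rw [enorm_mul, enorm_mul]
      gcongr ((?_ * _) ^ 2)
      rw [Real.enorm_eq_ofReal (Real.sqrt_nonneg _), Real.enorm_eq_ofReal (Real.sqrt_nonneg _)]
      exact ENNReal.ofReal_le_ofReal (Real.sqrt_le_sqrt (hax x hx))

/-- Elements of the energy space with square integrable time derivative are bounded in `L⁴`. -/
theorem exists_eLpNorm_four_le {a : ℝ → ℝ} {T lam : ℝ} [hlam : Fact (0 ≤ lam)] (hT : 0 ≤ T)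
    (ha : ContinuousOn a (Icc 0 1)) (hax : ∀ x ∈ Ioo (0 : ℝ) 1, x ≤ a x) :
    ∃ C, 0 ≤ C ∧ ∀ (U : energySpace a T lam) (q : L2Q T lam) (r : ℝ),
      toFn a T lam U = primitiveL T lam q → ‖q‖ ≤ r → ‖U‖ ≤ r →
      eLpNorm (toFn a T lam U) 4 (weightedMeasure T lam) ≤ ENNReal.ofReal (C * r) := by
  set E := Real.exp (lam * T) with hE
  have hE0 : 0 < E := Real.exp_pos _
  -- The estimate yields `‖u‖₄⁴ ≤ 8 T E⁴ r⁴`. Since `C ≥ 1`, one has `8 T E⁴ ≤ C ≤ C⁴`, which spares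
  -- a fourth root.
  set C : ℝ := 1 + 8 * T * E ^ 4 with hC
  have hC1 : 1 ≤ C := by rw [hC]; have : 0 ≤ 8 * T * E ^ 4 := by positivity
                         linarith
  refine ⟨C, by linarith, fun U q r hU hq hr => ?_⟩
  have hr0 : 0 ≤ r := (norm_nonneg _).trans hr
  have hcyl : ∀ w : L2Q T lam, ‖w‖ ≤ r →
      ∫⁻ z, ‖w z‖ₑ ^ 2 ∂cylMeasure (Ioo 0 1) T ≤ ENNReal.ofReal ((E * r) ^ 2) := by
    intro w hw
    rw [← eLpNorm_two_sq, ENNReal.ofReal_pow (by positivity), ENNReal.ofReal_mul hE0.le]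
    gcongr
    refine (eLpNorm_two_cylMeasure_le hlam.out _).trans ?_
    gcongr
    rw [← ENNReal.ofReal_toReal (Lp.eLpNorm_ne_top w), ← Lp.norm_def]
    exact ENNReal.ofReal_le_ofReal hw
  have hmu := (memLp_weightedMeasure_iff hlam.out).1 (Lp.memLp (toFn a T lam U))
  have hmG := (memLp_weightedMeasure_iff hlam.out).1 (Lp.memLp (toGrad a T lam U))
  have hmq := (memLp_weightedMeasure_iff hlam.out).1 (Lp.memLp q)
  have hup : toFn a T lam U =ᵐ[cylMeasure (Ioo 0 1) T] primitive q := by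
    rw [hU]; exact (ae_weightedMeasure_eq_iff hlam.out).1 (coeFn_primitiveL q)
  rw [← ENNReal.pow_le_pow_left_iff (n := 4) (by norm_num)]
  calc eLpNorm (toFn a T lam U) 4 (weightedMeasure T lam) ^ 4
      ≤ eLpNorm (toFn a T lam U) 4 (cylMeasure (Ioo 0 1) T) ^ 4 := by
        gcongr; exact weightedMeasure_le hlam.out
    _ = ∫⁻ t in Ioo 0 T, ∫⁻ x in Ioo (0 : ℝ) 1, ‖toFn a T lam U (x, t)‖ₑ ^ 4 := by
        rw [eLpNorm_four_pow, lintegral_cyl_swap (hmu.1.enorm.pow_const 4)]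
    _ ≤ ∫⁻ t in Ioo 0 T, (8 * (ENNReal.ofReal T * ENNReal.ofReal ((E * r) ^ 2))) *
          ∫⁻ x in Ioo (0 : ℝ) 1, ‖toGrad a T lam U (x, t)‖ₑ ^ 2 := by
        -- On each slice the `L²` norm of `u` is bounded uniformly in time, because `u` is the
        -- primitive of `q`. What remains is the integral of the gradient norm.
        refine lintegral_mono_ae ?_
        filter_upwards [ae_slice_pow_four_le ha hax U, ae_snd_of_ae_cyl hup,
          ae_restrict_mem measurableSet_Ioo] with t e1 e2 e3
        refine e1.trans ?_
        rw [mul_assoc]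
        gcongr 8 * (?_ * _)
        have e4 : ∫⁻ x in Ioo (0 : ℝ) 1, ‖toFn a T lam U (x, t)‖ₑ ^ 2 =
            ∫⁻ x in Ioo (0 : ℝ) 1, ‖primitive q (x, t)‖ₑ ^ 2 := by
          refine lintegral_congr_ae ?_
          filter_upwards [e2] with x hx
          rw [hx]
        rw [e4]
        refine (lintegral_primitive_sq_le hmq.1 e3).trans ?_
        gcongr
        exact hcyl q hq
    _ = (8 * (ENNReal.ofReal T * ENNReal.ofReal ((E * r) ^ 2))) *
          ∫⁻ z, ‖toGrad a T lam U z‖ₑ ^ 2 ∂cylMeasure (Ioo 0 1) T := by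
        rw [lintegral_const_mul' _ _ (by finiteness), lintegral_cyl_swap (hmG.1.enorm.pow_const 2)]
    _ ≤ (8 * (ENNReal.ofReal T * ENNReal.ofReal ((E * r) ^ 2))) * ENNReal.ofReal ((E * r) ^ 2) := by
        gcongr
        exact hcyl _ ((norm_toGrad_le U).trans hr)
    _ = ENNReal.ofReal ((8 * T * E ^ 4) * r ^ 4) := by
        rw [show (8 : ℝ≥0∞) = ENNReal.ofReal 8 by simp, ← ENNReal.ofReal_mul hT,
          ← ENNReal.ofReal_mul (by norm_num), ← ENNReal.ofReal_mul (by positivity)]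
        congr 1
        ring
    _ ≤ ENNReal.ofReal (C * r) ^ 4 := by
        rw [← ENNReal.ofReal_pow (by positivity), mul_pow]
        gcongr
        calc 8 * T * E ^ 4 ≤ C := by rw [hC]; linarith
          _ ≤ C ^ 4 := le_self_pow₀ hC1 (by norm_num)

end Ladyzhenskaya

/-! ### Abstract linear parabolic equations: maximal regularity and initial data. -/

section LinearEvolution

open scoped InnerProductSpace
open ContinuousLinearMap (adjoint)

variable {H V : Type*} [NormedAddCommGroup H] [InnerProductSpace ℝ H]
  [NormedAddCommGroup V] [InnerProductSpace ℝ V]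

/-- The weak form of the linear equation, integrated in time. -/
def weakForm (ι γ : V →L[ℝ] H) (I b B : H →L[ℝ] H) (u₀ f : H) (U Ψ : V) : ℝ :=
  ⟪ι U - u₀ - I (f + B (γ U)), ι Ψ⟫_ℝ + ⟪I (b (γ U)), γ Ψ⟫_ℝ

theorem weakForm_sub (ι γ : V →L[ℝ] H) (I b B : H →L[ℝ] H) (u₀ u₀' f f' : H) (U U' Ψ : V) :
    weakForm ι γ I b B (u₀ - u₀') (f - f') (U - U') Ψ =
      weakForm ι γ I b B u₀ f U Ψ - weakForm ι γ I b B u₀' f' U' Ψ := by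
  simp only [weakForm, map_add, map_sub, inner_add_left, inner_sub_left]
  ring

variable [CompleteSpace H]

/-- The abstract setting of a linear parabolic equation: `ι` and `γ` are the function and the
gradient of an element of the energy space `V`, `I` is the primitive in time, `b` the diffusion
coefficient, and `IV`, `JV`, `bV` are the operators induced on `V` by `I`, `I†` and `b`. -/
structure IsEvolution (ι γ : V →L[ℝ] H) (I b : H →L[ℝ] H) (IV JV bV : V →L[ℝ] V)
    (lam b₀ b₁ : ℝ) : Prop where
  inner_eq : ∀ U W, ⟪U, W⟫_ℝ = ⟪ι U, ι W⟫_ℝ + ⟪γ U, γ W⟫_ℝ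
  fn_I : ∀ U, ι (IV U) = I (ι U)
  grad_I : ∀ U, γ (IV U) = I (γ U)
  fn_J : ∀ U, ι (JV U) = adjoint I (ι U)
  grad_J : ∀ U, γ (JV U) = adjoint I (γ U)
  fn_b : ∀ U, ι (bV U) = b (ι U)
  grad_b : ∀ U, γ (bV U) = b (γ U)
  lam_pos : 0 < lam
  accretive : ∀ f, lam * ‖I f‖ ^ 2 ≤ ⟪I f, f⟫_ℝ
  injective : ∀ f, I f = 0 → f = 0
  symm : ∀ f g, ⟪b f, g⟫_ℝ = ⟪f, b g⟫_ℝ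
  b₀_pos : 0 < b₀
  b₁_nonneg : 0 ≤ b₁
  coercive : ∀ f, b₀ * ‖f‖ ^ 2 ≤ ⟪b f, f⟫_ℝ
  bounded : ∀ f, ‖b f‖ ≤ b₁ * ‖f‖

namespace IsEvolution

variable {ι γ : V →L[ℝ] H} {I b B : H →L[ℝ] H} {IV JV bV : V →L[ℝ] V} {lam b₀ b₁ β : ℝ}

theorem I_nonneg (h : IsEvolution ι γ I b IV JV bV lam b₀ b₁) (f : H) : 0 ≤ ⟪I f, f⟫_ℝ :=
  (mul_nonneg h.lam_pos.le (sq_nonneg _)).trans (h.accretive f)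

theorem eq_zero_of_b (h : IsEvolution ι γ I b IV JV bV lam b₀ b₁) {f : H} (hf : b f = 0) :
    f = 0 := by
  have h1 := h.coercive f
  rw [hf, inner_zero_left] at h1
  have h2 : ‖f‖ ^ 2 ≤ 0 := by
    by_contra! h3
    exact absurd h1 (not_le.2 (mul_pos h.b₀_pos h3))
  simpa using le_antisymm h2 (sq_nonneg _)

theorem norm_sq_eq (h : IsEvolution ι γ I b IV JV bV lam b₀ b₁) (U : V) :
    ‖U‖ ^ 2 = ‖ι U‖ ^ 2 + ‖γ U‖ ^ 2 := by
  rw [← real_inner_self_eq_norm_sq, h.inner_eq, real_inner_self_eq_norm_sq,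
    real_inner_self_eq_norm_sq]

theorem eq_zero_of_components (h : IsEvolution ι γ I b IV JV bV lam b₀ b₁) {U : V}
    (h1 : ι U = 0) (h2 : γ U = 0) : U = 0 := by
  have := h.norm_sq_eq U
  rw [h1, h2] at this
  simpa using this

theorem adjoint_IV (h : IsEvolution ι γ I b IV JV bV lam b₀ b₁) (U W : V) :
    ⟪IV U, W⟫_ℝ = ⟪U, JV W⟫_ℝ := by
  rw [h.inner_eq, h.inner_eq, h.fn_I, h.grad_I, h.fn_J, h.grad_J,
    ContinuousLinearMap.adjoint_inner_right, ContinuousLinearMap.adjoint_inner_right]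

theorem bV_symm (h : IsEvolution ι γ I b IV JV bV lam b₀ b₁) (U W : V) :
    ⟪bV U, W⟫_ℝ = ⟪U, bV W⟫_ℝ := by
  rw [h.inner_eq, h.inner_eq, h.fn_b, h.grad_b, h.fn_b, h.grad_b, h.symm, h.symm]

theorem bV_coercive (h : IsEvolution ι γ I b IV JV bV lam b₀ b₁) (U : V) :
    b₀ * ‖U‖ ^ 2 ≤ ⟪bV U, U⟫_ℝ := by
  rw [h.inner_eq, h.fn_b, h.grad_b, h.norm_sq_eq]
  linarith [h.coercive (ι U), h.coercive (γ U)]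

theorem IV_nonneg (h : IsEvolution ι γ I b IV JV bV lam b₀ b₁) (U : V) : 0 ≤ ⟪IV U, U⟫_ℝ := by
  rw [h.inner_eq, h.fn_I, h.grad_I]
  exact add_nonneg (h.I_nonneg _) (h.I_nonneg _)

/-- Completing the diffusion term to the full inner product of `V` adds `I (b (ι U))`, which is
compensated in the lower order part. The principal part is then coercive on all of `V`. -/
theorem weakForm_eq (h : IsEvolution ι γ I b IV JV bV lam b₀ b₁) (u₀ f : H) (U Ψ : V) :
    weakForm ι γ I b B u₀ f U Ψ = ⟪ι U, ι Ψ⟫_ℝ + ⟪IV (bV U), Ψ⟫_ℝ - ⟪u₀, ι Ψ⟫_ℝ -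
      ⟪I (f + (B (γ U) + b (ι U))), ι Ψ⟫_ℝ := by
  rw [h.inner_eq (IV (bV U)), h.fn_I, h.grad_I, h.fn_b, h.grad_b]
  simp only [weakForm, map_add, inner_add_left, inner_sub_left]
  ring

/-- The test function `bV X` is admissible because `b` acts on `V`. It makes both terms nonnegative,
so `ι X = 0`; the remaining identity says `IV (bV X) = 0`, and injectivity of `I` removes `γ X`. -/
theorem eq_zero_of_homogeneous (h : IsEvolution ι γ I b IV JV bV lam b₀ b₁) {X : V}
    (hX : ∀ Ψ, ⟪ι X, ι Ψ⟫_ℝ + ⟪IV (bV X), Ψ⟫_ℝ = 0) : X = 0 := by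
  have h1 := hX (bV X)
  rw [h.fn_b, real_inner_comm] at h1
  have h2 := h.IV_nonneg (bV X)
  have h3 := h.coercive (ι X)
  have h4 : ‖ι X‖ ^ 2 ≤ 0 := by
    by_contra! h5
    have := mul_pos h.b₀_pos h5
    linarith
  have h5 : ι X = 0 := by simpa using le_antisymm h4 (sq_nonneg _)
  refine h.eq_zero_of_components h5 (h.eq_zero_of_b (h.injective _ ?_))
  rw [← h.grad_b, ← h.grad_I]
  have h6 : IV (bV X) = 0 := by
    have := hX (IV (bV X))
    rw [h5, inner_zero_left, zero_add] at this
    exact inner_self_eq_zero.1 this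
  rw [h6, map_zero]

variable [CompleteSpace V]

theorem adjoint_IV_eq (h : IsEvolution ι γ I b IV JV bV lam b₀ b₁) (W : V) :
    adjoint IV W = JV W :=
  ext_inner_left ℝ fun U => by
    rw [ContinuousLinearMap.adjoint_inner_right, h.adjoint_IV]

/-- Commutation of `b` with the spatial operator `ι†`. In the concrete setting this expresses that
`b` depends on time alone, and it is essential for maximal regularity. -/
theorem adjoint_fn_b (h : IsEvolution ι γ I b IV JV bV lam b₀ b₁) (f : H) :
    adjoint ι (b f) = bV (adjoint ι f) :=
  ext_inner_right ℝ fun U => by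
    rw [ContinuousLinearMap.adjoint_inner_left, h.symm, ← h.fn_b, h.bV_symm,
      ContinuousLinearMap.adjoint_inner_left]

theorem adjoint_fn_I (h : IsEvolution ι γ I b IV JV bV lam b₀ b₁) (f : H) :
    adjoint ι (I f) = IV (adjoint ι f) :=
  ext_inner_right ℝ fun U => by
    rw [ContinuousLinearMap.adjoint_inner_left, h.adjoint_IV, ContinuousLinearMap.adjoint_inner_left,
      h.fn_J, ContinuousLinearMap.adjoint_inner_right]

/-- Solvability of the equation without lower order terms. -/
theorem exists_principal_solver (h : IsEvolution ι γ I b IV JV bV lam b₀ b₁) :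
    ∃ W : H →L[ℝ] H, (∀ f, ι (adjoint ι (W f)) + I (b (W f)) = I f) ∧
      ∀ f, ‖W f‖ ≤ b₀⁻¹ * ‖f‖ := by
  -- The operator `ι ι†` plays the role of the inverse of `w ↦ w - (a w_x)_x`. Seeking `U = ι† w`
  -- with `w` in `H`, rather than `U` in `V`, gives `L²` control of the diffusion term.
  refine exists_evolution_solver (ι ∘L adjoint ι) I b h.b₀_pos (fun u v => ?_) h.symm
    (fun g => ?_) h.coercive fun u hu => ?_
  · simp only [ContinuousLinearMap.comp_apply]
    rw [← ContinuousLinearMap.adjoint_inner_right, ContinuousLinearMap.adjoint_inner_left]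
  · simp only [ContinuousLinearMap.comp_apply]
    rw [ContinuousLinearMap.adjoint_inner_right, ← h.fn_I, ← ContinuousLinearMap.adjoint_inner_right]
    exact h.IV_nonneg _
  · simp only [ContinuousLinearMap.comp_apply] at hu
    have h1 : ⟪ι (adjoint ι u), b u⟫_ℝ + ⟪I (b u), b u⟫_ℝ = 0 := by
      rw [← inner_add_left, hu, inner_zero_left]
    rw [← ContinuousLinearMap.adjoint_inner_right, h.adjoint_fn_b, real_inner_comm] at h1
    have h2 := h.bV_coercive (adjoint ι u)
    have h3 := h.I_nonneg (b u)
    have h4 : ‖adjoint ι u‖ ^ 2 ≤ 0 := by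
      by_contra! h5
      have := mul_pos h.b₀_pos h5
      linarith
    have h5 : adjoint ι u = 0 := by simpa using le_antisymm h4 (sq_nonneg _)
    rw [h5, map_zero, zero_add] at hu
    exact h.eq_zero_of_b (h.injective _ hu)

/-- The same duality argument one level lower, with `N = ι† ι` on `V`. The right-hand side `IV F`
also carries a gradient part, as needed to remove an initial datum that is only in `V`. -/
theorem exists_energy_solver (h : IsEvolution ι γ I b IV JV bV lam b₀ b₁) (F : V) :
    ∃ p : V, ∀ Ψ, ⟪ι p, ι Ψ⟫_ℝ + ⟪IV (bV p), Ψ⟫_ℝ = ⟪IV F, Ψ⟫_ℝ := by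
  have hsym : ∀ u v, ⟪(adjoint ι ∘L ι) u, v⟫_ℝ = ⟪u, (adjoint ι ∘L ι) v⟫_ℝ := fun u v => by
    simp only [ContinuousLinearMap.comp_apply]
    rw [ContinuousLinearMap.adjoint_inner_left, ContinuousLinearMap.adjoint_inner_right]
  have hpos : ∀ g, 0 ≤ ⟪(adjoint ι ∘L ι) g, adjoint IV g⟫_ℝ := fun g => by
    simp only [ContinuousLinearMap.comp_apply]
    rw [ContinuousLinearMap.adjoint_inner_left, h.adjoint_IV_eq, h.fn_J,
      ContinuousLinearMap.adjoint_inner_right]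
    exact h.I_nonneg _
  have hinj : ∀ u, (adjoint ι ∘L ι) u + IV (bV u) = 0 → u = 0 := fun u hu => by
    refine h.eq_zero_of_homogeneous fun Ψ => ?_
    rw [← ContinuousLinearMap.adjoint_inner_left, ← inner_add_left]
    have : adjoint ι (ι u) + IV (bV u) = 0 := hu
    rw [this, inner_zero_left]
  obtain ⟨W, hW, -⟩ := exists_evolution_solver (adjoint ι ∘L ι) IV bV h.b₀_pos hsym
    h.bV_symm hpos h.bV_coercive hinj
  refine ⟨W F, fun Ψ => ?_⟩
  rw [← hW F, inner_add_left, ContinuousLinearMap.comp_apply,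
    ContinuousLinearMap.adjoint_inner_left]

/-- The solution operator of the linear equation with vanishing initial data. -/
theorem exists_weak_solver (h : IsEvolution ι γ I b IV JV bV lam b₀ b₁) (hβ : 0 ≤ β)
    (hB : ∀ f, ‖B f‖ ≤ β * ‖f‖)
    (hlam : 4 * (β + b₁) ^ 2 * ((1 + b₁ / b₀) / b₀) ≤ lam) :
    ∃ S : H →L[ℝ] V, (∀ U f, (∀ Ψ, weakForm ι γ I b B 0 f U Ψ = 0) ↔ U = S f) ∧
      (∀ f, lam * ‖S f‖ ^ 2 ≤ 4 * ((1 + b₁ / b₀) / b₀) * ‖f‖ ^ 2) ∧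
      ∀ f, ∃ q, ι (S f) = I q ∧ ‖q‖ ≤ 2 * (1 + b₁ / b₀) * ‖f‖ := by
  obtain ⟨W, hW, hWn⟩ := h.exists_principal_solver
  have hb₀ := h.b₀_pos
  have hb₁ := h.b₁_nonneg
  have hlam0 := h.lam_pos
  set c := 1 + b₁ / b₀ with hc
  have hc0 : 0 < c := by positivity
  set S₀ : H →L[ℝ] V := adjoint ι ∘L W with hS₀
  -- The lower order terms, including the compensation from `weakForm_eq`.
  set D : V →L[ℝ] H := B ∘L γ + b ∘L ι with hD
  have hDa : ∀ U, D U = B (γ U) + b (ι U) := fun U => rfl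
  -- Maximal regularity: the time derivative of the solution is `f - b (W f)`, an element of `H`.
  have hS₀I : ∀ f, ι (S₀ f) = I (f - b (W f)) := fun f => by
    rw [map_sub, ← hW f]
    simp [hS₀]
  have hqn : ∀ f, ‖f - b (W f)‖ ≤ c * ‖f‖ := fun f => by
    calc _ ≤ ‖f‖ + ‖b (W f)‖ := norm_sub_le _ _
      _ ≤ ‖f‖ + b₁ * (b₀⁻¹ * ‖f‖) := by
          gcongr
          exact (h.bounded _).trans (by gcongr; exact hWn f)
      _ = _ := by rw [hc]; field_simp
  have hIn : ∀ f, lam * ‖I f‖ ≤ ‖f‖ := fun f => by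
    rcases (norm_nonneg (I f)).eq_or_lt with h0 | h0
    · rw [← h0]; simp
    · have := (h.accretive f).trans (real_inner_le_norm _ _)
      nlinarith
  -- As `S₀ f = ι† (W f)`, its squared norm is `⟪I (f - b (W f)), W f⟫`, and `I` gains a factor
  -- `1/λ`.
  have hS₀n : ∀ f, lam * ‖S₀ f‖ ^ 2 ≤ c / b₀ * ‖f‖ ^ 2 := fun f => by
    have e1 : ‖S₀ f‖ ^ 2 = ⟪I (f - b (W f)), W f⟫_ℝ := by
      rw [← hS₀I, ← ContinuousLinearMap.adjoint_inner_right, ← real_inner_self_eq_norm_sq]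
      rfl
    calc lam * ‖S₀ f‖ ^ 2 ≤ lam * (‖I (f - b (W f))‖ * ‖W f‖) := by
          rw [e1]; gcongr; exact real_inner_le_norm _ _
      _ = (lam * ‖I (f - b (W f))‖) * ‖W f‖ := by ring
      _ ≤ (c * ‖f‖) * (b₀⁻¹ * ‖f‖) := by
          exact mul_le_mul ((hIn _).trans (hqn f)) (hWn f) (norm_nonneg _) (by positivity)
      _ = _ := by field_simp
  have hιn : ∀ U, ‖ι U‖ ≤ ‖U‖ := fun U =>
    le_of_sq_le_sq (by rw [h.norm_sq_eq U]; nlinarith [sq_nonneg ‖γ U‖]) (norm_nonneg _)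
  have hγn : ∀ U, ‖γ U‖ ≤ ‖U‖ := fun U =>
    le_of_sq_le_sq (by rw [h.norm_sq_eq U]; nlinarith [sq_nonneg ‖ι U‖]) (norm_nonneg _)
  have hDn : ∀ U, ‖D U‖ ≤ (β + b₁) * ‖U‖ := fun U => by
    rw [hDa]
    calc _ ≤ ‖B (γ U)‖ + ‖b (ι U)‖ := norm_add_le _ _
      _ ≤ β * ‖U‖ + b₁ * ‖U‖ := by
          gcongr
          · exact (hB _).trans (by gcongr; exact hγn U)
          · exact (h.bounded _).trans (by gcongr; exact hιn U)
      _ = _ := by ring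
  have hDS : ‖D ∘L S₀‖ ≤ 1 / 2 := by
    refine ContinuousLinearMap.opNorm_le_bound _ (by norm_num) fun f => ?_
    refine le_of_sq_le_sq ?_ (by positivity)
    have e1 := hDn (S₀ f)
    have e2 := hS₀n f
    have e3 : ‖D (S₀ f)‖ ^ 2 ≤ (β + b₁) ^ 2 * ‖S₀ f‖ ^ 2 := by
      rw [← mul_pow]; gcongr
    have e4 : lam * ‖D (S₀ f)‖ ^ 2 ≤ lam * (1 / 2 * ‖f‖) ^ 2 := by
      calc lam * ‖D (S₀ f)‖ ^ 2 ≤ (β + b₁) ^ 2 * (lam * ‖S₀ f‖ ^ 2) := by nlinarith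
        _ ≤ (β + b₁) ^ 2 * (c / b₀ * ‖f‖ ^ 2) := by gcongr
        _ = 1 / 4 * (4 * (β + b₁) ^ 2 * (c / b₀)) * ‖f‖ ^ 2 := by ring
        _ ≤ 1 / 4 * lam * ‖f‖ ^ 2 := by gcongr
        _ = _ := by ring
    exact le_of_mul_le_mul_left e4 hlam0
  have hlt : ‖D ∘L S₀‖ < 1 := by linarith
  -- The Neumann inverse of `1 - D S₀`. The full solution operator is `S₀ R`, since the equation
  -- reads `U = S₀ (f + D U)`.
  obtain ⟨R, hR1, hR2⟩ : ∃ R : H →L[ℝ] H, (∀ f, R f - D (S₀ (R f)) = f) ∧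
      ∀ f, R (f - D (S₀ f)) = f := by
    let u := Units.oneSub (D ∘L S₀) hlt
    refine ⟨(u⁻¹ : (H →L[ℝ] H)ˣ), fun f => ?_, fun f => ?_⟩
    · have := u.mul_inv
      exact congrArg (fun A : H →L[ℝ] H => A f) this
    · have := u.inv_mul
      exact congrArg (fun A : H →L[ℝ] H => A f) this
  have hRn : ∀ f, ‖R f‖ ≤ 2 * ‖f‖ := fun f => by
    have e1 : ‖D (S₀ (R f))‖ ≤ 1 / 2 * ‖R f‖ := (D ∘L S₀).le_of_opNorm_le hDS (R f)
    have e2 : ‖R f‖ ≤ ‖f‖ + ‖D (S₀ (R f))‖ := by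
      calc ‖R f‖ = ‖f + D (S₀ (R f))‖ := by
            congr 1
            rw [← sub_eq_iff_eq_add]; exact hR1 f
        _ ≤ _ := norm_add_le _ _
    linarith
  have hS₀w : ∀ f Ψ, ⟪ι (S₀ f), ι Ψ⟫_ℝ + ⟪IV (bV (S₀ f)), Ψ⟫_ℝ = ⟪I f, ι Ψ⟫_ℝ := fun f Ψ => by
    have e1 : IV (bV (S₀ f)) = adjoint ι (I (b (W f))) := by
      rw [h.adjoint_fn_I, h.adjoint_fn_b]; rfl
    rw [e1, ContinuousLinearMap.adjoint_inner_left, ← inner_add_left, ← hW f]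
    rfl
  refine ⟨S₀ ∘L R, fun U f => ⟨fun hU => ?_, fun hU Ψ => ?_⟩, fun f => ?_, fun f => ?_⟩
  · have e1 : U = S₀ (f + D U) := by
      rw [← sub_eq_zero]
      refine h.eq_zero_of_homogeneous fun Ψ => ?_
      have e2 := hU Ψ
      rw [h.weakForm_eq, ← hDa] at e2
      have e3 := hS₀w (f + D U) Ψ
      simp only [map_sub, inner_sub_left]
      simp only [inner_zero_left] at e2
      linarith
    have e2 : f + D U - D (S₀ (f + D U)) = f := by rw [← e1]; abel
    have e3 := hR2 (f + D U)
    rw [e2] at e3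
    rw [ContinuousLinearMap.comp_apply, e3, ← e1]
  · rw [h.weakForm_eq, ← hDa, hU, ContinuousLinearMap.comp_apply, hS₀w, ← hR1 f]
    have e1 : R (R f - D (S₀ (R f))) = R f := by rw [hR1]
    rw [e1]
    simp
  · calc lam * ‖S₀ (R f)‖ ^ 2 ≤ c / b₀ * ‖R f‖ ^ 2 := hS₀n _
      _ ≤ c / b₀ * (2 * ‖f‖) ^ 2 := by gcongr; exact hRn f
      _ = _ := by ring
  · refine ⟨R f - b (W (R f)), hS₀I (R f), (hqn _).trans ?_⟩
    calc c * ‖R f‖ ≤ c * (2 * ‖f‖) := by gcongr; exact hRn f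
      _ = _ := by ring

/-- The solutions with the initial datum of an element of the energy space. -/
theorem exists_initial_solution (h : IsEvolution ι γ I b IV JV bV lam b₀ b₁) {S : H →L[ℝ] V}
    (hS : ∀ U f, (∀ Ψ, weakForm ι γ I b B 0 f U Ψ = 0) ↔ U = S f) (Ũ : V) :
    ∃ U₀, ∀ U f, (∀ Ψ, weakForm ι γ I b B (ι Ũ) f U Ψ = 0) ↔ U = U₀ + S f := by
  -- Adding `p` to the extension `Ũ` of the initial datum cancels the principal part. The leftover
  -- lower order source `d` lies in `H` and is corrected by `S d`.
  obtain ⟨p, hp⟩ := h.exists_energy_solver (-bV Ũ)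
  set Q := Ũ + p with hQ
  set d := B (γ Q) + b (ι Q) with hd
  have hQw : ∀ Ψ, weakForm ι γ I b B (ι Ũ) (-d) Q Ψ = 0 := fun Ψ => by
    have e1 := hp Ψ
    rw [h.weakForm_eq, ← hd, neg_add_cancel, map_zero, inner_zero_left, hQ]
    simp only [map_add, map_neg, inner_add_left, inner_neg_left] at e1 ⊢
    linarith
  refine ⟨Q + S d, fun U f => ?_⟩
  have e1 : (∀ Ψ, weakForm ι γ I b B (ι Ũ) f U Ψ = 0) ↔
      ∀ Ψ, weakForm ι γ I b B 0 (f + d) (U - Q) Ψ = 0 := by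
    refine forall_congr' fun Ψ => ?_
    have := weakForm_sub ι γ I b B (ι Ũ) (ι Ũ) f (-d) U Q Ψ
    rw [sub_self, sub_neg_eq_add, hQw, sub_zero] at this
    rw [this]
  rw [e1, hS, sub_eq_iff_eq_add, map_add]
  constructor <;> rintro rfl <;> abel

end IsEvolution

end LinearEvolution

/-! ### Consequences of the hypotheses on the coefficients. -/

section Coefficients

theorem IsDegenerateCoefficient.map_one {a : ℝ → ℝ} (ha : IsDegenerateCoefficient a) : a 1 = 1 := by
  have h1 := ha.mul 1 (by simp) 1 (by simp)
  have h2 := ha.pos 1 (by simp)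
  rw [mul_one] at h1
  nlinarith

/-- The growth condition with `K ≤ 1` makes `a x / x` nonincreasing, and its value at `1` is `1`.
Thus the degeneracy is no worse than linear, which the Ladyzhenskaya inequality requires. -/
theorem IsDegenerateCoefficient.le {a : ℝ → ℝ} (ha : IsDegenerateCoefficient a) {x : ℝ}
    (hx : x ∈ Ioc (0 : ℝ) 1) : x ≤ a x := by
  obtain ⟨K, hK, hgr⟩ := ha.growth
  have hanti : AntitoneOn (fun x => a x / x) (Ioc 0 1) := by
    have hd : ∀ x ∈ Ioo (0 : ℝ) 1, HasDerivAt (fun x => a x / x)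
        ((derivWithin a (Ioc 0 1) x * x - a x * 1) / x ^ 2) x := fun x hx => by
      have h1 := (ha.contDiffOn.differentiableOn (by norm_num) x
        (Ioo_subset_Ioc_self hx)).hasDerivWithinAt.hasDerivAt (Ioc_mem_nhds hx.1 hx.2)
      exact h1.div (hasDerivAt_id x) hx.1.ne'
    refine antitoneOn_of_deriv_nonpos (convex_Ioc 0 1) ?_ ?_ ?_
    · exact (ha.continuousOn.mono Ioc_subset_Icc_self).div continuousOn_id fun x hx => hx.1.ne'
    · rw [interior_Ioc]
      exact fun x hx => (hd x hx).differentiableAt.differentiableWithinAt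
    · rw [interior_Ioc]
      intro x hx
      rw [(hd x hx).deriv]
      refine div_nonpos_of_nonpos_of_nonneg ?_ (sq_nonneg _)
      have h1 := hgr x (Ioo_subset_Ioc_self hx)
      have h2 := ha.pos x (Ioo_subset_Ioc_self hx)
      nlinarith [hK.2]
  have h1 := hanti hx (right_mem_Ioc.2 one_pos) hx.2
  simp only [ha.map_one, div_one] at h1
  rwa [le_div_iff₀ hx.1, one_mul] at h1

/-- The properties of the coefficients used in the linear theory. -/
structure IsLinearData (a b : ℝ → ℝ) (B : ℝ × ℝ → ℝ) (T b₀ b₁ β : ℝ) : Prop where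
  T_pos : 0 < T
  continuousOn_a : ContinuousOn a (Icc 0 1)
  le_a : ∀ x ∈ Ioo (0 : ℝ) 1, x ≤ a x
  continuousOn_b : ContinuousOn b (Icc 0 T)
  b₀_pos : 0 < b₀
  le_b : ∀ t ∈ Icc 0 T, b₀ ≤ b t
  b_le : ∀ t ∈ Icc 0 T, b t ≤ b₁
  β_nonneg : 0 ≤ β
  continuousOn_B : ContinuousOn B (cylinder T)
  B_le : ∀ z ∈ cylinder T, ‖B z‖ ≤ β

theorem Data.Admissible.exists_isLinearData {P : Data} (hP : P.Admissible) :
    ∃ b₀ b₁ β, IsLinearData P.a P.b P.B P.T b₀ b₁ β := by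
  have hT := hP.T_pos
  have ha := hP.a_degenerate
  have hℓ := hP.ℓ_moving
  have hℓc : ContinuousOn P.ℓ (Icc 0 P.T) := hℓ.contDiffOn.continuousOn
  have hne : (Icc 0 P.T).Nonempty := nonempty_Icc.2 hT.le
  obtain ⟨M, hM⟩ := isCompact_Icc.exists_bound_of_continuousOn hℓc
  have hM1 : 0 < max 1 M := lt_max_of_lt_left one_pos
  -- Where `ℓ t > 1`, nothing is assumed on the regularity of `a`. Scaling by a small fixed `x₀`
  -- expresses `a (ℓ t)` through values of `a` on `(0,1]`, which gives continuity and positivity of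
  -- `b`.
  set x₀ := (max 1 M)⁻¹ with hx₀
  have hx0 : x₀ ∈ Ioc (0 : ℝ) 1 := ⟨inv_pos.2 hM1, inv_le_one_of_one_le₀ (le_max_left _ _)⟩
  have hmem : ∀ t ∈ Icc 0 P.T, P.ℓ t * x₀ ∈ Ioc (0 : ℝ) 1 := fun t ht => by
    refine ⟨mul_pos (hℓ.pos t ht) hx0.1, ?_⟩
    rw [hx₀, ← div_eq_mul_inv, div_le_one hM1]
    exact (le_abs_self _).trans ((hM t ht).trans (le_max_right _ _))
  have hx0p := ha.pos x₀ hx0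
  have haℓ : ∀ t ∈ Icc 0 P.T, P.a (P.ℓ t) = P.a (P.ℓ t * x₀) / P.a x₀ := fun t ht => by
    rw [hℓ.scaling t ht x₀ (Ioc_subset_Icc_self hx0), mul_div_cancel_right₀ _ hx0p.ne']
  have hbc : ContinuousOn P.b (Icc 0 P.T) := by
    have h1 : ContinuousOn (fun t => P.a (P.ℓ t * x₀) / P.a x₀ / P.ℓ t ^ 2) (Icc 0 P.T) := by
      refine ContinuousOn.div (ContinuousOn.div_const ?_ _) (hℓc.pow 2)
        fun t ht => (pow_pos (hℓ.pos t ht) 2).ne'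
      exact ha.continuousOn.comp (hℓc.mul continuousOn_const)
        fun t ht => Ioc_subset_Icc_self (hmem t ht)
    refine h1.congr fun t ht => ?_
    rw [Data.b, haℓ t ht]
  have hbp : ∀ t ∈ Icc 0 P.T, 0 < P.b t := fun t ht => by
    rw [Data.b, haℓ t ht]
    exact div_pos (div_pos (ha.pos _ (hmem t ht)) hx0p) (pow_pos (hℓ.pos t ht) 2)
  obtain ⟨t₀, ht₀, hmin⟩ := isCompact_Icc.exists_isMinOn hne hbc
  obtain ⟨t₁, ht₁, hmax⟩ := isCompact_Icc.exists_isMaxOn hne hbc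
  have hdc : ContinuousOn (derivWithin P.ℓ (Icc 0 P.T)) (Icc 0 P.T) :=
    hℓ.contDiffOn.continuousOn_derivWithin (uniqueDiffOn_Icc hT) (by norm_num)
  have hde : ∀ t ∈ Ioo 0 P.T, deriv P.ℓ t = derivWithin P.ℓ (Icc 0 P.T) t := fun t ht =>
    (derivWithin_of_mem_nhds (Icc_mem_nhds ht.1 ht.2)).symm
  obtain ⟨β, hβ⟩ := isCompact_Icc.exists_bound_of_continuousOn (hdc.div hℓc
    fun t ht => (hℓ.pos t ht).ne')
  have hβ0 : 0 ≤ β := (norm_nonneg _).trans (hβ 0 (left_mem_Icc.2 hT.le))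
  have hap : ∀ x ∈ Ioo (0 : ℝ) 1, 0 < P.a x := fun x hx => ha.pos x (Ioo_subset_Ioc_self hx)
  refine ⟨P.b t₀, P.b t₁, β, hT, ha.continuousOn, fun x hx => ha.le (Ioo_subset_Ioc_self hx), hbc,
    hbp t₀ ht₀, fun t ht => hmin ht, fun t ht => hmax ht, hβ0, ?_, fun z hz => ?_⟩
  · have h1 : ContinuousOn (fun z : ℝ × ℝ => deriv P.ℓ z.2) (cylinder P.T) := by
      refine ContinuousOn.congr (f := fun z : ℝ × ℝ => derivWithin P.ℓ (Icc 0 P.T) z.2)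
        (hdc.comp continuousOn_snd fun z hz => Ioo_subset_Icc_self hz.2) fun z hz => hde _ hz.2
    refine (h1.mul continuousOn_fst).div ((hℓc.comp continuousOn_snd
      fun z hz => Ioo_subset_Icc_self hz.2).mul (ha.continuousOn.comp continuousOn_fst
      fun z hz => Ioo_subset_Icc_self hz.1).sqrt) fun z hz => ?_
    exact (mul_pos (hℓ.pos _ (Ioo_subset_Icc_self hz.2)) (Real.sqrt_pos.2 (hap _ hz.1))).ne'
  · have h1 := hβ z.2 (Ioo_subset_Icc_self hz.2)
    rw [Pi.div_apply, ← hde _ hz.2] at h1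
    -- Because `x² ≤ x ≤ a x`, the singular factor in `B` is bounded.
    have h2 : z.1 / √(P.a z.1) ≤ 1 := by
      rw [div_le_one (Real.sqrt_pos.2 (hap _ hz.1))]
      refine Real.le_sqrt_of_sq_le ((?_ : z.1 ^ 2 ≤ z.1).trans (ha.le (Ioo_subset_Ioc_self hz.1)))
      nlinarith [hz.1.1, hz.1.2]
    have h3 : 0 ≤ z.1 / √(P.a z.1) := div_nonneg hz.1.1.le (Real.sqrt_nonneg _)
    have h4 : P.B z = deriv P.ℓ z.2 / P.ℓ z.2 * (z.1 / √(P.a z.1)) := by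
      rw [Data.B, div_mul_div_comm]
    rw [h4, norm_mul, Real.norm_of_nonneg h3]
    calc _ ≤ β * 1 := by gcongr
      _ = β := mul_one β

end Coefficients

/-! ### From the integrated weak form to integrals against test functions. -/

section WeakForm

open scoped InnerProductSpace
open ContinuousLinearMap (adjoint)

variable {a b : ℝ → ℝ} {B : ℝ × ℝ → ℝ} {T b₀ b₁ β lam : ℝ}

/-- The key substitution `Ψ = -e^{2λt} φ_t`, for which `I† Ψ = e^{2λt} φ`. The factor `e^{2λt}`
cancels the weight of the inner product, so ordinary integrals against `φ_t` and `φ` appear. -/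
theorem backwardPrimitive_dt {φ : ℝ × ℝ → ℝ} (hφ : ContDiff ℝ ∞ φ) (hT : ∀ x, φ (x, T) = 0) :
    backwardPrimitive T lam (fun z => -Real.exp (2 * lam * z.2) * dt φ z) =
      fun z => Real.exp (2 * lam * z.2) * φ z := by
  have h1 : ∀ z : ℝ × ℝ, timePrimitive (fun w => Real.exp (-(2 * lam * w.2)) *
      (-Real.exp (2 * lam * w.2) * dt φ w)) z = φ (z.1, 0) - φ z := fun z => by
    have e1 : (fun s : ℝ => Real.exp (-(2 * lam * s)) * (-Real.exp (2 * lam * s) * dt φ (z.1, s))) =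
        fun s => -dt φ (z.1, s) := by
      ext s
      rw [← mul_assoc, mul_neg, ← Real.exp_add, neg_add_cancel, Real.exp_zero]; ring
    rw [timePrimitive]
    simp only [e1]
    rw [intervalIntegral.integral_neg, intervalIntegral.integral_eq_sub_of_hasDerivAt
      (f := fun s => φ (z.1, s)) (fun s _ => hasDerivAt_dt (hφ.differentiable (by simp) _))
      (((contDiff_dt hφ).continuous.comp (by fun_prop)).intervalIntegrable _ _)]
    simp
  ext z
  rw [backwardPrimitive, h1, h1, hT]
  simp

/-- Every `e^{2λt} φ` with `φ` a test function is in the range of `I†`, so `I f = 0` forces `∫ f φ =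
0` for all `φ`. -/
theorem primitiveL_injective [hlam : Fact (0 ≤ lam)] (f : L2Q T lam)
    (hf : primitiveL T lam f = 0) : f = 0 := by
  have hm := (memLp_weightedMeasure_iff hlam.out).1 (Lp.memLp f)
  have hopen : IsOpen (cylinder T) := isOpen_Ioo.prod isOpen_Ioo
  have key : ∀ᵐ z ∂(volume : Measure (ℝ × ℝ)), z ∈ cylinder T → f z = 0 := by
    refine hopen.ae_eq_zero_of_integral_contDiff_smul_eq_zero ?_ fun φ hφ hc hs => ?_
    · have h1 : IntegrableOn f (cylinder T) volume := hm.integrable (by norm_num)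
      exact h1.locallyIntegrableOn
    · have hlat : IsLateral φ := IsLateral.of_tsupport_subset hφ hc hs
      have hz0 : ∀ z ∉ cylinder T, φ z = 0 := fun z hz =>
        image_eq_zero_of_notMem_tsupport fun h => hz (hs h)
      have hψ : IsLateral fun z => -Real.exp (2 * lam * z.2) * dt φ z :=
        hlat.dt.time_mul (θ := fun t => -Real.exp (2 * lam * t)) (by fun_prop)
      have hψm := (memLp_weightedMeasure_iff (T := T) hlam.out).2 (hψ.memLp T)
      have h1 := adjoint_primitiveL_ae (T := T) (lam := lam) hψ (c := fun _ => 1) (C := 1)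
        aestronglyMeasurable_const (by simp) (u := hψm.toLp) (by simpa using hψm.coeFn_toLp)
      rw [backwardPrimitive_dt hφ fun x => hz0 _ fun h => h.2.2.false] at h1
      have h2 : ⟪f, adjoint (primitiveL T lam) hψm.toLp⟫_ℝ = 0 := by
        rw [ContinuousLinearMap.adjoint_inner_right, hf, inner_zero_left]
      rw [inner_toLp_weightedMeasure] at h2
      rw [← setIntegral_eq_integral_of_forall_compl_eq_zero (s := cylinder T)
        fun z hz => by rw [hz0 z hz, zero_smul]]
      refine Eq.trans (integral_congr_ae ?_) h2
      filter_upwards [(ae_weightedMeasure_eq_iff hlam.out).1 h1] with z hz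
      rw [hz, smul_eq_mul]
      have : Real.exp (-(2 * lam * z.2)) * Real.exp (2 * lam * z.2) = 1 := by
        rw [← Real.exp_add]; simp
      linear_combination (-(f z * φ z)) * this
  refine (Lp.eq_zero_iff_ae_eq_zero).2 ?_
  rw [ae_weightedMeasure_eq_iff hlam.out]
  exact (ae_restrict_iff' hopen.measurableSet).2 key

theorem IsLinearData.memLp_b (h : IsLinearData a b B T b₀ b₁ β) [hlam : Fact (0 ≤ lam)] :
    MemLp (fun z : ℝ × ℝ => b z.2) ⊤ (weightedMeasure T lam) := by
  obtain ⟨C, hC⟩ := isCompact_Icc.exists_bound_of_continuousOn h.continuousOn_b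
  refine memLp_top_weightedMeasure (C := C) ?_ fun z hz => hC _ (Ioo_subset_Icc_self hz.2)
  exact (h.continuousOn_b.comp continuousOn_snd fun z hz =>
    Ioo_subset_Icc_self hz.2 : ContinuousOn (fun z : ℝ × ℝ => b z.2) (cylinder T)
    ).aestronglyMeasurable (measurableSet_Ioo.prod measurableSet_Ioo)

theorem IsLinearData.memLp_B (h : IsLinearData a b B T b₀ b₁ β) [hlam : Fact (0 ≤ lam)] :
    MemLp B ⊤ (weightedMeasure T lam) :=
  memLp_top_weightedMeasure (h.continuousOn_B.aestronglyMeasurable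
    (measurableSet_Ioo.prod measurableSet_Ioo)) h.B_le

theorem ae_weightedMeasure_mem_cylinder [hlam : Fact (0 ≤ lam)] :
    ∀ᵐ z ∂weightedMeasure T lam, z ∈ cylinder T :=
  (ae_weightedMeasure_iff hlam.out).2 (ae_mem_cylinder T)

theorem IsLinearData.b₁_pos (h : IsLinearData a b B T b₀ b₁ β) : 0 < b₁ :=
  h.b₀_pos.trans_le ((h.le_b 0 (left_mem_Icc.2 h.T_pos.le)).trans
    (h.b_le 0 (left_mem_Icc.2 h.T_pos.le)))

theorem IsLinearData.isEvolution (h : IsLinearData a b B T b₀ b₁ β) [hlam : Fact (0 ≤ lam)]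
    (hpos : 0 < lam) :
    IsEvolution (toFn a T lam) (toGrad a T lam) (primitiveL T lam) (mulOp T lam fun z => b z.2)
      (preserves_primitiveL h.continuousOn_a).restrict
      (preserves_adjoint_primitiveL h.continuousOn_a).restrict
      (preserves_mulOp h.continuousOn_b h.memLp_b).restrict lam b₀ b₁ where
  inner_eq := energySpace_inner
  fn_I := Preserves.toFn_restrict _
  grad_I := Preserves.toGrad_restrict _
  fn_J := Preserves.toFn_restrict _
  grad_J := Preserves.toGrad_restrict _
  fn_b := Preserves.toFn_restrict _
  grad_b := Preserves.toGrad_restrict _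
  lam_pos := hpos
  accretive := primitiveL_accretive h.T_pos.le
  injective := primitiveL_injective
  symm := mulOp_symm h.memLp_b
  b₀_pos := h.b₀_pos
  b₁_nonneg := h.b₁_pos.le
  coercive := mulOp_coercive h.memLp_b (by
    filter_upwards [ae_weightedMeasure_mem_cylinder] with z hz
    exact h.le_b _ (Ioo_subset_Icc_self hz.2))
  bounded := norm_mulOp_apply_le h.memLp_b (by
    filter_upwards [ae_weightedMeasure_mem_cylinder] with z hz
    rw [Real.norm_of_nonneg (h.b₀_pos.le.trans (h.le_b _ (Ioo_subset_Icc_self hz.2)))]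
    exact h.b_le _ (Ioo_subset_Icc_self hz.2))

theorem inner_eq_integral_mul [hlam : Fact (0 ≤ lam)] {f g : L2Q T lam} {F G : ℝ × ℝ → ℝ}
    (hf : f =ᵐ[cylMeasure (Ioo 0 1) T] F)
    (hg : g =ᵐ[cylMeasure (Ioo 0 1) T] fun z => Real.exp (2 * lam * z.2) * G z) :
    ⟪f, g⟫_ℝ = ∫ z, F z * G z ∂cylMeasure (Ioo 0 1) T ∧
      Integrable (fun z => F z * G z) (cylMeasure (Ioo 0 1) T) := by
  have hae : (fun z => Real.exp (-(2 * lam * z.2)) * (f z * g z)) =ᵐ[cylMeasure (Ioo 0 1) T]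
      fun z => F z * G z := by
    filter_upwards [hf, hg] with z e1 e2
    rw [e1, e2]
    have : Real.exp (-(2 * lam * z.2)) * Real.exp (2 * lam * z.2) = 1 := by
      rw [← Real.exp_add]; simp
    linear_combination (F z * G z) * this
  refine ⟨by rw [inner_toLp_weightedMeasure]; exact integral_congr_ae hae, Integrable.congr ?_ hae⟩
  have h1 : Integrable (fun z => f z * g z) (cylMeasure (Ioo 0 1) T) :=
    ((memLp_weightedMeasure_iff hlam.out).1 (Lp.memLp f)).integrable_mul
      ((memLp_weightedMeasure_iff hlam.out).1 (Lp.memLp g))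
  refine h1.bdd_mul (c := 1) (by fun_prop) ?_
  filter_upwards [ae_mem_cylinder T] with z hz
  rw [Real.norm_of_nonneg (Real.exp_pos _).le]
  refine Real.exp_le_one_iff.2 ?_
  have := hlam.out
  have := hz.2.1
  simp only [Left.neg_nonpos_iff]
  positivity

theorem dx_eq_zero_of_slice {φ : ℝ × ℝ → ℝ} (hφ : Differentiable ℝ φ) {t : ℝ}
    (ht : ∀ x, φ (x, t) = 0) (x : ℝ) : dx φ (x, t) = 0 := by
  have h1 := hasDerivAt_dx (hφ (x, t))
  simp only [ht] at h1
  exact h1.unique (hasDerivAt_const x 0)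

/-- Integration in time turns a time-independent function into the initial term of the weak
formulation. -/
theorem integral_mul_dt {φ : ℝ × ℝ → ℝ} (hφ : IsLateral φ) (hT : 0 < T)
    (hφT : ∀ x, φ (x, T) = 0) {u : ℝ → ℝ}
    (hi : Integrable (fun z : ℝ × ℝ => u z.1 * -dt φ z) (cylMeasure (Ioo 0 1) T)) :
    ∫ z, u z.1 * -dt φ z ∂cylMeasure (Ioo 0 1) T = ∫ x in Ioo (0 : ℝ) 1, u x * φ (x, 0) := by
  rw [cylMeasure_eq_prod] at hi ⊢
  rw [integral_prod _ hi]
  congr 1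
  ext x
  simp only
  rw [integral_const_mul, integral_neg, ← integral_Ioc_eq_integral_Ioo,
    ← intervalIntegral.integral_of_le hT.le, intervalIntegral.integral_eq_sub_of_hasDerivAt
      (f := fun s => φ (x, s)) (fun s _ => hasDerivAt_dt (hφ.differentiable _))
      ((hφ.dt.continuous.comp (by fun_prop)).intervalIntegrable _ _), hφT]
  simp

/-- The integrated weak form agrees with the distributional weak form. -/
theorem IsLinearData.weakForm_eq_integral (h : IsLinearData a b B T b₀ b₁ β)
    [hlam : Fact (0 ≤ lam)] {φ : ℝ × ℝ → ℝ} (hφ : IsLateral φ) (hφT : ∀ x, φ (x, T) = 0)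
    {u₀ f N : L2Q T lam} {U Ψ : energySpace a T lam} {v : ℝ → ℝ} {y g w n : ℝ × ℝ → ℝ}
    (hu₀ : u₀ =ᵐ[cylMeasure (Ioo 0 1) T] fun z => v z.1) (hf : f =ᵐ[cylMeasure (Ioo 0 1) T] w)
    (hN : N =ᵐ[cylMeasure (Ioo 0 1) T] n)
    (hy : toFn a T lam U =ᵐ[cylMeasure (Ioo 0 1) T] y)
    (hg : toGrad a T lam U =ᵐ[cylMeasure (Ioo 0 1) T] fun z => √(a z.1) * g z)
    (hΨ : toFn a T lam Ψ =ᵐ[cylMeasure (Ioo 0 1) T] fun z => -Real.exp (2 * lam * z.2) * dt φ z)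
    (hΨ' : toGrad a T lam Ψ =ᵐ[cylMeasure (Ioo 0 1) T]
      fun z => √(a z.1) * (-Real.exp (2 * lam * z.2) * dt (dx φ) z)) :
    weakForm (toFn a T lam) (toGrad a T lam) (primitiveL T lam) (mulOp T lam fun z => b z.2)
        (mulOp T lam B) u₀ (f - N) U Ψ =
      (∫ z, (-(y z * dt φ z) + b z.2 * a z.1 * g z * dx φ z - B z * √(a z.1) * g z * φ z +
        n z * φ z) ∂cylMeasure (Ioo 0 1) T) - (∫ z, w z * φ z ∂cylMeasure (Ioo 0 1) T) -
        ∫ x in Ioo (0 : ℝ) 1, v x * φ (x, 0) := by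
  have hψ : IsLateral fun z => -Real.exp (2 * lam * z.2) * dt φ z :=
    hφ.dt.time_mul (θ := fun t => -Real.exp (2 * lam * t)) (by fun_prop)
  have hψ' : IsLateral fun z => -Real.exp (2 * lam * z.2) * dt (dx φ) z :=
    hφ.dx.dt.time_mul (θ := fun t => -Real.exp (2 * lam * t)) (by fun_prop)
  obtain ⟨C, hC⟩ := exists_sqrt_bound h.continuousOn_a
  have hJ : adjoint (primitiveL T lam) (toFn a T lam Ψ) =ᵐ[cylMeasure (Ioo 0 1) T]
      fun z => Real.exp (2 * lam * z.2) * φ z := by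
    have := adjoint_primitiveL_ae (T := T) (lam := lam) hψ (c := fun _ => 1) (C := 1)
      aestronglyMeasurable_const (by simp) (u := toFn a T lam Ψ)
      (by simpa using (ae_weightedMeasure_eq_iff hlam.out).2 hΨ)
    rw [backwardPrimitive_dt hφ.1 hφT] at this
    simpa using (ae_weightedMeasure_eq_iff hlam.out).1 this
  have hJ' : adjoint (primitiveL T lam) (toGrad a T lam Ψ) =ᵐ[cylMeasure (Ioo 0 1) T]
      fun z => Real.exp (2 * lam * z.2) * (√(a z.1) * dx φ z) := by
    have := adjoint_primitiveL_ae (T := T) (lam := lam) hψ' (c := fun x => √(a x))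
      (aestronglyMeasurable_sqrt h.continuousOn_a) (fun x hx => hC x (Ioo_subset_Icc_self hx))
      ((ae_weightedMeasure_eq_iff hlam.out).2 hΨ')
    rw [backwardPrimitive_dt hφ.dx.1 (dx_eq_zero_of_slice hφ.differentiable hφT)] at this
    filter_upwards [(ae_weightedMeasure_eq_iff hlam.out).1 this] with z hz
    rw [hz]; ring
  have hΨ2 : toFn a T lam Ψ =ᵐ[cylMeasure (Ioo 0 1) T]
      fun z => Real.exp (2 * lam * z.2) * -dt φ z := by
    filter_upwards [hΨ] with z hz
    rw [hz]; ring
  have hB := (ae_weightedMeasure_eq_iff hlam.out).1 (coeFn_mulOp h.memLp_B (toGrad a T lam U))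
  have hb := (ae_weightedMeasure_eq_iff hlam.out).1
    (coeFn_mulOp (h.memLp_b (lam := lam)) (toGrad a T lam U))
  obtain ⟨e1, i1⟩ := inner_eq_integral_mul hy hΨ2
  obtain ⟨e2, i2⟩ := inner_eq_integral_mul hu₀ hΨ2
  obtain ⟨e3, i3⟩ := inner_eq_integral_mul hf hJ
  obtain ⟨e7, i7⟩ := inner_eq_integral_mul hN hJ
  obtain ⟨e4, i4⟩ := inner_eq_integral_mul hB hJ
  obtain ⟨e5, i5⟩ := inner_eq_integral_mul hb hJ'
  -- The primitive is moved onto the test function, where `hJ` and `hJ'` evaluate its adjoint.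
  rw [weakForm, inner_sub_left, inner_sub_left, ← ContinuousLinearMap.adjoint_inner_right (primitiveL T lam),
    ← ContinuousLinearMap.adjoint_inner_right (primitiveL T lam), inner_add_left, inner_sub_left,
    e1, e2, e3, e7, e4, e5,
    integral_mul_dt hφ h.T_pos hφT i2]
  have e6 : ∫ z, (-(y z * dt φ z) + b z.2 * a z.1 * g z * dx φ z - B z * √(a z.1) * g z * φ z +
        n z * φ z) ∂cylMeasure (Ioo 0 1) T = ∫ z, (y z * -dt φ z +
          b z.2 * toGrad a T lam U z * (√(a z.1) * dx φ z) - B z * toGrad a T lam U z * φ z +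
          n z * φ z) ∂cylMeasure (Ioo 0 1) T := by
    refine integral_congr_ae ?_
    filter_upwards [hg, ae_mem_cylinder T] with z h1 h2
    have h3 : √(a z.1) * √(a z.1) = a z.1 :=
      Real.mul_self_sqrt (h2.1.1.le.trans (h.le_a _ h2.1))
    rw [h1]
    linear_combination (-(b z.2 * g z * dx φ z)) * h3
  have i15 : Integrable (fun z => y z * -dt φ z +
      b z.2 * toGrad a T lam U z * (√(a z.1) * dx φ z)) (cylMeasure (Ioo 0 1) T) := i1.add i5
  have i154 : Integrable (fun z => y z * -dt φ z +
      b z.2 * toGrad a T lam U z * (√(a z.1) * dx φ z) - B z * toGrad a T lam U z * φ z)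
      (cylMeasure (Ioo 0 1) T) := i15.sub i4
  rw [e6, integral_add i154 i7, integral_sub i15 i4, integral_add i1 i5]
  ring

end WeakForm

/-! ### Correspondence between functions and elements of the energy space. -/

section StateEquation

open scoped InnerProductSpace ENNReal
open ContinuousLinearMap (adjoint)

variable {a b : ℝ → ℝ} {B : ℝ × ℝ → ℝ} {T b₀ b₁ β lam : ℝ}

theorem exists_energySpace_of_tendsto [hlam : Fact (0 ≤ lam)] (ha : ContinuousOn a (Icc 0 1))
    {φ : ℕ → ℝ × ℝ → ℝ} (hφ : ∀ n, IsLateral (φ n)) {y g : ℝ × ℝ → ℝ}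
    (hy : MemLp y 2 (cylMeasure (Ioo 0 1) T))
    (hg : MemLp (fun z => √(a z.1) * g z) 2 (cylMeasure (Ioo 0 1) T))
    (t1 : Tendsto (fun n => eLpNorm (fun z => φ n z - y z) 2 (cylMeasure (Ioo 0 1) T))
      atTop (𝓝 0))
    (t2 : Tendsto (fun n => eLpNorm (fun z => √(a z.1) * (dx (φ n) z - g z)) 2
      (cylMeasure (Ioo 0 1) T)) atTop (𝓝 0)) :
    ∃ U : energySpace a T lam, toFn a T lam U =ᵐ[cylMeasure (Ioo 0 1) T] y ∧
      toGrad a T lam U =ᵐ[cylMeasure (Ioo 0 1) T] fun z => √(a z.1) * g z := by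
  have hy' := (memLp_weightedMeasure_iff hlam.out).2 hy
  have hg' := (memLp_weightedMeasure_iff hlam.out).2 hg
  have m1 := fun n => (memLp_weightedMeasure_iff (T := T) hlam.out).2 ((hφ n).memLp T)
  have m2 := fun n => (memLp_weightedMeasure_iff (T := T) hlam.out).2
    (memLp_sqrt_mul ha ((hφ n).dx.memLp T))
  have s1 : Tendsto (fun n => (m1 n).toLp) atTop (𝓝 hy'.toLp) := by
    rw [Lp.tendsto_Lp_iff_tendsto_eLpNorm']
    refine tendsto_of_tendsto_of_tendsto_of_le_of_le tendsto_const_nhds t1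
      (fun _ => zero_le) fun n => ?_
    refine le_trans (le_of_eq (eLpNorm_congr_ae ?_)) (eLpNorm_weightedMeasure_le hlam.out _ _)
    filter_upwards [(m1 n).coeFn_toLp, hy'.coeFn_toLp] with z e1 e2
    rw [Pi.sub_apply, e1, e2]
  have s2 : Tendsto (fun n => (m2 n).toLp) atTop (𝓝 hg'.toLp) := by
    rw [Lp.tendsto_Lp_iff_tendsto_eLpNorm']
    refine tendsto_of_tendsto_of_tendsto_of_le_of_le tendsto_const_nhds t2
      (fun _ => zero_le) fun n => ?_
    refine le_trans (le_of_eq (eLpNorm_congr_ae ?_)) (eLpNorm_weightedMeasure_le hlam.out _ _)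
    filter_upwards [(m2 n).coeFn_toLp, hg'.coeFn_toLp] with z e1 e2
    rw [Pi.sub_apply, e1, e2, mul_sub]
  have hmem : (WithLp.toLp 2 (hy'.toLp, hg'.toLp) : L2Pair T lam) ∈ energySpace a T lam :=
    (isClosed_energySpace a T lam).mem_of_tendsto
      (tendsto_toLp_pair (p := WithLp.toLp 2 (hy'.toLp, hg'.toLp)) s1 s2)
      (Eventually.of_forall fun n =>
        mem_energySpace_of_isLateral ha (hφ n) (m1 n).coeFn_toLp (m2 n).coeFn_toLp)
  exact ⟨⟨_, hmem⟩, (ae_weightedMeasure_eq_iff hlam.out).1 hy'.coeFn_toLp,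
    (ae_weightedMeasure_eq_iff hlam.out).1 hg'.coeFn_toLp⟩

theorem exists_energySpace_of_isL2H1a [hlam : Fact (0 ≤ lam)] (ha : ContinuousOn a (Icc 0 1))
    {y g : ℝ × ℝ → ℝ} (h : IsL2H1a a T y g) :
    ∃ U : energySpace a T lam, toFn a T lam U =ᵐ[cylMeasure (Ioo 0 1) T] y ∧
      toGrad a T lam U =ᵐ[cylMeasure (Ioo 0 1) T] fun z => √(a z.1) * g z := by
  obtain ⟨hy, hg, φ, hφ, t1, t2⟩ := h
  exact exists_energySpace_of_tendsto ha
    (fun n => IsLateral.of_tsupport_subset (hφ n).1 (hφ n).2.1 (hφ n).2.2) hy hg t1 t2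

theorem exists_energySpace_of_isLateral [hlam : Fact (0 ≤ lam)] (ha : ContinuousOn a (Icc 0 1))
    {φ : ℝ × ℝ → ℝ} (hφ : IsLateral φ) :
    ∃ U : energySpace a T lam, toFn a T lam U =ᵐ[cylMeasure (Ioo 0 1) T] φ ∧
      toGrad a T lam U =ᵐ[cylMeasure (Ioo 0 1) T] fun z => √(a z.1) * dx φ z :=
  exists_energySpace_of_tendsto ha (φ := fun _ => φ) (fun _ => hφ) (hφ.memLp T)
    (memLp_sqrt_mul ha (hφ.dx.memLp T)) (by simp) (by simp)

/-- The spatial derivative is recovered by dividing the weighted gradient by `√a`, which is positive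
inside `(0,1)`. -/
theorem isL2H1a_of_energySpace [hlam : Fact (0 ≤ lam)] (ha : ∀ x ∈ Ioo (0 : ℝ) 1, x ≤ a x)
    (U : energySpace a T lam) {y : ℝ × ℝ → ℝ}
    (hy : toFn a T lam U =ᵐ[cylMeasure (Ioo 0 1) T] y) :
    ∃ g, IsL2H1a a T y g ∧
      toGrad a T lam U =ᵐ[cylMeasure (Ioo 0 1) T] fun z => √(a z.1) * g z := by
  have hg : toGrad a T lam U =ᵐ[cylMeasure (Ioo 0 1) T]
      fun z => √(a z.1) * (toGrad a T lam U z / √(a z.1)) := by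
    filter_upwards [ae_mem_cylinder T] with z hz
    rw [mul_div_cancel₀]
    exact (Real.sqrt_pos.2 (hz.1.1.trans_le (ha _ hz.1))).ne'
  refine ⟨fun z => toGrad a T lam U z / √(a z.1),
    ⟨((memLp_weightedMeasure_iff hlam.out).1 (Lp.memLp _)).ae_eq hy,
      ((memLp_weightedMeasure_iff hlam.out).1 (Lp.memLp _)).ae_eq hg, ?_⟩, hg⟩
  obtain ⟨p, hp, hlim⟩ := mem_closure_iff_seq_limit.1 U.2
  choose φ h1 h2 h3 h4 h5 using hp
  have key : ∀ {f : ℕ → L2Q T lam} {w : L2Q T lam} {F : ℕ → ℝ × ℝ → ℝ},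
      Tendsto f atTop (𝓝 w) → (∀ n, (fun z => f n z - w z) =ᵐ[cylMeasure (Ioo 0 1) T] F n) →
      Tendsto (fun n => eLpNorm (F n) 2 (cylMeasure (Ioo 0 1) T)) atTop (𝓝 0) := by
    intro f w F hf hF
    rw [Lp.tendsto_Lp_iff_tendsto_eLpNorm'] at hf
    have h0 := ENNReal.Tendsto.const_mul (a := ENNReal.ofReal (Real.exp (lam * T))) hf
      (Or.inr ENNReal.ofReal_ne_top)
    rw [mul_zero] at h0
    refine tendsto_of_tendsto_of_tendsto_of_le_of_le tendsto_const_nhds h0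
      (fun _ => zero_le) fun n => ?_
    rw [← eLpNorm_congr_ae (hF n)]
    exact eLpNorm_two_cylMeasure_le hlam.out _
  refine ⟨φ, fun n => ⟨h1 n, h2 n, h3 n⟩,
    key (((WithLp.fstL 2 ℝ (L2Q T lam) (L2Q T lam)).continuous.tendsto _).comp hlim) fun n => ?_,
    key (((WithLp.sndL 2 ℝ (L2Q T lam) (L2Q T lam)).continuous.tendsto _).comp hlim) fun n => ?_⟩
  · filter_upwards [hy, (ae_weightedMeasure_eq_iff hlam.out).1 (h4 n)] with z e1 e2
    exact congrArg₂ (· - ·) e2 e1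
  · filter_upwards [hg, (ae_weightedMeasure_eq_iff hlam.out).1 (h5 n)] with z e1 e2
    rw [mul_sub, ← e1]
    exact congrArg₂ (· - ·) e2 rfl

theorem dx_comp_fst {φ : ℝ → ℝ} (hφ : Differentiable ℝ φ) (z : ℝ × ℝ) :
    dx (fun z => φ z.1) z = deriv φ z.1 := by
  have h1 := hasDerivAt_dx (x := z.1) (t := z.2)
    ((hφ.comp differentiable_fst : Differentiable ℝ fun z : ℝ × ℝ => φ z.1) z)
  exact h1.unique (hφ z.1).hasDerivAt

theorem memLp_comp_fst {f : ℝ → ℝ} (hf : MemLp f 2 (volume.restrict (Ioo 0 1))) :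
    MemLp (fun z : ℝ × ℝ => f z.1) 2 (cylMeasure (Ioo 0 1) T) := by
  rw [cylMeasure_eq_prod]
  exact hf.comp_fst _

theorem tendsto_eLpNorm_comp_fst {f : ℕ → ℝ → ℝ}
    (hf : ∀ n, AEStronglyMeasurable (f n) (volume.restrict (Ioo 0 1)))
    (h : Tendsto (fun n => eLpNorm (f n) 2 (volume.restrict (Ioo 0 1))) atTop (𝓝 0)) :
    Tendsto (fun n => eLpNorm (fun z : ℝ × ℝ => f n z.1) 2 (cylMeasure (Ioo 0 1) T))
      atTop (𝓝 0) := by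
  have e : ∀ n, eLpNorm (fun z : ℝ × ℝ => f n z.1) 2 (cylMeasure (Ioo 0 1) T) =
      (volume.restrict (Ioo 0 T) univ) ^ (1 / 2 : ℝ) *
        eLpNorm (f n) 2 (volume.restrict (Ioo 0 1)) := fun n => by
    have hmap : Measure.map Prod.fst ((volume.restrict (Ioo (0 : ℝ) 1)).prod
        (volume.restrict (Ioo (0 : ℝ) T))) =
        volume.restrict (Ioo 0 T) univ • volume.restrict (Ioo (0 : ℝ) 1) := Measure.map_fst_prod
    have h1 := eLpNorm_map_measure (p := 2) (f := Prod.fst) (g := f n)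
      (μ := (volume.restrict (Ioo (0 : ℝ) 1)).prod (volume.restrict (Ioo (0 : ℝ) T)))
      (by rw [hmap]; exact (hf n).smul_measure _) measurable_fst.aemeasurable
    rw [cylMeasure_eq_prod]
    refine h1.symm.trans ?_
    rw [hmap, eLpNorm_smul_measure_of_ne_top (by norm_num)]
    simp
  simp only [e]
  have := ENNReal.Tendsto.const_mul (a := (volume.restrict (Ioo 0 T) univ) ^ (1 / 2 : ℝ)) h
    (Or.inr (ENNReal.rpow_ne_top_of_nonneg (by norm_num) (by simp)))
  rwa [mul_zero] at this

/-- The initial state is extended constantly in time, so that it enters the integrated equation as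
the function component of an element of the energy space. -/
theorem exists_energySpace_of_memH1a [hlam : Fact (0 ≤ lam)] (ha : ContinuousOn a (Icc 0 1))
    {v : ℝ → ℝ} (h : MemH1a a v) :
    ∃ U : energySpace a T lam,
      toFn a T lam U =ᵐ[cylMeasure (Ioo 0 1) T] fun z => v z.1 := by
  obtain ⟨g, hv, hg, φ, hφ, t1, t2⟩ := h
  have hsq : AEStronglyMeasurable (fun x => √(a x)) (volume.restrict (Ioo (0 : ℝ) 1)) :=
    (ha.mono Ioo_subset_Icc_self).sqrt.aestronglyMeasurable measurableSet_Ioo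
  have hlat : ∀ n, IsLateral fun z : ℝ × ℝ => φ n z.1 := fun n =>
    ⟨(hφ n).1.comp contDiff_fst, tsupport (φ n), (hφ n).2.1, (hφ n).2.2,
      fun z hz => image_eq_zero_of_notMem_tsupport hz⟩
  obtain ⟨U, hU, -⟩ := exists_energySpace_of_tendsto (T := T) (lam := lam) ha hlat
    (y := fun z => v z.1) (g := fun z => g z.1) (memLp_comp_fst hv) (memLp_comp_fst hg)
    (tendsto_eLpNorm_comp_fst (f := fun n x => φ n x - v x)
      (fun n => (hφ n).1.continuous.aestronglyMeasurable.sub hv.1) t1)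
    (by
      refine (tendsto_eLpNorm_comp_fst (T := T)
        (f := fun n x => √(a x) * (deriv (φ n) x - g x)) (fun n => ?_) t2).congr fun n => ?_
      · have h1 : AEStronglyMeasurable (fun x => √(a x) * deriv (φ n) x)
            (volume.restrict (Ioo (0 : ℝ) 1)) := hsq.mul
          ((hφ n).1.continuous_deriv (by simp)).aestronglyMeasurable
        refine (h1.sub hg.1).congr (Eventually.of_forall fun x => ?_)
        simp [mul_sub]
      · refine eLpNorm_congr_ae (Eventually.of_forall fun z => ?_)
        simp only [dx_comp_fst ((hφ n).1.differentiable (by simp))])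
  exact ⟨U, hU⟩

end StateEquation

/-! ### Equivalence of the integrated and the distributional formulations. -/

section WeakEquivalence

open scoped InnerProductSpace
open ContinuousLinearMap (adjoint)

variable {a b : ℝ → ℝ} {B : ℝ × ℝ → ℝ} {T b₀ b₁ β lam : ℝ}

/-- A test function for the state equation with prescribed time derivative in the cylinder. -/
theorem exists_test_primitive {ψ : ℝ × ℝ → ℝ} (hψ : ContDiff ℝ ∞ ψ) (hc : HasCompactSupport ψ)
    (hs : tsupport ψ ⊆ cylinder T) (lam : ℝ) :
    ∃ φ : ℝ × ℝ → ℝ, ContDiff ℝ ∞ φ ∧ HasCompactSupport φ ∧ tsupport φ ⊆ Ioo 0 1 ×ˢ Iio T ∧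
      ∀ z ∈ cylinder T, ψ z = -Real.exp (2 * lam * z.2) * dt φ z ∧
        dx ψ z = -Real.exp (2 * lam * z.2) * dt (dx φ) z := by
  have hlat : IsLateral ψ := IsLateral.of_tsupport_subset hψ hc hs
  set θ : ℝ → ℝ := fun t => Real.exp (-(2 * lam * t)) with hθ
  have hθs : ContDiff ℝ ∞ θ := contDiff_exp_neg (2 * lam)
  have hκ : IsLateral fun z => θ z.2 * ψ z := hlat.time_mul hθs
  -- The candidate `∫_t^T e^{-2λs} ψ ds` does not vanish for negative times. This cutoff is `1` for
  -- `t ≥ 0` and `0` for `t ≤ -1`, so it makes the support compact without changing anything in the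
  -- cylinder.
  set χ : ℝ → ℝ := fun t => Real.smoothTransition (t + 1) with hχ
  have hχs : ContDiff ℝ ∞ χ :=
    Real.smoothTransition.contDiff.comp (by fun_prop : ContDiff ℝ ∞ fun t : ℝ => t + 1)
  set Θ : ℝ × ℝ → ℝ := timePrimitive fun z => θ z.2 * ψ z with hΘ
  have hΘl : IsLateral Θ := hκ.timePrimitive
  have hφ0 : IsLateral fun z => Θ (z.1, T) - Θ z := (hΘl.comp_const_time T).sub hΘl
  have hφ : IsLateral fun z => χ z.2 * (Θ (z.1, T) - Θ z) := hφ0.time_mul hχs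
  obtain ⟨T', hT', hT'z⟩ : ∃ T' < T, ∀ z : ℝ × ℝ, T' < z.2 → ψ z = 0 := by
    rcases (tsupport ψ).eq_empty_or_nonempty with he | hne
    · refine ⟨T - 1, by linarith, fun z _ => image_eq_zero_of_notMem_tsupport ?_⟩
      rw [he]; exact notMem_empty z
    · obtain ⟨z₀, hz₀, hmax⟩ := hc.isCompact.exists_isMaxOn hne continuous_snd.continuousOn
      refine ⟨z₀.2, (hs hz₀).2.2, fun z hz => image_eq_zero_of_notMem_tsupport fun h => ?_⟩
      exact absurd (hmax h) (not_le.2 hz)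
  have hzero : ∀ z : ℝ × ℝ, T' < z.2 → Θ (z.1, T) - Θ z = 0 := fun z hz => by
    have hcont : Continuous fun s : ℝ => θ s * ψ (z.1, s) := hκ.continuous.comp
      (by fun_prop : Continuous fun s : ℝ => (z.1, s))
    change (∫ s in (0 : ℝ)..T, θ s * ψ (z.1, s)) - ∫ s in (0 : ℝ)..z.2, θ s * ψ (z.1, s) = 0
    rw [intervalIntegral.integral_interval_sub_left (hcont.intervalIntegrable _ _)
      (hcont.intervalIntegrable _ _)]
    refine (intervalIntegral.integral_congr (g := fun _ => 0) fun s hs' => ?_).trans (by simp)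
    have : T' < s := (lt_min hz hT').trans_le hs'.1
    simp only [hT'z (z.1, s) this, mul_zero]
  obtain ⟨K, hK, hK1, hK0⟩ := hφ0.2
  have hout : ∀ z ∉ K ×ˢ Icc (-1) T', χ z.2 * (Θ (z.1, T) - Θ z) = 0 := fun z hz => by
    by_cases h1 : z.1 ∈ K
    · have h2 : z.2 ∉ Icc (-1) T' := fun h2 => hz ⟨h1, h2⟩
      rw [mem_Icc, not_and_or, not_le, not_le] at h2
      rcases h2 with h2 | h2
      · rw [hχ]
        simp only
        rw [Real.smoothTransition.zero_of_nonpos (by linarith), zero_mul]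
      · rw [hzero z h2, mul_zero]
    · exact mul_eq_zero_of_right _ (hK0 z h1)
  have hcomp : IsCompact (K ×ˢ Icc (-1) T') := hK.prod isCompact_Icc
  have hdt : ∀ z ∈ cylinder T, dt (fun z => χ z.2 * (Θ (z.1, T) - Θ z)) z = -(θ z.2 * ψ z) := by
    intro z hz
    rw [dt_time_mul (hχs.differentiable (by simp)) hφ0.differentiable]
    have h1 : χ =ᶠ[𝓝 z.2] fun _ => 1 := by
      filter_upwards [lt_mem_nhds hz.2.1] with t ht
      exact Real.smoothTransition.one_of_one_le (by linarith)
    have h2 : dt (fun z => Θ (z.1, T) - Θ z) z = -(θ z.2 * ψ z) := by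
      have e1 := hasDerivAt_dt (x := z.1) (t := z.2) (hφ0.differentiable z)
      have e2 := (hasDerivAt_dt (x := z.1) (t := z.2) (hΘl.differentiable z)).const_sub
        (Θ (z.1, T))
      have e3 := e1.unique e2
      rw [hΘ, dt_timePrimitive hκ.1] at e3
      exact e3
    rw [h1.deriv_eq, h1.eq_of_nhds, h2]
    simp
  have hexp : ∀ t : ℝ, Real.exp (2 * lam * t) * θ t = 1 := fun t => by
    rw [hθ]
    simp only
    rw [← Real.exp_add]; simp
  have hopen : IsOpen (cylinder T) := isOpen_Ioo.prod isOpen_Ioo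
  refine ⟨_, hφ.1, HasCompactSupport.intro hcomp fun z hz => hout z hz, ?_, fun z hz => ⟨?_, ?_⟩⟩
  · have h1 : tsupport (fun z => χ z.2 * (Θ (z.1, T) - Θ z)) ⊆ K ×ˢ Icc (-1) T' :=
      closure_minimal (fun z hz' => by_contra fun h => hz' (hout z h)) hcomp.isClosed
    exact h1.trans (prod_mono hK1 fun t ht => ht.2.trans_lt hT')
  · rw [hdt z hz]
    linear_combination (-ψ z) * hexp z.2
  · have h1 : dt (fun z => χ z.2 * (Θ (z.1, T) - Θ z)) =ᶠ[𝓝 z] fun z => -θ z.2 * ψ z := by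
      filter_upwards [hopen.mem_nhds hz] with w hw
      rw [hdt w hw]; ring
    rw [← dx_dt_comm hφ.1, dx, dx, h1.fderiv_eq]
    have h2 := dx_time_mul (θ := fun t => -θ t) (hθs.neg.differentiable (by simp))
      hlat.differentiable z
    rw [dx, dx] at h2
    rw [h2]
    linear_combination (-fderiv ℝ ψ z (1, 0)) * hexp z.2

/-- The integrated weak form holds for all elements of the energy space if and only if the
distributional weak form holds for all test functions. -/
theorem IsLinearData.weakForm_iff (h : IsLinearData a b B T b₀ b₁ β)
    [hlam : Fact (0 ≤ lam)] {u₀ f N : L2Q T lam} {U : energySpace a T lam} {v : ℝ → ℝ}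
    {y g w n : ℝ × ℝ → ℝ}
    (hu₀ : u₀ =ᵐ[cylMeasure (Ioo 0 1) T] fun z => v z.1) (hf : f =ᵐ[cylMeasure (Ioo 0 1) T] w)
    (hN : N =ᵐ[cylMeasure (Ioo 0 1) T] n)
    (hy : toFn a T lam U =ᵐ[cylMeasure (Ioo 0 1) T] y)
    (hg : toGrad a T lam U =ᵐ[cylMeasure (Ioo 0 1) T] fun z => √(a z.1) * g z) :
    (∀ Ψ, weakForm (toFn a T lam) (toGrad a T lam) (primitiveL T lam)
      (mulOp T lam fun z => b z.2) (mulOp T lam B) u₀ (f - N) U Ψ = 0) ↔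
    ∀ φ : ℝ × ℝ → ℝ, ContDiff ℝ ∞ φ → HasCompactSupport φ →
      tsupport φ ⊆ Ioo 0 1 ×ˢ Iio T →
      ∫ z in cylinder T, (-(y z * dt φ z) + b z.2 * a z.1 * g z * dx φ z -
        B z * √(a z.1) * g z * φ z + n z * φ z) =
        (∫ z in cylinder T, w z * φ z) + ∫ x in Ioo (0 : ℝ) 1, v x * φ (x, 0) := by
  have hlatT : ∀ {φ : ℝ × ℝ → ℝ}, tsupport φ ⊆ Ioo 0 1 ×ˢ Iio T → ∀ x, φ (x, T) = 0 :=
    fun hs x => image_eq_zero_of_notMem_tsupport fun hx => lt_irrefl T (hs hx).2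
  constructor
  · intro hw φ h1 h2 h3
    have hφ : IsLateral φ := IsLateral.of_tsupport_subset h1 h2 h3
    have hψ : IsLateral fun z => -Real.exp (2 * lam * z.2) * dt φ z :=
      hφ.dt.time_mul (θ := fun t => -Real.exp (2 * lam * t)) (by fun_prop)
    obtain ⟨Ψ, e1, e2⟩ := exists_energySpace_of_isLateral (T := T) (lam := lam) h.continuousOn_a hψ
    have e3 := h.weakForm_eq_integral hφ (hlatT h3) hu₀ hf hN hy hg e1 (by
      filter_upwards [e2] with z hz
      rw [hz, dx_time_mul (θ := fun t => -Real.exp (2 * lam * t))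
        (by fun_prop) hφ.dt.differentiable, dx_dt_comm h1])
    rw [hw Ψ] at e3
    change ∫ z, _ ∂cylMeasure (Ioo 0 1) T = (∫ z, _ ∂cylMeasure (Ioo 0 1) T) + _
    linarith
  · intro hw
    -- The weak form is continuous in the test element, so it suffices to test with smooth pairs,
    -- which `exists_test_primitive` represents through time derivatives.
    have hclosed : IsClosed {p : L2Pair T lam |
        ⟪toFn a T lam U - u₀ - primitiveL T lam (f - N + mulOp T lam B (toGrad a T lam U)),
          p.fst⟫_ℝ + ⟪primitiveL T lam (mulOp T lam (fun z => b z.2) (toGrad a T lam U)),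
          p.snd⟫_ℝ = 0} := by
      refine isClosed_eq (Continuous.add ?_ ?_) continuous_const
      · exact continuous_const.inner (WithLp.fstL 2 ℝ (L2Q T lam) (L2Q T lam)).continuous
      · exact continuous_const.inner (WithLp.sndL 2 ℝ (L2Q T lam) (L2Q T lam)).continuous
    intro Ψ
    refine hclosed.closure_subset_iff.2 ?_ Ψ.2
    intro p hp
    have hpV : p ∈ energySpace a T lam := Submodule.le_topologicalClosure _ hp
    obtain ⟨ψ, h1, h2, h3, h4, h5⟩ := hp
    obtain ⟨φ, k1, k2, k3, k4⟩ := exists_test_primitive h1 h2 h3 lam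
    have e3 := h.weakForm_eq_integral (Ψ := ⟨p, hpV⟩) (IsLateral.of_tsupport_subset k1 k2 k3)
      (hlatT k3) hu₀ hf hN hy hg (by
        filter_upwards [(ae_weightedMeasure_eq_iff hlam.out).1 h4, ae_mem_cylinder T] with z e1 e2
        exact e1.trans (k4 z e2).1) (by
        filter_upwards [(ae_weightedMeasure_eq_iff hlam.out).1 h5, ae_mem_cylinder T] with z e1 e2
        rw [← (k4 z e2).2]
        exact e1)
    have e4 : ∫ z, _ ∂cylMeasure (Ioo 0 1) T = (∫ z, _ ∂cylMeasure (Ioo 0 1) T) + _ :=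
      hw φ k1 k2 k3
    rw [e4] at e3
    exact e3.trans (by ring)

end WeakEquivalence

/-! ### Pairs of functions and diagonal operators. -/

section Systems

variable {T lam : ℝ}

/-- The `L²` space of pairs of functions on the cylinder. -/
abbrev L2Vec (T lam : ℝ) := Lp (ℝ × ℝ) 2 (weightedMeasure T lam)

/-- The coordinates of the plane. -/
def coord (k : Fin 2) : ℝ × ℝ →L[ℝ] ℝ :=
  if k = 0 then ContinuousLinearMap.fst ℝ ℝ ℝ else ContinuousLinearMap.snd ℝ ℝ ℝ

/-- The components of a pair of functions. -/
def component (T lam : ℝ) (k : Fin 2) : L2Vec T lam →L[ℝ] L2Q T lam :=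
  (coord k).compLpL 2 (weightedMeasure T lam)

/-- The pair of functions with given components. -/
def ofComponents (f : Fin 2 → L2Q T lam) : L2Vec T lam :=
  (ContinuousLinearMap.inl ℝ ℝ ℝ).compLpL 2 (weightedMeasure T lam) (f 0) +
    (ContinuousLinearMap.inr ℝ ℝ ℝ).compLpL 2 (weightedMeasure T lam) (f 1)

theorem coeFn_component (k : Fin 2) (g : L2Vec T lam) :
    component T lam k g =ᵐ[weightedMeasure T lam] fun z => coord k (g z) :=
  ContinuousLinearMap.coeFn_compLpL _ _

theorem coeFn_ofComponents (f : Fin 2 → L2Q T lam) :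
    ofComponents f =ᵐ[weightedMeasure T lam] fun z => (f 0 z, f 1 z) := by
  filter_upwards [Lp.coeFn_add ((ContinuousLinearMap.inl ℝ ℝ ℝ).compLpL 2 (weightedMeasure T lam)
    (f 0)) ((ContinuousLinearMap.inr ℝ ℝ ℝ).compLpL 2 (weightedMeasure T lam) (f 1)),
    ContinuousLinearMap.coeFn_compLpL (p := 2) (ContinuousLinearMap.inl ℝ ℝ ℝ) (f 0),
    ContinuousLinearMap.coeFn_compLpL (p := 2) (ContinuousLinearMap.inr ℝ ℝ ℝ) (f 1)]
    with z e1 e2 e3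
  rw [ofComponents, e1, Pi.add_apply, e2, e3]
  simp

theorem coord_apply (k : Fin 2) (p : ℝ × ℝ) : coord k p = if k = 0 then p.1 else p.2 := by
  unfold coord; split_ifs <;> rfl

theorem coord_pair (k : Fin 2) (f : Fin 2 → ℝ) : coord k (f 0, f 1) = f k := by
  rw [coord_apply]
  fin_cases k <;> simp

theorem component_ofComponents (k : Fin 2) (f : Fin 2 → L2Q T lam) :
    component T lam k (ofComponents f) = f k := by
  refine Lp.ext ?_
  filter_upwards [coeFn_component k (ofComponents f), coeFn_ofComponents f] with z e1 e2
  rw [e1, e2]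
  exact coord_pair k fun k => f k z

theorem ofComponents_component (g : L2Vec T lam) :
    ofComponents (fun k => component T lam k g) = g := by
  refine Lp.ext ?_
  filter_upwards [coeFn_component 0 g, coeFn_component 1 g,
    coeFn_ofComponents fun k => component T lam k g] with z e1 e2 e3
  rw [e3, e1, e2]
  simp [coord_apply]

theorem l2Vec_ext {g g' : L2Vec T lam} (h : ∀ k, component T lam k g = component T lam k g') :
    g = g' := by
  rw [← ofComponents_component g, ← ofComponents_component g']
  simp only [h]

theorem norm_component_le (k : Fin 2) (g : L2Vec T lam) : ‖component T lam k g‖ ≤ ‖g‖ := by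
  refine Lp.norm_le_norm_of_ae_le ?_
  filter_upwards [coeFn_component k g] with z e1
  rw [e1, coord_apply]
  split_ifs
  · exact norm_fst_le _
  · exact norm_snd_le _

theorem norm_ofComponents_le (f : Fin 2 → L2Q T lam) : ‖ofComponents f‖ ≤ ‖f 0‖ + ‖f 1‖ := by
  refine (norm_add_le _ _).trans (add_le_add ?_ ?_)
  · refine Lp.norm_le_norm_of_ae_le ?_
    filter_upwards [ContinuousLinearMap.coeFn_compLpL (p := 2) (ContinuousLinearMap.inl ℝ ℝ ℝ)
      (f 0)] with z e1
    rw [e1]; simp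
  · refine Lp.norm_le_norm_of_ae_le ?_
    filter_upwards [ContinuousLinearMap.coeFn_compLpL (p := 2) (ContinuousLinearMap.inr ℝ ℝ ℝ)
      (f 1)] with z e1
    rw [e1]; simp

/-- The diagonal action of an operator on pairs of functions. -/
def diagVec (A : L2Q T lam →L[ℝ] L2Q T lam) : L2Vec T lam →L[ℝ] L2Vec T lam :=
  (ContinuousLinearMap.inl ℝ ℝ ℝ).compLpL 2 (weightedMeasure T lam) ∘L A ∘L component T lam 0 +
    (ContinuousLinearMap.inr ℝ ℝ ℝ).compLpL 2 (weightedMeasure T lam) ∘L A ∘L component T lam 1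

theorem diagVec_apply (A : L2Q T lam →L[ℝ] L2Q T lam) (g : L2Vec T lam) :
    diagVec A g = ofComponents fun k => A (component T lam k g) := rfl

theorem component_diagVec (A : L2Q T lam →L[ℝ] L2Q T lam) (k : Fin 2) (g : L2Vec T lam) :
    component T lam k (diagVec A g) = A (component T lam k g) := by
  rw [diagVec_apply, component_ofComponents]

theorem norm_diagVec_le {A : L2Q T lam →L[ℝ] L2Q T lam} {r : ℝ} (hr : 0 ≤ r)
    (hA : ∀ f, ‖A f‖ ≤ r * ‖f‖) : ‖diagVec A‖ ≤ 2 * r := by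
  refine ContinuousLinearMap.opNorm_le_bound _ (by positivity) fun g => ?_
  rw [diagVec_apply]
  refine (norm_ofComponents_le _).trans ?_
  have h0 := (hA (component T lam 0 g)).trans
    (mul_le_mul_of_nonneg_left (norm_component_le 0 g) hr)
  have h1 := (hA (component T lam 1 g)).trans
    (mul_le_mul_of_nonneg_left (norm_component_le 1 g) hr)
  linarith

theorem eLpNorm_four_diagVec_le {A : L2Q T lam →L[ℝ] L2Q T lam} {r : ℝ} (hr : 0 ≤ r)
    (hA : ∀ f, eLpNorm (A f) 4 (weightedMeasure T lam) ≤ ENNReal.ofReal (r * ‖f‖))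
    (g : L2Vec T lam) :
    eLpNorm (diagVec A g) 4 (weightedMeasure T lam) ≤ ENNReal.ofReal (2 * r * ‖g‖) := by
  have hk : ∀ k, eLpNorm (A (component T lam k g)) 4 (weightedMeasure T lam) ≤
      ENNReal.ofReal (r * ‖g‖) := fun k => (hA _).trans
    (ENNReal.ofReal_le_ofReal (mul_le_mul_of_nonneg_left (norm_component_le k g) hr))
  have e1 : eLpNorm (diagVec A g) 4 (weightedMeasure T lam) ≤
      eLpNorm (fun z => ‖A (component T lam 0 g) z‖ + ‖A (component T lam 1 g) z‖) 4
        (weightedMeasure T lam) := by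
    refine eLpNorm_mono_ae_real ?_
    filter_upwards [coeFn_ofComponents fun k => A (component T lam k g)] with z hz
    rw [diagVec_apply, hz, Prod.norm_def]
    exact max_le (le_add_of_nonneg_right (norm_nonneg _)) (le_add_of_nonneg_left (norm_nonneg _))
  refine e1.trans ((eLpNorm_add_le (Lp.aestronglyMeasurable _).norm
    (Lp.aestronglyMeasurable _).norm (by norm_num)).trans ?_)
  rw [eLpNorm_norm, eLpNorm_norm, show 2 * r * ‖g‖ = r * ‖g‖ + r * ‖g‖ by ring,
    ENNReal.ofReal_add (by positivity) (by positivity)]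
  exact add_le_add (hk 0) (hk 1)

end Systems

/-! ### The two couplings as one nonlinearity of the plane. -/

section Nonlinearity

theorem Data.Admissible.exists_isSmoothNonlinearity {P : Data} (hP : P.Admissible) :
    ∃ M, IsSmoothNonlinearity (fun z => (P.F 0 z, P.F 1 z)) M := by
  have hF := hP.F_coupling
  have hbd := fun k => (hF k).bounded
  choose M hM hMb using hbd
  set L := max (M 0) (M 1) with hL
  have hLk : ∀ k, M k ≤ L := fun k => by
    fin_cases k
    · exact le_max_left _ _
    · exact le_max_right _ _
  have hL0 : 0 ≤ L := (hM 0).le.trans (hLk 0)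
  have h1 : ∀ k z, ‖fderiv ℝ (P.F k) z‖ ≤ L := fun k z =>
    (le_add_of_nonneg_right (norm_nonneg (fderiv ℝ (fderiv ℝ (P.F k)) z))).trans
      ((hMb k z).trans (hLk k))
  have h2 : ∀ k z, ‖fderiv ℝ (fderiv ℝ (P.F k)) z‖ ≤ L := fun k z =>
    (le_add_of_nonneg_left (norm_nonneg (fderiv ℝ (P.F k) z))).trans ((hMb k z).trans (hLk k))
  have hd : ∀ k, Differentiable ℝ (P.F k) := fun k => (hF k).contDiff.differentiable (by norm_num)
  have hd2 : ∀ k, Differentiable ℝ (fderiv ℝ (P.F k)) := fun k =>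
    ((hF k).contDiff.fderiv_right (m := 1) (by norm_num)).differentiable (by norm_num)
  have hfd : ∀ z, fderiv ℝ (fun z => (P.F 0 z, P.F 1 z)) z =
      (fderiv ℝ (P.F 0) z).prod (fderiv ℝ (P.F 1) z) := fun z =>
    ((hd 0 z).hasFDerivAt.prodMk (hd 1 z).hasFDerivAt).fderiv
  have hprod : ∀ f g : ℝ × ℝ →L[ℝ] ℝ, ∀ r, ‖f‖ ≤ r → ‖g‖ ≤ r → ‖f.prod g‖ ≤ r := by
    intro f g r hf hg
    refine ContinuousLinearMap.opNorm_le_bound _ ((norm_nonneg _).trans hf) fun z => ?_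
    exact max_le (f.le_of_opNorm_le hf z) (g.le_of_opNorm_le hg z)
  refine ⟨L, ⟨?_, (hF 0).contDiff.prodMk (hF 1).contDiff, fun z => ?_, fun z => ?_⟩⟩
  · exact Prod.ext (hF 0).zero (hF 1).zero
  · rw [hfd]
    exact hprod _ _ _ (h1 0 z) (h1 1 z)
  · have hlip : ∀ k z z', ‖fderiv ℝ (P.F k) z - fderiv ℝ (P.F k) z'‖ ≤ L * ‖z - z'‖ :=
      fun k z z' => Convex.norm_image_sub_le_of_norm_fderiv_le (s := univ)
        (fun x _ => hd2 k x) (fun x _ => h2 k x) convex_univ (mem_univ _) (mem_univ _)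
    -- A Lipschitz bound on the first derivative controls the second one without computing it for
    -- the pair.
    have : LipschitzWith ⟨L, hL0⟩ (fderiv ℝ fun z => (P.F 0 z, P.F 1 z)) := by
      refine LipschitzWith.of_dist_le_mul fun z z' => ?_
      rw [dist_eq_norm, dist_eq_norm, hfd, hfd]
      exact hprod (fderiv ℝ (P.F 0) z - fderiv ℝ (P.F 0) z')
        (fderiv ℝ (P.F 1) z - fderiv ℝ (P.F 1) z') _ (hlip 0 z z') (hlip 1 z z')
    exact norm_fderiv_le_of_lipschitz ℝ this

end Nonlinearity

/-! ### The concrete linear solution operator, small for a large weight. -/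

section StateOperator

variable {a b : ℝ → ℝ} {B : ℝ × ℝ → ℝ} {T b₀ b₁ β : ℝ}

/-- The solution operators of the linear equation, with arbitrarily small norm for a large
exponential weight. -/
theorem IsLinearData.exists_linear_solver (h : IsLinearData a b B T b₀ b₁ β) {ε : ℝ} (hε : 0 < ε) :
    ∃ (lam : ℝ) (_ : Fact (0 ≤ lam)) (S : L2Q T lam →L[ℝ] energySpace a T lam) (C₄ : ℝ),
      (∀ Ũ : energySpace a T lam, ∃ U₀ : energySpace a T lam, ∀ U f,
        (∀ Ψ, weakForm (toFn a T lam) (toGrad a T lam) (primitiveL T lam)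
          (mulOp T lam fun z => b z.2) (mulOp T lam B) (toFn a T lam Ũ) f U Ψ = 0) ↔
            U = U₀ + S f) ∧
      (∀ f, ‖toFn a T lam (S f)‖ ≤ ε * ‖f‖) ∧ 0 ≤ C₄ ∧
      ∀ f, eLpNorm (toFn a T lam (S f)) 4 (weightedMeasure T lam) ≤ ENNReal.ofReal (C₄ * ‖f‖) := by
  have hb₀ := h.b₀_pos
  have hb₁ := h.b₁_pos
  set c := (1 + b₁ / b₀) / b₀ with hc
  have hc0 : 0 < c := by positivity
  -- The second term satisfies the smallness condition of `exists_weak_solver`; the third turns `λ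
  -- ‖S f‖² ≤ 4 c ‖f‖²` into `‖S f‖ ≤ ε ‖f‖`.
  set lam := 1 + 4 * (β + b₁) ^ 2 * c + 4 * c / ε ^ 2 with hlamdef
  have hp1 : 0 ≤ 4 * (β + b₁) ^ 2 * c := by positivity
  have hp2 : 0 ≤ 4 * c / ε ^ 2 := by positivity
  have hpos : 0 < lam := by linarith
  have : Fact (0 ≤ lam) := ⟨hpos.le⟩
  have hev := h.isEvolution (lam := lam) hpos
  obtain ⟨S, hS, hSn, hSq⟩ := hev.exists_weak_solver h.β_nonneg (B := mulOp T lam B)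
    (norm_mulOp_apply_le h.memLp_B (by
      filter_upwards [ae_weightedMeasure_mem_cylinder] with z hz using h.B_le z hz))
    (by rw [← hc]; linarith)
  obtain ⟨C, hC0, hC⟩ := exists_eLpNorm_four_le (lam := lam) h.T_pos.le h.continuousOn_a h.le_a
  have hSε : ∀ f, ‖S f‖ ≤ ε * ‖f‖ := fun f => by
    refine le_of_sq_le_sq ?_ (by positivity)
    have h1 := hSn f
    rw [← hc] at h1
    have h2 : 4 * c ≤ lam * ε ^ 2 := by
      have : 4 * c / ε ^ 2 * ε ^ 2 = 4 * c := div_mul_cancel₀ _ (by positivity)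
      nlinarith [sq_nonneg ε]
    refine le_of_mul_le_mul_left ?_ hpos
    nlinarith [sq_nonneg ‖f‖]
  set D := max ε (2 * (1 + b₁ / b₀)) with hD
  have hD0 : 0 ≤ D := hε.le.trans (le_max_left _ _)
  refine ⟨lam, this, S, C * D, hev.exists_initial_solution hS,
    fun f => (norm_toFn_le _).trans (hSε f), by positivity, fun f => ?_⟩
  obtain ⟨q, hq, hqn⟩ := hSq f
  refine (hC (S f) q (D * ‖f‖) hq (hqn.trans ?_) ((hSε f).trans ?_)).trans_eq (by rw [mul_assoc])
  · gcongr; exact le_max_right _ _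
  · gcongr; exact le_max_left _ _

end StateOperator

/-! ### The nonlinear state as a function of the source. -/

section State

/-- The state depends on the source through a smooth perturbation of the identity. -/
theorem Data.Admissible.exists_state_operator {P : Data} (hP : P.Admissible) :
    ∃ (lam : ℝ) (_ : Fact (0 ≤ lam)) (y₀ : L2Vec P.T lam) (S : L2Vec P.T lam →L[ℝ] L2Vec P.T lam)
      (𝒩 : L2Vec P.T lam → L2Vec P.T lam) (d𝒩 : L2Vec P.T lam → L2Vec P.T lam →L[ℝ] L2Vec P.T lam)
      (dd𝒩 : L2Vec P.T lam → L2Vec P.T lam →L[ℝ] L2Vec P.T lam →L[ℝ] L2Vec P.T lam) (C : ℝ)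
      (Φ : L2Vec P.T lam → L2Vec P.T lam),
      IsSmoothPerturbation 𝒩 d𝒩 dd𝒩 C ∧ (∀ f, Φ f + 𝒩 (Φ f) = f) ∧
      ∀ (h : ℝ × ℝ → ℝ) (v : Fin 2 → ℝ × ℝ → ℝ) (s : L2Vec P.T lam),
        (∀ k, component P.T lam k s =ᵐ[cylMeasure (Ioo 0 1) P.T] P.source h v k) →
        ∀ k, P.state h v k =ᵐ[cylMeasure (Ioo 0 1) P.T]
          component P.T lam k (y₀ + S (Φ s)) := by
  obtain ⟨b₀, b₁, β, hD⟩ := hP.exists_isLinearData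
  obtain ⟨M, hM⟩ := hP.exists_isSmoothNonlinearity
  have hM0 := hM.nonneg
  -- Passing to pairs may double the norm, so this gives `M ‖diagVec A‖ ≤ 1/2`. The `+ 1` covers `M
  -- = 0`.
  set ε := 1 / (4 * (M + 1)) with hε
  have hε0 : 0 < ε := by positivity
  obtain ⟨lam, hlam, S, C₄, hS, hSε, hC₄, hS4⟩ := hD.exists_linear_solver hε0
  have hŨ := fun k => exists_energySpace_of_memH1a (T := P.T) (lam := lam) hD.continuousOn_a
    (hP.y0_mem k)
  choose Ũ hŨ using hŨ
  choose U₀ hU₀ using fun k => hS (Ũ k)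
  set A : L2Q P.T lam →L[ℝ] L2Q P.T lam := toFn P.a P.T lam ∘L S with hA
  set y₀ : L2Vec P.T lam := ofComponents fun k => toFn P.a P.T lam (U₀ k) with hy₀
  have hAM : M * ‖diagVec A‖ ≤ 1 / 2 := by
    have h1 := norm_diagVec_le (A := A) hε0.le hSε
    calc M * ‖diagVec A‖ ≤ (M + 1) * (2 * ε) := by
          gcongr; linarith
      _ = 1 / 2 := by rw [hε]; field_simp; norm_num
  have hpert := hM.isSmoothPerturbation (S := diagVec A) (by positivity : 0 ≤ 2 * C₄)
    (eLpNorm_four_diagVec_le hC₄ hS4) hAM y₀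
  obtain ⟨Φ, hΦ, hΦu⟩ := hpert.exists_inverse
  have hcomp : ∀ (g : L2Vec P.T lam) k, component P.T lam k (y₀ + diagVec A g) =
      toFn P.a P.T lam (U₀ k + S (component P.T lam k g)) := fun g k => by
    rw [map_add, component_diagVec, hy₀, component_ofComponents, map_add]
    rfl
  have hsup : ∀ (Y : L2Vec P.T lam) k, component P.T lam k (hM.superpose Y)
      =ᵐ[cylMeasure (Ioo 0 1) P.T] fun z => P.F k (Y z) := fun Y k => by
    filter_upwards [(ae_weightedMeasure_eq_iff hlam.out).1 (coeFn_component k (hM.superpose Y)),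
      (ae_weightedMeasure_iff hlam.out).1 (hM.coeFn_superpose Y)] with z e1 e2
    rw [e1, e2]
    exact coord_pair k fun k => P.F k (Y z)
  refine ⟨lam, hlam, y₀, diagVec A, _, _, _, _, Φ, hpert, hΦ, fun h v s hs => ?_⟩
  -- For any solution `Y` the effective source `s - F(Y)` solves `g + 𝒩 g = s`, hence equals `Φ s`.
  -- The state is defined by a choice, so both uniqueness almost everywhere and existence are
  -- needed.
  have huniq : ∀ y, P.IsState h v y → ∀ k, y k =ᵐ[cylMeasure (Ioo 0 1) P.T]
      component P.T lam k (y₀ + diagVec A (Φ s)) := by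
    rintro y ⟨g, hyg, hweak⟩
    choose U hUy hUg using fun k => exists_energySpace_of_isL2H1a (lam := lam) hD.continuousOn_a
      (hyg k)
    set Y : L2Vec P.T lam := ofComponents fun k => toFn P.a P.T lam (U k) with hY
    have hYy : Y =ᵐ[cylMeasure (Ioo 0 1) P.T] fun z => (y 0 z, y 1 z) := by
      filter_upwards [(ae_weightedMeasure_iff hlam.out).1
        (coeFn_ofComponents fun k => toFn P.a P.T lam (U k)), hUy 0, hUy 1] with z e1 e2 e3
      rw [hY, e1, e2, e3]
    have hUk : ∀ k, U k = U₀ k + S (component P.T lam k (s - hM.superpose Y)) := fun k => by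
      refine (hU₀ k _ _).1 ?_
      rw [map_sub]
      refine (hD.weakForm_iff (hŨ k) (hs k) ?_ (hUy k) (hUg k)).2 (hweak k)
      filter_upwards [hsup Y k, hYy] with z e1 e2
      rw [e1, e2]
    have hYe : Y = y₀ + diagVec A (s - hM.superpose Y) := l2Vec_ext fun k => by
      rw [hcomp, ← hUk, hY, component_ofComponents]
    have hg : s - hM.superpose Y = Φ s := by
      refine hΦu _ _ ?_
      rw [← hYe]; abel
    rw [hg] at hYe
    intro k
    rw [← hYe, hY, component_ofComponents]
    exact (hUy k).symm
  have hex : ∃ y, P.IsState h v y := by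
    set Y := y₀ + diagVec A (Φ s) with hY
    have hrep : ∀ k, toFn P.a P.T lam (U₀ k + S (component P.T lam k (Φ s)))
        =ᵐ[cylMeasure (Ioo 0 1) P.T] fun z => coord k (Y z) := fun k => by
      rw [← hcomp, ← hY]
      exact (ae_weightedMeasure_eq_iff hlam.out).1 (coeFn_component k Y)
    choose g hg hgU using fun k => isL2H1a_of_energySpace hD.le_a _ (hrep k)
    refine ⟨fun k z => coord k (Y z), g, hg, fun k => ?_⟩
    refine (hD.weakForm_iff (N := component P.T lam k (hM.superpose Y)) (hŨ k) (hs k) ?_ (hrep k)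
      (hgU k)).1 ((hU₀ k _ _).2 ?_)
    · filter_upwards [hsup Y k] with z e1
      rw [e1]
      simp [coord_apply]
    · congr 2
      rw [← map_sub]
      congr 1
      rw [eq_sub_iff_add_eq]
      exact hΦ s
  exact huniq _ (Classical.epsilon_spec hex)

end State

/-! ### Transfer from the space of controls to all functions. -/

section Restriction

variable {E : Type*} [AddCommGroup E] [Module ℝ E] {S : Submodule ℝ E} {f : E → ℝ}

theorem HasSecondGateauxDeriv.of_submodule {w δ η : S} {d : ℝ}
    (h : HasSecondGateauxDeriv (fun w : S => f w) w δ η d) :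
    HasSecondGateauxDeriv f (w : E) (δ : E) (η : E) d := h

theorem convexOn_of_submodule {s : Set S} (h : ConvexOn ℝ s fun w : S => f w) :
    ConvexOn ℝ (Subtype.val '' s) f := by
  refine ⟨h.1.is_linear_image S.subtype.isLinear, ?_⟩
  rintro _ ⟨w, hw, rfl⟩ _ ⟨w', hw', rfl⟩ a b ha hb hab
  exact h.2 hw hw' ha hb hab

end Restriction

/-! ### Convexity and minimisation under a strong quadratic penalty. -/

section Minimisation

open scoped InnerProductSpace

variable {W X Y Z : Type*} [AddCommGroup W] [Module ℝ W] [NormedAddCommGroup X] [NormedSpace ℝ X]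
  [NormedAddCommGroup Y] [NormedSpace ℝ Y] [NormedAddCommGroup Z] [InnerProductSpace ℝ Z]

/-- A cost made of a smooth part, which grows at most quadratically, and a quadratic penalty. -/
structure IsPenalized (J : W → ℝ) (Q : X → ℝ) (q₁ : X → X →L[ℝ] ℝ) (q₂ : X → X →L[ℝ] X →L[ℝ] ℝ)
    (e : W →ₗ[ℝ] X) (ν : W →ₗ[ℝ] Y) (r : W →ₗ[ℝ] Z) (w₀ : W) (s : X) (α M c μ : ℝ) : Prop where
  eq : ∀ w, J w = α * Q (s + e (w - w₀)) + μ / 2 * ‖r w‖ ^ 2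
  α_pos : 0 < α
  c_pos : 0 < c
  M_nonneg : 0 ≤ M
  μ_nonneg : 0 ≤ μ
  e_le : ∀ w, ‖e w‖ ≤ ‖ν w‖
  r_ge : ∀ w, c * ‖ν w‖ ≤ ‖r w‖
  hasDerivAt : ∀ f η, HasDerivAt (fun t : ℝ => Q (f + t • η)) (q₁ f η) 0
  hasDerivAt_deriv : ∀ f δ η, HasDerivAt (fun t : ℝ => q₁ (f + t • δ) η) (q₂ f δ η) 0
  nonneg : ∀ f, 0 ≤ Q f
  le : ∀ f, Q f ≤ M * (1 + ‖f‖) ^ 2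
  deriv_le : ∀ f η, |q₁ f η| ≤ M * (1 + ‖f‖) * ‖η‖
  second_le : ∀ f δ η, |q₂ f δ η| ≤ M * (1 + ‖f‖) * ‖δ‖ * ‖η‖

namespace IsPenalized

variable {J : W → ℝ} {Q : X → ℝ} {q₁ : X → X →L[ℝ] ℝ} {q₂ : X → X →L[ℝ] X →L[ℝ] ℝ}
  {e : W →ₗ[ℝ] X} {ν : W →ₗ[ℝ] Y} {r : W →ₗ[ℝ] Z} {w₀ : W} {s : X} {α M c μ H R : ℝ}

theorem hasDerivAt_J (h : IsPenalized J Q q₁ q₂ e ν r w₀ s α M c μ) (w η : W) :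
    HasDerivAt (fun t : ℝ => J (w + t • η))
      (α * q₁ (s + e (w - w₀)) (e η) + μ * ⟪r w, r η⟫_ℝ) 0 := by
  have h1 := (h.hasDerivAt (s + e (w - w₀)) (e η)).const_mul α
  have h2 : HasDerivAt (fun t : ℝ => r w + t • r η) (r η) 0 := by
    simpa using ((hasDerivAt_id (0 : ℝ)).smul_const (r η)).const_add (r w)
  have h3 := (h2.norm_sq).const_mul (μ / 2)
  refine ((h1.add h3).congr_deriv ?_).congr_of_eventuallyEq (Eventually.of_forall fun t => ?_)
  · rw [zero_smul, add_zero]; ring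
  · simp only [Pi.add_apply]
    rw [h.eq, map_add, map_smul, show w + t • η - w₀ = (w - w₀) + t • η by abel, map_add, map_smul,
      add_assoc]

theorem hasDerivAt_deriv_J (h : IsPenalized J Q q₁ q₂ e ν r w₀ s α M c μ) (w δ η : W) (t₀ : ℝ) :
    HasDerivAt (fun t : ℝ => α * q₁ (s + e (w + t • δ - w₀)) (e η) + μ * ⟪r (w + t • δ), r η⟫_ℝ)
      (α * q₂ (s + e (w + t₀ • δ - w₀)) (e δ) (e η) + μ * ⟪r δ, r η⟫_ℝ) t₀ := by
  have h1 := ((h.hasDerivAt_deriv (s + e (w + t₀ • δ - w₀)) (e δ) (e η)).const_mul α)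
  have h2 : HasDerivAt (fun t : ℝ => r (w + t₀ • δ) + t • r δ) (r δ) 0 := by
    simpa using ((hasDerivAt_id (0 : ℝ)).smul_const (r δ)).const_add (r (w + t₀ • δ))
  have h3 := ((h2.inner ℝ (hasDerivAt_const (0 : ℝ) (r η))).const_mul μ)
  have h4 : HasDerivAt (fun t : ℝ => t - t₀) 1 t₀ := (hasDerivAt_id t₀).sub_const t₀
  have h5 := HasDerivAt.comp t₀ (h₂ := fun t : ℝ => _) (h := fun t : ℝ => t - t₀)
    (by rw [sub_self]; exact h1.add h3) h4
  refine (h5.congr_deriv (by simp)).congr_of_eventuallyEq (Eventually.of_forall fun t => ?_)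
  simp only [Function.comp_apply, Pi.add_apply]
  have e1 : w + t • δ = (w + t₀ • δ) + (t - t₀) • δ := by rw [sub_smul]; abel
  rw [e1, show (w + t₀ • δ) + (t - t₀) • δ - w₀ = (w + t₀ • δ - w₀) + (t - t₀) • δ by abel]
  simp only [map_add, map_smul, add_assoc]

/-- The tracking part can lower the second derivative by at most `α M H ‖ν δ‖²`, while the penalty
contributes at least `μ c² ‖ν δ‖²`. -/
theorem second_ge (h : IsPenalized J Q q₁ q₂ e ν r w₀ s α M c μ) {f : X} (hf : 1 + ‖f‖ ≤ H)
    (hμ : 1 + α * M * H ≤ μ * c ^ 2) (δ : W) :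
    ‖ν δ‖ ^ 2 ≤ α * q₂ f (e δ) (e δ) + μ * ⟪r δ, r δ⟫_ℝ := by
  have hα := h.α_pos
  have hM := h.M_nonneg
  have h1 := (abs_le.1 (h.second_le f (e δ) (e δ))).1
  have h2 : M * (1 + ‖f‖) * ‖e δ‖ * ‖e δ‖ ≤ M * H * ‖ν δ‖ * ‖ν δ‖ := by
    have := h.e_le δ
    have hH : 0 ≤ H := le_trans (by positivity) hf
    gcongr
  have h3 : c ^ 2 * ‖ν δ‖ ^ 2 ≤ ‖r δ‖ ^ 2 := by
    rw [← mul_pow]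
    have := h.c_pos
    gcongr
    exact h.r_ge δ
  rw [real_inner_self_eq_norm_sq]
  have h4 : α * (-(M * H * ‖ν δ‖ * ‖ν δ‖)) ≤ α * q₂ f (e δ) (e δ) := by
    gcongr; linarith
  have h5 : μ * (c ^ 2 * ‖ν δ‖ ^ 2) ≤ μ * ‖r δ‖ ^ 2 := by
    have := h.μ_nonneg
    gcongr
  nlinarith [mul_le_mul_of_nonneg_right hμ (sq_nonneg ‖ν δ‖)]

/-- Along a segment in the ball, the cost is convex. -/
theorem convexOn_segment (h : IsPenalized J Q q₁ q₂ e ν r w₀ s α M c μ)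
    (hμ : 1 + α * M * (1 + ‖s‖ + R) ≤ μ * c ^ 2) {w w' : W} (hw : ‖ν (w - w₀)‖ ≤ R)
    (hw' : ‖ν (w' - w₀)‖ ≤ R) :
    ConvexOn ℝ (Icc (0 : ℝ) 1) fun t => J (w + t • (w' - w)) := by
  set δ := w' - w with hδ
  set p : ℝ → ℝ := fun t => α * q₁ (s + e (w + t • δ - w₀)) (e δ) + μ * ⟪r (w + t • δ), r δ⟫_ℝ
    with hp
  have hd : ∀ t, HasDerivAt (fun t => J (w + t • δ)) (p t) t := fun t => by
    have h1 := h.hasDerivAt_J (w + t • δ) δ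
    have h2 : HasDerivAt (fun t' : ℝ => t' - t) 1 t := (hasDerivAt_id t).sub_const t
    have h3 := HasDerivAt.comp t (h₂ := fun t : ℝ => _) (h := fun t' : ℝ => t' - t)
      (by rw [sub_self]; exact h1) h2
    refine (h3.congr_deriv (by simp [hp])).congr_of_eventuallyEq
      (Eventually.of_forall fun t' => ?_)
    simp only [Function.comp_apply]
    rw [sub_smul]
    congr 1
    abel
  have hpd := fun t => h.hasDerivAt_deriv_J w δ δ t
  -- Points of the segment stay in the ball, so the source stays below `‖s‖ + R` in norm and
  -- `second_ge` makes the derivative of `p` nonnegative.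
  have hmono : MonotoneOn p (Icc 0 1) := by
    refine monotoneOn_of_deriv_nonneg (convex_Icc 0 1)
      (fun t _ => (hpd t).continuousAt.continuousWithinAt)
      (fun t _ => (hpd t).differentiableAt.differentiableWithinAt) fun t ht => ?_
    rw [interior_Icc] at ht
    rw [(hpd t).deriv]
    refine le_trans (sq_nonneg _) (h.second_ge (H := 1 + ‖s‖ + R) ?_ hμ δ)
    have e1 : w + t • δ - w₀ = (1 - t) • (w - w₀) + t • (w' - w₀) := by
      rw [hδ]; module
    have e2 : ‖e (w + t • δ - w₀)‖ ≤ R := by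
      refine (h.e_le _).trans ?_
      rw [e1, map_add, map_smul, map_smul]
      refine (norm_add_le _ _).trans ?_
      rw [norm_smul, norm_smul, Real.norm_of_nonneg ht.1.le,
        Real.norm_of_nonneg (sub_nonneg.2 ht.2.le)]
      have := mul_le_mul_of_nonneg_left hw (sub_nonneg.2 ht.2.le)
      have := mul_le_mul_of_nonneg_left hw' ht.1.le
      linarith
    linarith [norm_add_le s (e (w + t • δ - w₀))]
  refine MonotoneOn.convexOn_of_deriv (convex_Icc 0 1)
    (fun t _ => (hd t).continuousAt.continuousWithinAt)
    (fun t _ => (hd t).differentiableAt.differentiableWithinAt) ?_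
  have : deriv (fun t => J (w + t • δ)) = p := funext fun t => (hd t).deriv
  rw [this]
  exact hmono.mono interior_subset

/-- The second derivative of the cost is coercive if the penalty is strong. -/
theorem exists_coercive_second_deriv (h : IsPenalized J Q q₁ q₂ e ν r w₀ s α M c μ)
    (hμ : 1 + α * M * (1 + ‖s‖) ≤ μ * c ^ 2) :
    ∃ D : W →ₗ[ℝ] W →ₗ[ℝ] ℝ, (∀ δ η, HasSecondGateauxDeriv J w₀ δ η (D δ η)) ∧
      ∀ δ, ‖ν δ‖ ^ 2 ≤ D δ δ := by
  refine ⟨LinearMap.mk₂ ℝ (fun δ η => α * q₂ s (e δ) (e η) + μ * ⟪r δ, r η⟫_ℝ) ?_ ?_ ?_ ?_,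
    fun δ η => ⟨_, fun t => h.hasDerivAt_J (w₀ + t • δ) η, ?_⟩, fun δ => h.second_ge le_rfl hμ δ⟩
  · intro δ δ' η
    simp only [map_add, inner_add_left, add_apply]; ring
  · intro a δ η
    simp only [map_smul, real_inner_smul_left, smul_apply, smul_eq_mul]; ring
  · intro δ η η'
    simp only [map_add, inner_add_right]; ring
  · intro a δ η
    simp only [map_smul, real_inner_smul_right, smul_eq_mul]; ring
  · refine (h.hasDerivAt_deriv_J w₀ δ η 0).congr_deriv ?_
    simp

theorem convexOn_ball (h : IsPenalized J Q q₁ q₂ e ν r w₀ s α M c μ)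
    (hμ : 1 + α * M * (1 + ‖s‖ + R) ≤ μ * c ^ 2) :
    ConvexOn ℝ {w | ‖ν (w - w₀)‖ ≤ R} J := by
  refine ⟨fun w hw w' hw' a b ha hb hab => ?_, fun w hw w' hw' a b ha hb hab => ?_⟩
  · have e1 : a • w + b • w' - w₀ = a • (w - w₀) + b • (w' - w₀) := by
      rw [smul_sub, smul_sub, sub_add_sub_comm, ← add_smul, hab, one_smul]
    rw [mem_ofPred_eq, e1, map_add, map_smul, map_smul]
    refine (norm_add_le _ _).trans ?_
    rw [norm_smul, norm_smul, Real.norm_of_nonneg ha, Real.norm_of_nonneg hb]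
    calc _ ≤ a * R + b * R := add_le_add (mul_le_mul_of_nonneg_left hw ha)
          (mul_le_mul_of_nonneg_left hw' hb)
      _ = R := by rw [← add_mul, hab, one_mul]
  · have h1 := (h.convexOn_segment hμ hw hw').2
      (left_mem_Icc.2 zero_le_one) (right_mem_Icc.2 zero_le_one) ha hb hab
    have h2 : w + (a • (0 : ℝ) + b • (1 : ℝ)) • (w' - w) = a • w + b • w' := by
      rw [smul_zero, zero_add, smul_eq_mul, mul_one, eq_sub_of_add_eq hab]
      module
    have h3 : w + (0 : ℝ) • (w' - w) = w := by simp
    have h4 : w + (1 : ℝ) • (w' - w) = w' := by simp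
    simpa only [h2, h3, h4] using h1

/-- Criticality in the direction `w₀` itself balances `μ ‖r w₀‖²` against the first derivative of
the tracking term, which is linear in `‖ν w₀‖`; one factor is then divided out. -/
theorem norm_critical_le (h : IsPenalized J Q q₁ q₂ e ν r w₀ s α M c μ)
    (hcrit : ∀ δ, HasDerivAt (fun t : ℝ => J (w₀ + t • δ)) 0 0) :
    μ * c ^ 2 * ‖ν w₀‖ ≤ α * M * (1 + ‖s‖) := by
  have hα := h.α_pos
  have hM := h.M_nonneg
  have h1 := (h.hasDerivAt_J w₀ w₀).unique (hcrit w₀)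
  rw [sub_self, map_zero, add_zero, real_inner_self_eq_norm_sq] at h1
  have h2 := (abs_le.1 (h.deriv_le s (e w₀))).1
  have h3 : M * (1 + ‖s‖) * ‖e w₀‖ ≤ M * (1 + ‖s‖) * ‖ν w₀‖ := by
    gcongr; exact h.e_le w₀
  have h4 : c ^ 2 * ‖ν w₀‖ ^ 2 ≤ ‖r w₀‖ ^ 2 := by
    rw [← mul_pow]
    have := h.c_pos
    gcongr
    exact h.r_ge w₀
  have h5 : μ * (c ^ 2 * ‖ν w₀‖ ^ 2) ≤ μ * ‖r w₀‖ ^ 2 := by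
    have := h.μ_nonneg
    gcongr
  have h6 : α * (-(M * (1 + ‖s‖) * ‖ν w₀‖)) ≤ α * q₁ s (e w₀) := by
    gcongr; linarith
  rcases (norm_nonneg (ν w₀)).eq_or_lt with h0 | h0
  · rw [← h0, mul_zero]; positivity
  · refine le_of_mul_le_mul_right ?_ h0
    nlinarith

/-- A critical point near the origin is a global minimum if the penalty is strong. -/
theorem le_of_critical (h : IsPenalized J Q q₁ q₂ e ν r w₀ s α M c μ)
    (hcrit : ∀ δ, HasDerivAt (fun t : ℝ => J (w₀ + t • δ)) 0 0) (hw₀ : ‖ν w₀‖ ≤ 1)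
    (hμ : 1 + α * M * (1 + ‖s‖ + 2) ≤ μ * c ^ 2)
    (hμ' : α * M * (2 + ‖s‖) ^ 2 ≤ μ / 2 * c ^ 2) (w : W) : J w₀ ≤ J w := by
  have hα := h.α_pos
  have hM := h.M_nonneg
  -- A convex function on a segment with zero slope at its starting point lies above its value
  -- there.
  have hloc : ∀ w, ‖ν (w - w₀)‖ ≤ 2 → J w₀ ≤ J w := fun w hw => by
    have hc := h.convexOn_segment hμ (w := w₀) (w' := w) (by simp) hw
    have hmin := hc.le_slope_of_hasDerivAt (x := 0) (y := 1) (by simp) (by simp) one_pos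
      (hcrit (w - w₀))
    rw [slope_def_field] at hmin
    simpa using hmin
  rcases le_or_gt ‖ν (w - w₀)‖ 2 with hw | hw
  · exact hloc w hw
  · have h1 : 1 ≤ ‖ν w‖ := by
      rw [map_sub] at hw
      linarith [norm_sub_le (ν w) (ν w₀)]
    -- Outside the ball one has `‖ν w‖ > 2 - 1`, so the penalty is at least `μ c² / 2`. The zero
    -- control, which lies in the ball and pays no penalty, is the comparison point.
    have h0 : J w₀ ≤ J 0 := hloc 0 (by
      rw [zero_sub, map_neg, norm_neg]; linarith)
    have h2 : J 0 ≤ α * M * (2 + ‖s‖) ^ 2 := by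
      rw [h.eq, zero_sub, map_neg, map_zero, norm_zero]
      have e1 := h.le (s + -e w₀)
      have e2 : 1 + ‖s + -e w₀‖ ≤ 2 + ‖s‖ := by
        have := norm_add_le s (-e w₀)
        rw [norm_neg] at this
        linarith [h.e_le w₀]
      calc _ ≤ α * (M * (2 + ‖s‖) ^ 2) := by
            rw [zero_pow (by norm_num), mul_zero, add_zero]
            gcongr
            exact e1.trans (by gcongr)
        _ = _ := by ring
    have h3 : μ / 2 * c ^ 2 ≤ J w := by
      rw [h.eq]
      have e1 : c ^ 2 ≤ ‖r w‖ ^ 2 := by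
        have := h.c_pos
        gcongr
        calc c ≤ c * ‖ν w‖ := le_mul_of_one_le_right this.le h1
          _ ≤ _ := h.r_ge w
      have e2 := mul_nonneg hα.le (h.nonneg (s + e (w - w₀)))
      have e3 : μ / 2 * c ^ 2 ≤ μ / 2 * ‖r w‖ ^ 2 := by
        have := h.μ_nonneg
        gcongr
      linarith
    linarith

end IsPenalized

end Minimisation

/-! ### Follower controls and tracking costs as maps between Hilbert spaces. -/

section Controls

open scoped InnerProductSpace

theorem norm_toLp_sq {α : Type*} [MeasurableSpace α] {m : Measure α} {f : α → ℝ}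
    (hf : MemLp f 2 m) : ‖hf.toLp‖ ^ 2 = ∫ z, |f z| ^ 2 ∂m := by
  rw [← real_inner_self_eq_norm_sq, L2.inner_def]
  refine integral_congr_ae ?_
  filter_upwards [hf.coeFn_toLp] with z hz
  rw [hz, real_inner_self_eq_norm_sq, Real.norm_eq_abs]

/-- A linear map to functions, all of whose values are in `L²`, as a linear map to `L²`. -/
def toLpLinear {α W : Type*} [MeasurableSpace α] {m : Measure α} [AddCommGroup W] [Module ℝ W]
    (A : W →ₗ[ℝ] (α → ℝ)) (h : ∀ w, MemLp (A w) 2 m) : W →ₗ[ℝ] Lp ℝ 2 m where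
  toFun w := (h w).toLp
  map_add' w w' := by
    rw [← MemLp.toLp_add]
    exact MemLp.toLp_congr _ _ (by rw [map_add])
  map_smul' c w := by
    rw [RingHom.id_apply, ← MemLp.toLp_const_smul]
    exact MemLp.toLp_congr _ _ (by rw [map_smul])

/-- Multiplication of functions by a fixed function. -/
def mulLinear {α : Type*} (g : α → ℝ) : (α → ℝ) →ₗ[ℝ] (α → ℝ) where
  toFun f z := g z * f z
  map_add' f f' := by ext z; simp [mul_add]
  map_smul' c f := by ext z; simp [mul_left_comm]

variable {T lam : ℝ} {S : Set ℝ}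

theorem cylMeasure_restrict (hS : MeasurableSet S) (hS' : S ⊆ Ioo 0 1) :
    (cylMeasure (Ioo 0 1) T).restrict (S ×ˢ univ) = cylMeasure S T := by
  rw [cylMeasure, Measure.restrict_restrict (hS.prod .univ), prod_inter_prod, univ_inter,
    inter_eq_self_of_subset_left hS', cylMeasure]

theorem cylMeasure_mono (hS' : S ⊆ Ioo 0 1) : cylMeasure S T ≤ cylMeasure (Ioo 0 1) T :=
  Measure.restrict_mono (prod_mono hS' subset_rfl) le_rfl

theorem eLpNorm_indicator_weightedMeasure_le [hlam : Fact (0 ≤ lam)] (hS : MeasurableSet S)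
    (hS' : S ⊆ Ioo 0 1) (w : ℝ × ℝ → ℝ) :
    eLpNorm ((S ×ˢ univ).indicator w) 2 (weightedMeasure T lam) ≤ eLpNorm w 2 (cylMeasure S T) := by
  refine (eLpNorm_weightedMeasure_le hlam.out _ _).trans_eq ?_
  rw [eLpNorm_indicator_eq_eLpNorm_restrict (hS.prod .univ), cylMeasure_restrict hS hS']

theorem memLp_indicator_weightedMeasure [hlam : Fact (0 ≤ lam)] (hS : MeasurableSet S)
    (hS' : S ⊆ Ioo 0 1) {w : ℝ × ℝ → ℝ} (hw : MemLp w 2 (cylMeasure S T)) :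
    MemLp ((S ×ˢ univ).indicator w) 2 (weightedMeasure T lam) := by
  rw [memLp_weightedMeasure_iff hlam.out, memLp_indicator_iff_restrict (hS.prod .univ),
    cylMeasure_restrict hS hS']
  exact hw

/-- Restriction of a function to `S × ℝ`, as a linear map. -/
def indicatorLinear (S : Set ℝ) : (ℝ × ℝ → ℝ) →ₗ[ℝ] (ℝ × ℝ → ℝ) where
  toFun := (S ×ˢ univ).indicator
  map_add' f g := indicator_add _ f g
  map_smul' c f := indicator_const_smul _ c f

theorem component_inl (k : Fin 2) (f : L2Q T lam) :
    component T lam k ((ContinuousLinearMap.inl ℝ ℝ ℝ).compLpL 2 (weightedMeasure T lam) f) =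
      if k = 0 then f else 0 := by
  have h1 : (ContinuousLinearMap.inl ℝ ℝ ℝ).compLpL 2 (weightedMeasure T lam) f =
      ofComponents ![f, 0] := by simp [ofComponents]
  rw [h1, component_ofComponents]
  fin_cases k <;> simp

theorem norm_inl_le (f : L2Q T lam) :
    ‖(ContinuousLinearMap.inl ℝ ℝ ℝ).compLpL 2 (weightedMeasure T lam) f‖ ≤ ‖f‖ := by
  refine Lp.norm_le_norm_of_ae_le ?_
  filter_upwards [ContinuousLinearMap.coeFn_compLpL (p := 2) (ContinuousLinearMap.inl ℝ ℝ ℝ) f]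
    with z e1
  rw [e1]; simp

/-- The action of the controls of a follower on the state equation, and their costs. -/
theorem Data.Admissible.exists_control_maps {P : Data} (hP : P.Admissible) (lam : ℝ)
    [hlam : Fact (0 ≤ lam)] (i : Fin 2) :
    ∃ (e : P.followerSpace i →ₗ[ℝ] L2Vec P.T lam)
      (ν r : P.followerSpace i →ₗ[ℝ] Lp ℝ 2 (cylMeasure (P.Of i) P.T)) (c : ℝ), 0 < c ∧
      (∀ w k, component P.T lam k (e w) =ᵐ[cylMeasure (Ioo 0 1) P.T]
        fun z => if k = 0 then (P.Of i ×ˢ univ).indicator (w : ℝ × ℝ → ℝ) z else 0) ∧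
      (∀ w, ‖e w‖ ≤ ‖ν w‖) ∧ (∀ w, c * ‖ν w‖ ≤ ‖r w‖) ∧
      (∀ w, ‖ν w‖ ^ 2 = P.normSq i w) ∧
      ∀ w, ‖r w‖ ^ 2 =
        ∫ z in P.Of i ×ˢ Ioo 0 P.T, P.ρ z.2 ^ 2 * |(w : ℝ × ℝ → ℝ) z| ^ 2 := by
  obtain ⟨c, hc, hρ⟩ := hP.ρ_weight.lower
  have hS := hP.Of_measurable i
  have hS' := hP.Of_subset i
  set ν := toLpLinear (m := cylMeasure (P.Of i) P.T) (P.followerSpace i).subtype fun w => w.2.1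
  set r := toLpLinear (m := cylMeasure (P.Of i) P.T)
    (mulLinear (fun z : ℝ × ℝ => P.ρ z.2) ∘ₗ (P.followerSpace i).subtype) fun w => w.2.2
  set ext := toLpLinear (m := weightedMeasure P.T lam)
    (indicatorLinear (P.Of i) ∘ₗ (P.followerSpace i).subtype)
    fun w => memLp_indicator_weightedMeasure hS hS' w.2.1
  refine ⟨((ContinuousLinearMap.inl ℝ ℝ ℝ).compLpL 2 (weightedMeasure P.T lam)).toLinearMap ∘ₗ ext,
    ν, r, c, hc, fun w k => ?_, fun w => ?_, fun w => ?_, fun w => ?_, fun w => ?_⟩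
  · change component P.T lam k ((ContinuousLinearMap.inl ℝ ℝ ℝ).compLpL 2
      (weightedMeasure P.T lam) (ext w)) =ᵐ[cylMeasure (Ioo 0 1) P.T] _
    rw [component_inl, ← ae_weightedMeasure_eq_iff hlam.out]
    split_ifs with hk
    · exact (memLp_indicator_weightedMeasure hS hS' w.2.1).coeFn_toLp
    · exact Lp.coeFn_zero _ _ _
  · refine (norm_inl_le (ext w)).trans ?_
    have h1 : ‖ext w‖ = _ := Lp.norm_toLp _ (memLp_indicator_weightedMeasure hS hS' w.2.1)
    have h2 : ‖ν w‖ = _ := Lp.norm_toLp _ w.2.1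
    rw [h1, h2]
    exact ENNReal.toReal_mono w.2.1.2.ne (eLpNorm_indicator_weightedMeasure_le hS hS' _)
  · have hmem : ∀ᵐ z ∂cylMeasure (P.Of i) P.T, z ∈ P.Of i ×ˢ Ioo 0 P.T :=
      ae_restrict_mem (hS.prod measurableSet_Ioo)
    -- The positive lower bound of `ρ_*` makes the penalty control the plain `L²` norm.
    have h1 : ‖ν w‖ ≤ c⁻¹ * ‖r w‖ := by
      refine Lp.norm_le_mul_norm_of_ae_le_mul ?_
      filter_upwards [MemLp.coeFn_toLp w.2.1, MemLp.coeFn_toLp w.2.2, hmem] with z e1 e2 e3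
      have hνz : ν w z = (w : ℝ × ℝ → ℝ) z := e1
      have hrz : r w z = P.ρ z.2 * (w : ℝ × ℝ → ℝ) z := e2
      have hle := hρ z.2 e3.2
      rw [hνz, hrz, norm_mul, Real.norm_of_nonneg (hc.le.trans hle), ← mul_assoc]
      refine le_mul_of_one_le_left (norm_nonneg _) ?_
      rw [inv_mul_eq_div, one_le_div hc]
      exact hle
    rwa [inv_mul_eq_div, le_div_iff₀ hc, mul_comm] at h1
  · exact norm_toLp_sq w.2.1
  · refine (norm_toLp_sq w.2.2).trans ?_
    refine integral_congr_ae (Eventually.of_forall fun z => ?_)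
    simp only [abs_mul, mul_pow, sq_abs]

/-- The tracking part of the cost of a follower, as a function of the source. -/
theorem exists_tracking_operator [hlam : Fact (0 ≤ lam)] (hS : MeasurableSet S)
    (hS' : S ⊆ Ioo 0 1) {yd : Fin 2 → ℝ × ℝ → ℝ} (hyd : ∀ k, MemLp (yd k) 2 (cylMeasure S T)) :
    ∃ (A : L2Vec T lam →L[ℝ] L2Pair T lam) (d : L2Pair T lam),
      ∀ (Y : L2Vec T lam) (y : Fin 2 → ℝ × ℝ → ℝ),
        (∀ k, y k =ᵐ[cylMeasure (Ioo 0 1) T] component T lam k Y) →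
        ‖A Y - d‖ ^ 2 =
          ∫ z in S ×ˢ Ioo 0 T, (|y 0 z - yd 0 z| ^ 2 + |y 1 z - yd 1 z| ^ 2) := by
  -- The cost is measured without the exponential weight; multiplication by `e^{λt}` undoes the
  -- weight `e^{-2λt}` of the squared norm.
  set κ : ℝ × ℝ → ℝ := (S ×ˢ univ).indicator fun z => Real.exp (lam * z.2) with hκ
  have hexpm : Measurable fun z : ℝ × ℝ => Real.exp (lam * z.2) := by fun_prop
  have hκm : Measurable κ := hexpm.indicator (hS.prod .univ)
  have hκb : ∀ z ∈ cylinder T, ‖κ z‖ ≤ Real.exp (lam * T) := fun z hz => by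
    refine (norm_indicator_le_norm_self _ _).trans ?_
    rw [Real.norm_of_nonneg (Real.exp_pos _).le]
    have := hlam.out
    gcongr
    exact hz.2.2.le
  have hκt : MemLp κ ⊤ (weightedMeasure T lam) :=
    memLp_top_weightedMeasure hκm.aestronglyMeasurable hκb
  have hdm : ∀ k, MemLp (fun z => κ z * (S ×ˢ univ).indicator (yd k) z) 2
      (weightedMeasure T lam) := fun k => by
    have h1 := memLp_indicator_weightedMeasure (lam := lam) hS hS' (hyd k)
    refine h1.of_le_mul (c := Real.exp (lam * T)) (hκm.aestronglyMeasurable.mul h1.1) ?_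
    filter_upwards [ae_weightedMeasure_mem_cylinder] with z hz
    rw [norm_mul]
    gcongr
    exact hκb z hz
  set A₀ := mulOp T lam κ with hA₀
  set d : Fin 2 → L2Q T lam := fun k => (hdm k).toLp with hd
  refine ⟨((WithLp.prodContinuousLinearEquiv 2 ℝ (L2Q T lam) (L2Q T lam)).symm :
    L2Q T lam × L2Q T lam →L[ℝ] L2Pair T lam) ∘L
      ((A₀ ∘L component T lam 0).prod (A₀ ∘L component T lam 1)), WithLp.toLp 2 (d 0, d 1),
      fun Y y hy => ?_⟩
  have hmem : ∀ k, MemLp (fun z => y k z - yd k z) 2 (cylMeasure S T) := fun k => by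
    have h1 := ((memLp_weightedMeasure_iff hlam.out).1 (Lp.memLp (component T lam k Y))).ae_eq
      (hy k).symm
    exact (h1.mono_measure (cylMeasure_mono hS')).sub (hyd k)
  have hk : ∀ k, ‖A₀ (component T lam k Y) - d k‖ ^ 2 =
      ∫ z, |y k z - yd k z| ^ 2 ∂cylMeasure S T := fun k => by
    rw [← real_inner_self_eq_norm_sq, inner_toLp_weightedMeasure, ← cylMeasure_restrict hS hS',
      ← integral_indicator (hS.prod .univ)]
    refine integral_congr_ae ?_
    filter_upwards [(ae_weightedMeasure_eq_iff hlam.out).1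
      (Lp.coeFn_sub (A₀ (component T lam k Y)) (d k)),
      (ae_weightedMeasure_eq_iff hlam.out).1 (coeFn_mulOp hκt (component T lam k Y)),
      (ae_weightedMeasure_eq_iff hlam.out).1 (hdm k).coeFn_toLp, hy k] with z e1 e2 e3 e4
    rw [e1, Pi.sub_apply, e2, e3, ← e4]
    by_cases hz : z ∈ S ×ˢ (univ : Set ℝ)
    · rw [indicator_of_mem hz, indicator_of_mem hz, hκ, indicator_of_mem hz, sq_abs]
      have : Real.exp (-(2 * lam * z.2)) * (Real.exp (lam * z.2) * Real.exp (lam * z.2)) = 1 := by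
        rw [← Real.exp_add, ← Real.exp_add, ← Real.exp_zero]
        congr 1
        ring
      linear_combination (y k z - yd k z) ^ 2 * this
    · rw [indicator_of_notMem hz, indicator_of_notMem hz, hκ, indicator_of_notMem hz]
      ring
  have hint : ∀ k, Integrable (fun z => |y k z - yd k z| ^ 2) (cylMeasure S T) := fun k =>
    (hmem k).abs.integrable_sq
  rw [WithLp.prod_norm_sq_eq_of_L2]
  change ‖A₀ (component T lam 0 Y) - d 0‖ ^ 2 + ‖A₀ (component T lam 1 Y) - d 1‖ ^ 2 = _
  rw [hk, hk, ← integral_add (hint 0) (hint 1)]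
  rfl

end Controls

/-! ### Assembly of the cost structure and the main theorem. -/

section MainResult

open scoped InnerProductSpace

theorem Data.source_update (P : Data) (h : ℝ × ℝ → ℝ) (v : Fin 2 → ℝ × ℝ → ℝ) (i k : Fin 2)
    (w : ℝ × ℝ → ℝ) (z : ℝ × ℝ) :
    P.source h (Function.update v i w) k z = P.source h v k z +
      if k = 0 then (P.Of i ×ˢ univ).indicator (w - v i) z else 0 := by
  unfold Data.source
  split_ifs with hk
  · rw [add_assoc, Fin.sum_univ_two, Fin.sum_univ_two, indicator_sub']
    fin_cases i
    · simp; ring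
    · simp
  · simp

/-- The dependence of the costs on the controls and on the source. -/
theorem Data.Admissible.exists_cost_structure {P : Data} (hP : P.Admissible) {h : ℝ × ℝ → ℝ}
    (hh : MemLp h 2 (cylMeasure P.O P.T)) :
    ∃ (lam : ℝ) (e : ∀ i, P.followerSpace i →ₗ[ℝ] L2Vec P.T lam)
      (ν r : ∀ i, P.followerSpace i →ₗ[ℝ] Lp ℝ 2 (cylMeasure (P.Of i) P.T))
      (Q : Fin 2 → L2Vec P.T lam → ℝ) (q₁ : Fin 2 → L2Vec P.T lam → L2Vec P.T lam →L[ℝ] ℝ)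
      (q₂ : Fin 2 → L2Vec P.T lam → L2Vec P.T lam →L[ℝ] L2Vec P.T lam →L[ℝ] ℝ)
      (M c : Fin 2 → ℝ) (H : ℝ), (∀ i w, ‖ν i w‖ ^ 2 = P.normSq i w) ∧
      ∀ (μ : Fin 2 → ℝ) (_ : ∀ i, 0 ≤ μ i) (w₀ : ∀ i, P.followerSpace i), ∃ s : L2Vec P.T lam,
        ‖s‖ ≤ H + ∑ i, ‖ν i (w₀ i)‖ ∧
        ∀ i, IsPenalized (fun w : P.followerSpace i =>
            P.partialJ μ h (fun j => (w₀ j : ℝ × ℝ → ℝ)) i w) (Q i) (q₁ i) (q₂ i) (e i) (ν i) (r i)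
          (w₀ i) s (P.α i) (M i) (c i) (μ i) := by
  obtain ⟨lam, hlam, y₀, S, 𝒩, d𝒩, dd𝒩, C, Φ, hpert, hΦ, hstate⟩ := hP.exists_state_operator
  choose e ν r c hc he heν hνr hν hr using fun i => hP.exists_control_maps lam i
  have hyd : ∀ i k, MemLp (P.yd i k) 2 (cylMeasure (P.Od i) P.T) := fun i k => by
    have : IsFiniteMeasure (cylMeasure (P.Od i) P.T) :=
      isFiniteMeasure_of_le _ (cylMeasure_mono (hP.Od_subset i))
    exact (hP.yd_bounded i k).mono_exponent le_top
  choose A d hA using fun i => exists_tracking_operator (lam := lam) (hP.Od_measurable i)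
    (hP.Od_subset i) (hyd i)
  choose q₁ q₂ M hM0 hq₁ hq₂ hQle hq₁le hq₂le using fun i =>
    hpert.exists_tracking_derivs hΦ (A i ∘L S) (A i y₀ - d i)
  have hhm := memLp_indicator_weightedMeasure (lam := lam) hP.O_measurable hP.O_subset hh
  set sH : L2Vec P.T lam :=
    (ContinuousLinearMap.inl ℝ ℝ ℝ).compLpL 2 (weightedMeasure P.T lam) hhm.toLp with hsH
  -- All operators and constants are fixed before `μ` and `w₀` are introduced. Only the source `s`
  -- depends on the controls.
  refine ⟨lam, e, ν, r, fun i f => 1 / 2 * ‖A i y₀ - d i + (A i ∘L S) (Φ f)‖ ^ 2, q₁, q₂, M, c,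
    ‖sH‖, hν, fun μ hμ w₀ => ?_⟩
  set v : Fin 2 → ℝ × ℝ → ℝ := fun j => (w₀ j : ℝ × ℝ → ℝ) with hv
  set s := sH + ∑ i, e i (w₀ i) with hs
  have hsrc : ∀ k, component P.T lam k s =ᵐ[cylMeasure (Ioo 0 1) P.T] P.source h v k := fun k => by
    have h1 : component P.T lam k sH =ᵐ[cylMeasure (Ioo 0 1) P.T]
        fun z => if k = 0 then (P.O ×ˢ univ).indicator h z else 0 := by
      rw [hsH, component_inl, ← ae_weightedMeasure_eq_iff hlam.out]
      split_ifs with hk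
      · exact hhm.coeFn_toLp
      · exact Lp.coeFn_zero _ _ _
    rw [hs, Fin.sum_univ_two, map_add, map_add]
    filter_upwards [h1, he 0 (w₀ 0) k, he 1 (w₀ 1) k, (ae_weightedMeasure_eq_iff hlam.out).1
      (Lp.coeFn_add (component P.T lam k sH)
        (component P.T lam k (e 0 (w₀ 0)) + component P.T lam k (e 1 (w₀ 1)))),
      (ae_weightedMeasure_eq_iff hlam.out).1
      (Lp.coeFn_add (component P.T lam k (e 0 (w₀ 0))) (component P.T lam k (e 1 (w₀ 1))))]
      with z e1 e2 e3 e4 e5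
    rw [e4, Pi.add_apply, e5, Pi.add_apply, e1, e2, e3, Data.source, Fin.sum_univ_two]
    split_ifs <;> simp [hv]
  refine ⟨s, (norm_add_le _ _).trans ?_, fun i => ⟨fun w => ?_, hP.α_pos i, hc i, hM0 i, hμ i,
    heν i, hνr i, hq₁ i, hq₂ i, fun f => by positivity, hQle i, hq₁le i, hq₂le i⟩⟩
  · gcongr
    exact (norm_sum_le _ _).trans (Finset.sum_le_sum fun i _ => heν i _)
  · have hsw : ∀ k, component P.T lam k (s + e i (w - w₀ i)) =ᵐ[cylMeasure (Ioo 0 1) P.T]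
        P.source h (Function.update v i w) k := fun k => by
      rw [map_add]
      filter_upwards [hsrc k, he i (w - w₀ i) k, (ae_weightedMeasure_eq_iff hlam.out).1
        (Lp.coeFn_add (component P.T lam k s) (component P.T lam k (e i (w - w₀ i))))]
        with z e1 e2 e3
      rw [e3, Pi.add_apply, e1, e2, P.source_update]
      rfl
    have hcost := hA i _ _ (hstate h (Function.update v i w) _ hsw)
    have hnorm : A i y₀ - d i + (A i ∘L S) (Φ (s + e i (w - w₀ i))) =
        A i (y₀ + S (Φ (s + e i (w - w₀ i)))) - d i := by
      rw [map_add, ContinuousLinearMap.comp_apply]; abel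
    simp only [hnorm]
    rw [hcost, hr, Data.partialJ, Data.J, Function.update_self]
    ring

end MainResult

end StackelbergNash

end

theorem mainTheorem2 (P : StackelbergNash.Data) (hP : P.Admissible) (h : ℝ × ℝ → ℝ)
    (hh : MeasureTheory.MemLp h 2 (StackelbergNash.cylMeasure P.O P.T)) :
    ∃ C > 0, ∀ R > 0, ∃ μ₀ > 0, ∀ μ : Fin 2 → ℝ, (∀ i, μ₀ ≤ μ i) →
      ∀ v : Fin 2 → ℝ × ℝ → ℝ, P.IsNashQuasiEquilibrium μ h v →
        (∀ i, ∃ D : P.followerSpace i →ₗ[ℝ] P.followerSpace i →ₗ[ℝ] ℝ,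
          (∀ δ η : P.followerSpace i,
            StackelbergNash.HasSecondGateauxDeriv (P.partialJ μ h v i) (v i)
              (δ : ℝ × ℝ → ℝ) (η : ℝ × ℝ → ℝ) (D δ η)) ∧
          ∀ δ : P.followerSpace i, C * P.normSq i (δ : ℝ × ℝ → ℝ) ≤ D δ δ) ∧
        (∀ i, ConvexOn ℝ {w | w ∈ P.followerSpace i ∧ P.normSq i (w - v i) ≤ R ^ 2}
          (P.partialJ μ h v i)) ∧
        P.IsNashEquilibrium μ h v := by
  obtain ⟨lam, e, ν, r, Q, q₁, q₂, M, c, H, hν, hpen⟩ := hP.exists_cost_structure hh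
  -- The trivial instance serves only to extract the signs of the constants, none of which depends
  -- on `μ`.
  obtain ⟨s₀, hs₀, hpen₀⟩ := hpen 0 (fun _ => le_rfl) 0
  have hH0 : 0 ≤ H := by simpa using (norm_nonneg s₀).trans hs₀
  have hc : ∀ i, 0 < c i := fun i => (hpen₀ i).c_pos
  have hαM : ∀ i, 0 ≤ P.α i * M i := fun i => mul_nonneg (hP.α_pos i).le (hpen₀ i).M_nonneg
  set K := ∑ i, P.α i * M i with hK
  have hKi : ∀ i, P.α i * M i ≤ K := fun i =>
    Finset.single_le_sum (f := fun i => P.α i * M i) (fun j _ => hαM j) (Finset.mem_univ i)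
  have hK0 : 0 ≤ K := (hαM 0).trans (hKi 0)
  set κ := min (c 0) (c 1) with hκ
  have hκ0 : 0 < κ := lt_min (hc 0) (hc 1)
  have hκi : ∀ i, κ ≤ c i := fun i => by
    fin_cases i
    · exact min_le_left _ _
    · exact min_le_right _ _
  refine ⟨1, one_pos, fun R hR => ?_⟩
  -- The summands serve, in order, the coercivity constant `1`, the smallness of the equilibrium,
  -- convexity on balls of radius up to `R + 2`, and the comparison with the zero control.
  set Λ := 1 + 2 * K * (2 + H) + K * (4 + H + R) + 2 * (K * (3 + H) ^ 2) with hΛ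
  have hΛ0 : 0 < Λ := by positivity
  refine ⟨Λ / κ ^ 2, by positivity, fun μ hμ v hv => ?_⟩
  have hμ0 : ∀ i, 0 ≤ μ i := fun i => le_trans (by positivity) (hμ i)
  have hμΛ : ∀ i, Λ ≤ μ i * c i ^ 2 := fun i => by
    have h1 := (div_le_iff₀ (by positivity)).1 (hμ i)
    refine h1.trans ?_
    have := hμ0 i
    have := hκi i
    gcongr
  obtain ⟨s, hs, hJ⟩ := hpen μ hμ0 fun i => ⟨v i, (hv i).1⟩
  have hcrit : ∀ i (δ : P.followerSpace i), HasDerivAt (fun t : ℝ =>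
      P.partialJ μ h v i (((⟨v i, (hv i).1⟩ + t • δ : P.followerSpace i)) : ℝ × ℝ → ℝ)) 0 0 :=
    fun i δ => (hv i).2 δ δ.2
  have p1 : 0 ≤ 2 * K * (2 + H) := by positivity
  have p2 : 0 ≤ K * (4 + H + R) := by positivity
  have p3 : 0 ≤ 2 * (K * (3 + H) ^ 2) := by positivity
  rw [Fin.sum_univ_two] at hs
  set n : Fin 2 → ℝ := fun i => ‖ν i ⟨v i, (hv i).1⟩‖ with hn
  have hn0 : ∀ i, 0 ≤ n i := fun i => norm_nonneg _
  have hs' : ‖s‖ ≤ H + (n 0 + n 1) := hs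
  -- The source contains both followers, so the two critical point bounds are coupled and have to be
  -- added. If `n 0 + n 1 > 1`, the sum of the right-hand sides is at most `2 K (2 + H) (n 0 + n
  -- 1)`, which is too small for the left-hand side.
  have hsmall : n 0 + n 1 ≤ 1 := by
    have h1 : ∀ i, Λ * n i ≤ K * (1 + H + (n 0 + n 1)) := fun i => by
      have h2 := (hJ i).norm_critical_le (hcrit i)
      calc Λ * n i ≤ μ i * c i ^ 2 * n i := by
            exact mul_le_mul_of_nonneg_right (hμΛ i) (hn0 i)
        _ ≤ P.α i * M i * (1 + ‖s‖) := h2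
        _ ≤ K * (1 + H + (n 0 + n 1)) := by
            exact mul_le_mul (hKi i) (by linarith) (by positivity) hK0
    by_contra! hlt
    have h2 := h1 0
    have h3 := h1 1
    have h4 : (1 + 2 * K * (2 + H)) * (n 0 + n 1) ≤ Λ * (n 0 + n 1) := by
      exact mul_le_mul_of_nonneg_right (by linarith) (by linarith)
    nlinarith [mul_nonneg hK0 hH0, mul_nonneg (mul_nonneg hK0 hH0) (sub_nonneg.2 hlt.le),
      mul_nonneg hK0 (sub_nonneg.2 hlt.le)]
  have hs1 : ‖s‖ ≤ H + 1 := by linarith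
  have hni : ∀ i, n i ≤ 1 := fun i => by
    fin_cases i
    · exact le_trans (by simpa using hn0 1) hsmall
    · exact le_trans (by simpa using hn0 0) hsmall
  have hball : ∀ i, ∀ R', R' ≤ R + 2 → 1 + P.α i * M i * (1 + ‖s‖ + R') ≤ μ i * c i ^ 2 := by
    intro i R' hR'
    have h1 : P.α i * M i * (1 + ‖s‖ + R') ≤ P.α i * M i * (4 + H + R) := by
      have := hαM i
      gcongr ?_ * ?_
      linarith
    have h2 : P.α i * M i * (4 + H + R) ≤ K * (4 + H + R) := by
      gcongr
      exact hKi i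
    linarith [hμΛ i]
  refine ⟨fun i => ?_, fun i => ?_, fun i => ⟨(hv i).1, fun w hw => ?_⟩⟩
  · obtain ⟨D, hD, hD'⟩ := (hJ i).exists_coercive_second_deriv
      (by simpa using hball i 0 (by linarith))
    refine ⟨D, fun δ η => (hD δ η).of_submodule, fun δ => ?_⟩
    rw [one_mul, ← hν]
    exact hD' δ
  · have hset : {w | w ∈ P.followerSpace i ∧ P.normSq i (w - v i) ≤ R ^ 2} =
        Subtype.val '' {w : P.followerSpace i | ‖ν i (w - ⟨v i, (hv i).1⟩)‖ ≤ R} := by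
      ext w
      constructor
      · rintro ⟨hw, hwR⟩
        exact ⟨⟨w, hw⟩, le_of_sq_le_sq (by rw [hν]; exact hwR) hR.le, rfl⟩
      · rintro ⟨u, hu, rfl⟩
        refine ⟨u.2, ?_⟩
        have := pow_le_pow_left₀ (norm_nonneg _) hu 2
        rwa [hν] at this
    rw [hset]
    exact StackelbergNash.convexOn_of_submodule ((hJ i).convexOn_ball (hball i R (by linarith)))
  -- Here the radius 2 is used instead of `R`; it is covered because `hball` reaches up to `R + 2`.
  · have h1 := (hJ i).le_of_critical (hcrit i) (hni i) (hball i 2 (by linarith)) (by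
      have h2 : P.α i * M i * (2 + ‖s‖) ^ 2 ≤ K * (3 + H) ^ 2 := by
        gcongr ?_ * ?_ ^ 2
        · exact hKi i
        · linarith
      linarith [hμΛ i]) ⟨w, hw⟩
    have h2 : P.partialJ μ h v i (v i) = P.J μ h i v := by
      rw [StackelbergNash.Data.partialJ, Function.update_eq_self]
    rw [← h2]
    exact h1
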